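/- Let $n>1$ and let $G=G_1\times\dots\times G_n$ be a product of topological groups which is locally compact (Hausdorff) and compactly generated. Let $\Gamma\le G$ be a uniform lattice, i.e. a discrete subgroup such that $G/\Gamma$ is compact, and assume that $\Gamma$ is irreducible, meaning that $\Gamma\cdot\prod_{j\ne i}G_j$ is dense in $G$ for every $1\le i\le n$. Let $X$ be a complete metric space which is: (a) Busemann non-positively curved: $X$ is geodesic and for any two constant speed geodesics $c,c':[0,1]\to X$ the function $t\mapsto d(c(t),c'(t))$ is convex (in particular $X$ is uniquely geodesic; write $\frac{x+y}{2}$ for the midpoint of $x$ and $y$); (b) uniformly convex: for every $\epsilon>0$ there is $\delta(\epsilon)>0$ such that for all $r>0$ and all $x,y_1,y_2\in X$ with $d(x,y_1)\le r$, $d(x,y_2)\le r$ and $d(y_1,y_2)\ge\epsilon r$ one has $r-d\bigl(x,\frac{y_1+y_2}{2}\bigr)\ge\delta(\epsilon)\,r$; (c) without non-trivial Clifford isometries: every surjective isometry $T:X\to X$ for which $x\mapsto d(x,T(x))$ is constant is the identity. Let $\Gamma$ act on $X$ by isometries. Assume that the action has no global fixed point and is reduced, i.e. there is no unbounded closed convex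 proper subset $Y\subsetneq X$ such that the Hausdorff distance between $Y$ and $\gamma Y$ is finite for every $\gamma\in\Gamma$. Then there is exactly one continuous action of $G$ on $X$ by isometries which extends the action of $\Gamma$, and this $G$-action factors through one of the $G_i$: for some $i$ it is the composition of the projection $G\to G_i$ with a continuous isometric action of $G_i$ on $X$. -/

import Mathlib

open scoped Pointwise

namespace Superrigidity

section Spaces

/-- `c`, restricted to `[0, 1]`, is a (minimizing) geodesic parametrized with constant speed. -/
def IsConstSpeedGeodesic {X : Type*} [MetricSpace X] (c : ℝ → X) : Prop :=
  ∀ s ∈ Set.Icc (0 : ℝ) 1, ∀ t ∈ Set.Icc (0 : ℝ) 1,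
    dist (c s) (c t) = |s - t| * dist (c 0) (c 1)

/-- Busemann non-positive curvature: the space is geodesic, and the distance between any two
constant speed geodesics is a convex function. (Completeness is a separate hypothesis.) -/
structure IsBNPC (X : Type*) [MetricSpace X] : Prop where
  exists_geodesic : ∀ x y : X, ∃ c : ℝ → X, IsConstSpeedGeodesic c ∧ c 0 = x ∧ c 1 = y
  convex_dist : ∀ c c' : ℝ → X, IsConstSpeedGeodesic c → IsConstSpeedGeodesic c' →
    ConvexOn ℝ (Set.Icc (0 : ℝ) 1) (fun t => dist (c t) (c' t))

/-- `m` is a midpoint of `x` and `y`. -/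
def IsMidpoint {X : Type*} [MetricSpace X] (m x y : X) : Prop :=
  dist x m = dist x y / 2 ∧ dist m y = dist x y / 2

/-- Uniform convexity: for every `ε > 0` there is `δ > 0` such that, for all `r > 0` and `x`, the
modulus of convexity `inf {r - d(x, (y₁ + y₂)/2) : d(x, yᵢ) ≤ r, d(y₁, y₂) ≥ ε r}` is at least
`δ r` (the infimum of the empty set being `+∞`). -/
def IsUniformlyConvex (X : Type*) [MetricSpace X] : Prop :=
  ∀ ε : ℝ, 0 < ε → ∃ δ : ℝ, 0 < δ ∧ ∀ r : ℝ, 0 < r → ∀ x y₁ y₂ m : X,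
    dist x y₁ ≤ r → dist x y₂ ≤ r → ε * r ≤ dist y₁ y₂ → IsMidpoint m y₁ y₂ →
      δ * r ≤ r - dist x m

/-- A subset of a geodesic space is convex if it contains every geodesic joining two of its
points. -/
def IsGeodesicallyConvex {X : Type*} [MetricSpace X] (Y : Set X) : Prop :=
  ∀ c : ℝ → X, IsConstSpeedGeodesic c → c 0 ∈ Y → c 1 ∈ Y →
    ∀ t ∈ Set.Icc (0 : ℝ) 1, c t ∈ Y

/-- A Clifford isometry: a surjective isometry with constant displacement. -/
def IsClifford {X : Type*} [MetricSpace X] (T : X ≃ᵢ X) : Prop :=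
  ∃ a : ℝ, ∀ x : X, dist x (T x) = a

end Spaces

section Actions

/-- The isometric action `ρ` is reduced: no unbounded closed convex proper subset is at finite
Hausdorff distance from all its translates. -/
def IsReduced {H X : Type*} [Group H] [MetricSpace X] (ρ : H →* (X ≃ᵢ X)) : Prop :=
  ¬ ∃ Y : Set X, ¬ Bornology.IsBounded Y ∧ IsClosed Y ∧ IsGeodesicallyConvex Y ∧
    Y ≠ Set.univ ∧ ∀ h : H, Metric.hausdorffEDist Y (ρ h '' Y) ≠ ⊤

/-- The isometric action `ρ` has a global fixed point. -/
def HasGlobalFixedPoint {H X : Type*} [Group H] [MetricSpace X] (ρ : H →* (X ≃ᵢ X)) : Prop :=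
  ∃ x : X, ∀ h : H, ρ h x = x

/-- The isometric action `α` is (jointly) continuous. -/
def IsContinuousAction {H X : Type*} [Group H] [TopologicalSpace H] [MetricSpace X]
    (α : H →* (X ≃ᵢ X)) : Prop :=
  Continuous (fun p : H × X => α p.1 p.2)

/-- The action `α` of `H` extends the action `ρ` of the subgroup `Γ`. -/
def Extends {H X : Type*} [Group H] [MetricSpace X] {Γ : Subgroup H}
    (α : H →* (X ≃ᵢ X)) (ρ : Γ →* (X ≃ᵢ X)) : Prop :=
  ∀ γ : Γ, α (γ : H) = ρ γ

end Actions

section Lattices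

/-- A topological group generated by a compact subset. -/
def IsCompactlyGeneratedGroup (H : Type*) [Group H] [TopologicalSpace H] : Prop :=
  ∃ K : Set H, IsCompact K ∧ Subgroup.closure K = ⊤

/-- A uniform lattice: a discrete subgroup with compact quotient. -/
def IsUniformLattice {H : Type*} [Group H] [TopologicalSpace H] (Γ : Subgroup H) : Prop :=
  DiscreteTopology Γ ∧ CompactSpace (H ⧸ Γ)

/-- A subgroup of `∏ᵢ Gᵢ` is irreducible if `Γ · ∏_{j ≠ i} Gⱼ` is dense for each `i`; here
`∏_{j ≠ i} Gⱼ` is the kernel of the projection to the `i`-th factor. -/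
def IsIrreducible {n : ℕ} {G : Fin n → Type*} [∀ i, Group (G i)] [∀ i, TopologicalSpace (G i)]
    (Γ : Subgroup (∀ i, G i)) : Prop :=
  ∀ i, Dense ((Γ : Set (∀ i, G i)) * ((Pi.evalMonoidHom G i).ker : Set (∀ i, G i)))

/-- The action `α` of `∏ᵢ Gᵢ` factors through (the projection to) the factor `Gᵢ`. -/
def FactorsThrough {n : ℕ} {G : Fin n → Type*} [∀ i, Group (G i)] [∀ i, TopologicalSpace (G i)]
    {X : Type*} [MetricSpace X] (α : (∀ i, G i) →* (X ≃ᵢ X)) (i : Fin n) : Prop :=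
  ∃ αi : G i →* (X ≃ᵢ X), IsContinuousAction αi ∧ ∀ g : (∀ i, G i), α g = αi (g i)

end Lattices

end Superrigidity

/-!
The proof replaces the lattice `Γ` by the ambient group. Let `Y` be the space of square-integrable
`Γ`-equivariant maps `G → X`, defined as the completion of the continuous ones (which exist by a
barycentre construction, `nonempty_equivMap`) for the `L²`-distance over `G ⧸ Γ` with its invariant
probability measure (`exists_invariant_measure`). Convexity and uniform convexity of `X` are
inequalities between distances and squared distances, see `MidSpace`, and are therefore inherited by
`Y`. The group `G` acts on `Y` by translations, isometrically and continuously. Besides its distance,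
`Y` carries the finer datum of the function `gΓ ↦ d(f(g), f'(g))` in `L²(G ⧸ Γ)`, called `gapL2`.

Properness. As the action on `X` is reduced, has no fixed point, and `X` has no nontrivial Clifford isometries,
the points moved by a bounded amount by generators of `Γ` form a bounded set
(`IsReduced.isBounded_displacement`). Averaging over `G` carries this over to `Y`
(`exists_isBounded_displacement`), and by convexity the displacements under a compact subset of `G`
then grow linearly with the distance to a base point (`exists_linear_growth`).

One factor. Let `A` be one of the factors of `G` and `B` the product of the others. Starting from
a continuous map `u₀`, consider the maps which each element of `B` moves, uniformly, no more
than it moves `u₀`. Linear growth yields a minimal `A`-invariant closed convex set `C` of such maps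
(`exists_minimal_tameMaps`). By minimality and the strict convexity of `L²`, every `b ∈ B` moves
all points of `C` in the same way, and the functions `d(f(g), f'(g))` with `f, f' ∈ C` are invariant
under `B`. By irreducibility `B` acts ergodically on `G ⧸ Γ` (`eq_const_of_invariant`), so that these
functions are constant. Consequently the points of `C` are moved uniformly little by small elements
of `G`, and are continuous maps (`exists_toL2_eq_of_modulus`, `exists_coe_eq_of_modulus`), which can
be evaluated at points.

If `C` is bounded it is a single map, fixed by `A`. If `C` is unbounded, then evaluation at any point
embeds `C` isometrically into `X`, onto a closed convex set at finite distance from its translates,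
hence onto `X` by reducedness. Comparing the evaluations at `x` and `b x` with `b ∈ B` gives a Clifford
isometry of `X`; it is trivial, and the maps in `C` are invariant under `B`. This alternative is
`exists_fixed_or_tendsto`. In the second case the values of such a map are points of `X` whose
`Γ`-orbit maps are continuous for the topology induced from `A`, and minimality of the action extends
this to all points and to the closure of the projection of `Γ`, which is `A`
(`IsReduced.exists_continuous_extension`). The first case cannot occur for all factors: treating them
one after the other, while keeping the invariance already obtained, would lead to a constant
equivariant map, i.e. to a fixed point of `Γ` (`exists_tendsto_dist`).

Uniqueness. For two extensions `α` and `β`, the distance in `Y` of the orbit maps `g ↦ α(g)⁻¹ x` and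
`g ↦ β(g)⁻¹ x` is a convex `Γ`-invariant function of `x`, hence constant, and strict convexity of
`L²` shows that each `α(g) β(g)⁻¹` is a Clifford isometry (`eq_of_extends`).
-/

namespace Superrigidity

open Filter Topology MeasureTheory

/-! ### Uniformly convex midpoint spaces -/

/-- A metric space with a choice of midpoints whose metric is convex in the sense of Busemann and
uniformly convex. The uniform convexity `uc` is stated as an inequality that is linear in the
squared distances: in this form it survives integration, hence passes to `L²` spaces of maps,
and also to completions. -/
class MidSpace (Z : Type*) [MetricSpace Z] where
  /-- the midpoint -/
  mid : Z → Z → Z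
  dist_left_mid : ∀ x y : Z, dist x (mid x y) = dist x y / 2
  dist_mid_right : ∀ x y : Z, dist (mid x y) y = dist x y / 2
  dist_mid_mid_le : ∀ x y x' y' : Z,
    dist (mid x y) (mid x' y') ≤ (dist x x' + dist y y') / 2
  uc : ∀ ε : ℝ, 0 < ε → ∃ c : ℝ, 0 < c ∧ ∀ x y z : Z,
    dist x (mid y z) ^ 2 + c * dist y z ^ 2 ≤ (1 / 2 + c * ε) * (dist x y ^ 2 + dist x z ^ 2)

section Basic

open MidSpace

variable {Z : Type*} [MetricSpace Z] [MidSpace Z]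

theorem mid_self (x : Z) : mid x x = x := by
  have h := dist_left_mid x x
  rw [dist_self, zero_div] at h
  exact (dist_eq_zero.1 h).symm

/-- The form in which the error term `ε` in the inequality `MidSpace.uc` is removed. -/
theorem eq_zero_of_sq_le_mul {e M : ℝ} (h : ∀ ε : ℝ, 0 < ε → e ^ 2 ≤ ε * M) : e = 0 := by
  have hM : 0 ≤ M := by nlinarith [h 1 one_pos, sq_nonneg e]
  have h0 : e ^ 2 ≤ 0 := by
    refine le_of_forall_pos_le_add fun η hη => ?_
    have h1 := h (η / (M + 1)) (by positivity)
    have h2 : η / (M + 1) * M ≤ η := by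
      rw [div_mul_eq_mul_div, div_le_iff₀ (by positivity)]
      nlinarith
    linarith
  nlinarith [pow_eq_zero_iff (two_ne_zero) |>.1 (le_antisymm h0 (sq_nonneg e))]

/-- Midpoints are unique, as a consequence of uniform convexity. -/
theorem eq_mid {x y m : Z} (h1 : dist x m = dist x y / 2) (h2 : dist m y = dist x y / 2) :
    m = mid x y := by
  rw [← dist_eq_zero]
  refine eq_zero_of_sq_le_mul (M := dist x y ^ 2) fun ε hε => ?_
  obtain ⟨c, hc, H⟩ := uc (Z := Z) ε hε
  have e1 := H x m (mid x y)
  have e2 := H y m (mid x y)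
  rw [h1, dist_left_mid] at e1
  rw [dist_comm y m, h2, dist_comm y (mid x y), dist_mid_right] at e2
  have e3 := dist_triangle_right x y (mid m (mid x y))
  have e4 : dist x y ^ 2 ≤ 2 * (dist x (mid m (mid x y)) ^ 2 + dist y (mid m (mid x y)) ^ 2) := by
    have := sq_nonneg (dist x (mid m (mid x y)) - dist y (mid m (mid x y)))
    have := pow_le_pow_left₀ dist_nonneg e3 2
    nlinarith
  have e5 : c * dist m (mid x y) ^ 2 ≤ c * (ε * dist x y ^ 2) := by
    nlinarith [mul_nonneg (mul_nonneg hc.le hε.le) (sq_nonneg (dist x y))]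
  exact le_of_mul_le_mul_left e5 hc

theorem map_mid (T : Z ≃ᵢ Z) (x y : Z) : T (mid x y) = mid (T x) (T y) := by
  apply eq_mid
  · rw [T.dist_eq, T.dist_eq, dist_left_mid]
  · rw [T.dist_eq, T.dist_eq, dist_mid_right]

theorem continuous_mid : Continuous fun p : Z × Z => mid p.1 p.2 := by
  refine (LipschitzWith.of_dist_le_mul (K := 1) fun p q => ?_).continuous
  refine (dist_mid_mid_le _ _ _ _).trans ?_
  have h1 : dist p.1 q.1 ≤ dist p q := le_max_left _ _
  have h2 : dist p.2 q.2 ≤ dist p q := le_max_right _ _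
  simp only [NNReal.coe_one, one_mul]
  linarith

/-- A set is midpoint convex if it contains the midpoint of any two of its points. -/
def MidConvex (C : Set Z) : Prop := ∀ x ∈ C, ∀ y ∈ C, mid x y ∈ C

/-- A real function on `Z` is midpoint convex if its value at a midpoint is at most the mean of its
values at the endpoints. -/
def MidConvexFun (F : Z → ℝ) : Prop := ∀ x y, F (mid x y) ≤ (F x + F y) / 2

theorem MidConvexFun.midConvex_le {F : Z → ℝ} (hF : MidConvexFun F) (a : ℝ) :
    MidConvex {x | F x ≤ a} := by
  intro x hx y hy
  have := hF x y
  simp only [Set.mem_ofPred_eq] at *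
  linarith

theorem midConvexFun_dist_isometry (T : Z ≃ᵢ Z) : MidConvexFun fun x => dist x (T x) := by
  intro x y
  simp only [map_mid]
  exact dist_mid_mid_le _ _ _ _

theorem dist_iterate_mid (x y : Z) (n : ℕ) : dist x ((mid x)^[n] y) = dist x y / 2 ^ n := by
  induction n with
  | zero => simp
  | succ n ih => rw [Function.iterate_succ_apply', dist_left_mid, ih, pow_succ, div_div]

theorem MidConvexFun.iterate_mid_le {F : Z → ℝ} (hF : MidConvexFun F) (x y : Z) (n : ℕ) :
    F ((mid x)^[n] y) ≤ F x + (F y - F x) / 2 ^ n := by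
  induction n with
  | zero => simp
  | succ n ih =>
    rw [Function.iterate_succ_apply', pow_succ, ← div_div]
    have := hF x ((mid x)^[n] y)
    linarith

/-- Uniform convexity of a function, in the form satisfied by squared distances to a point and
by their averages. -/
def UCFun (Ψ : Z → ℝ) : Prop :=
  ∀ ε : ℝ, 0 < ε → ∃ c : ℝ, 0 < c ∧ ∀ y z : Z,
    Ψ (mid y z) + c * dist y z ^ 2 ≤ (1 / 2 + c * ε) * (Ψ y + Ψ z)

theorem ucFun_dist_sq (x : Z) : UCFun fun y => dist x y ^ 2 := fun ε hε => by
  obtain ⟨c, hc, H⟩ := uc (Z := Z) ε hε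
  exact ⟨c, hc, fun y z => H x y z⟩

/-- Near-minimizers of a uniformly convex function are close to each other. -/
theorem UCFun.exists_dist_le {Ψ : Z → ℝ} (hΨ : UCFun Ψ) (M : ℝ) {η : ℝ} (hη : 0 < η) :
    ∃ δ : ℝ, 0 < δ ∧ ∀ (m : ℝ) (y z : Z), m ≤ M → Ψ y ≤ m + δ → Ψ z ≤ m + δ →
      m ≤ Ψ (mid y z) → dist y z ≤ η := by
  obtain ⟨c, hc, H⟩ := hΨ (η ^ 2 / (4 * (|M| + 1))) (by positivity)
  refine ⟨min 1 (c * η ^ 2 / 2), by positivity, fun m y z hm hy hz hmid => ?_⟩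
  set ε := η ^ 2 / (4 * (|M| + 1)) with hε
  set δ := min 1 (c * η ^ 2 / 2)
  have hε0 : 0 < ε := by positivity
  have hδ1 : δ ≤ 1 := min_le_left _ _
  have hδ2 : δ ≤ c * η ^ 2 / 2 := min_le_right _ _
  have h1 := H y z
  have h2 : (1 / 2 + c * ε) * (Ψ y + Ψ z) ≤ (1 / 2 + c * ε) * (2 * (m + δ)) :=
    mul_le_mul_of_nonneg_left (by linarith) (by positivity)
  have h3 : ε * (m + δ) ≤ η ^ 2 / 4 := by
    calc ε * (m + δ) ≤ ε * (|M| + 1) :=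
          mul_le_mul_of_nonneg_left (by linarith [le_abs_self M]) hε0.le
      _ = η ^ 2 / 4 := by rw [hε]; field_simp
  have h4 : c * dist y z ^ 2 ≤ c * η ^ 2 := by nlinarith
  exact le_of_abs_le (abs_le_of_sq_le_sq (le_of_mul_le_mul_left h4 hc) hη.le)

/-- A continuous nonnegative uniformly convex function attains its minimum on a closed convex
subset of a complete space. -/
theorem UCFun.exists_isMinOn [CompleteSpace Z] {Ψ : Z → ℝ} (hΨ : UCFun Ψ) (hc : Continuous Ψ)
    (h0 : ∀ x, 0 ≤ Ψ x) {C : Set Z} (hne : C.Nonempty) (hcl : IsClosed C) (hconv : MidConvex C) :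
    ∃ p ∈ C, ∀ q ∈ C, Ψ p ≤ Ψ q := by
  set m := sInf (Ψ '' C)
  have hbdd : BddBelow (Ψ '' C) := ⟨0, by rintro _ ⟨x, -, rfl⟩; exact h0 x⟩
  have hm : ∀ q ∈ C, m ≤ Ψ q := fun q hq => csInf_le hbdd ⟨q, hq, rfl⟩
  have hex : ∀ n : ℕ, ∃ x ∈ C, Ψ x < m + 1 / ((n : ℝ) + 1) := fun n => by
    obtain ⟨_, ⟨x, hx, rfl⟩, h⟩ := exists_lt_of_csInf_lt (hne.image Ψ)
      (show m < m + 1 / ((n : ℝ) + 1) by linarith [show (0 : ℝ) < 1 / ((n : ℝ) + 1) by positivity])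
    exact ⟨x, hx, h⟩
  choose x hxC hx using hex
  have hlim : Tendsto (fun n : ℕ => m + 1 / ((n : ℝ) + 1)) atTop (𝓝 (m + 0)) :=
    tendsto_const_nhds.add tendsto_one_div_add_atTop_nhds_zero_nat
  rw [add_zero] at hlim
  have hcau : CauchySeq x := by
    rw [Metric.cauchySeq_iff]
    intro η hη
    obtain ⟨δ, hδ, H⟩ := hΨ.exists_dist_le m (half_pos hη)
    obtain ⟨N, hN⟩ := eventually_atTop.1 (hlim.eventually_lt_const (show m < m + δ by linarith))
    refine ⟨N, fun k hk l hl => (H m _ _ le_rfl ?_ ?_ ?_).trans_lt (half_lt_self hη)⟩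
    · exact ((hx k).trans (hN k hk)).le
    · exact ((hx l).trans (hN l hl)).le
    · exact hm _ (hconv _ (hxC k) _ (hxC l))
  obtain ⟨p, hp⟩ := cauchySeq_tendsto_of_complete hcau
  refine ⟨p, hcl.mem_of_tendsto hp (Eventually.of_forall hxC), fun q hq => ?_⟩
  refine le_trans ?_ (hm q hq)
  exact le_of_tendsto_of_tendsto' ((hc.tendsto p).comp hp) hlim fun n => (hx n).le

theorem exists_nearest [CompleteSpace Z] (x : Z) {C : Set Z} (hne : C.Nonempty) (hcl : IsClosed C)
    (hconv : MidConvex C) : ∃ p ∈ C, ∀ q ∈ C, dist x p ≤ dist x q := by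
  obtain ⟨p, hp, H⟩ := (ucFun_dist_sq x).exists_isMinOn (by fun_prop) (fun _ => sq_nonneg _)
    hne hcl hconv
  exact ⟨p, hp, fun q hq => le_of_abs_le (abs_le_of_sq_le_sq (H q hq) dist_nonneg)⟩

/-- Let `p` be a point of the convex set `C` nearest to `x`, and let `T` be an isometry mapping
`C` to itself and moving `x` by at most `s`. Then `p` is moved by an amount that is sublinear in
the distance from `x` to `C`. This is the substitute for the fact that nearest point projections
of `CAT(0)` spaces do not increase distances. -/
theorem exists_displacement_nearest_le (s : ℝ) {η : ℝ} (hη : 0 < η) :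
    ∃ R : ℝ, ∀ (T : Z ≃ᵢ Z) (C : Set Z) (x p : Z), MidConvex C → (∀ q ∈ C, T q ∈ C) → p ∈ C →
      (∀ q ∈ C, dist x p ≤ dist x q) → dist x (T x) ≤ s → R ≤ dist x p →
      dist p (T p) ≤ η * dist x p := by
  -- compare `p` with the midpoint of `p` and `T p`; the error term in `uc` is at most
  -- `c (η ^ 2 / 10) (r ^ 2 + 4 r ^ 2)`, half of the allowed amount
  obtain ⟨c, hc, H⟩ := uc (Z := Z) (η ^ 2 / 10) (by positivity)
  refine ⟨max |s| (3 * |s| / (c * η ^ 2)), fun T C x p hC hT hp hmin hs hR => ?_⟩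
  set r := dist x p with hr
  have hr1 : |s| ≤ r := (le_max_left _ _).trans hR
  have hr2 : 3 * |s| ≤ r * (c * η ^ 2) := by
    rw [← div_le_iff₀ (by positivity)]; exact (le_max_right _ _).trans hR
  have hr0 : 0 ≤ r := dist_nonneg
  have h1 := H x p (T p)
  have h2 : r ≤ dist x (mid p (T p)) := hmin _ (hC _ hp _ (hT _ hp))
  have h3 : dist x (T p) ≤ |s| + r := by
    calc dist x (T p) ≤ dist x (T x) + dist (T x) (T p) := dist_triangle _ _ _
      _ ≤ |s| + r := by rw [T.dist_eq]; linarith [le_abs_self s]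
  have h4 : r ^ 2 ≤ dist x (mid p (T p)) ^ 2 := pow_le_pow_left₀ hr0 h2 2
  have h5 : dist x (T p) ^ 2 ≤ (|s| + r) ^ 2 := pow_le_pow_left₀ dist_nonneg h3 2
  have hs0 := abs_nonneg s
  have h6 : dist x (T p) ^ 2 ≤ r ^ 2 + 3 * |s| * r := by nlinarith
  have h7 : dist x (T p) ^ 2 ≤ 4 * r ^ 2 := by nlinarith
  have h8 : c * dist p (T p) ^ 2 ≤ 3 / 2 * |s| * r + c * (η ^ 2 / 10) * (5 * r ^ 2) := by
    have : c * (η ^ 2 / 10) * (r ^ 2 + dist x (T p) ^ 2) ≤ c * (η ^ 2 / 10) * (5 * r ^ 2) :=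
      mul_le_mul_of_nonneg_left (by linarith) (by positivity)
    nlinarith
  have h9 : c * dist p (T p) ^ 2 ≤ c * (η * r) ^ 2 := by
    nlinarith [mul_le_mul_of_nonneg_right hr2 hr0]
  exact le_of_abs_le (abs_le_of_sq_le_sq (le_of_mul_le_mul_left h9 hc) (by positivity))

/-- One step of the parallelogram argument: if the segments `[x, u]` and `[y, v]` are parallel in
the sense that the midpoints of `[x, y]` and `[u, v]` are at the same distance as the endpoints,
then so are their first halves, and passing to the halves does not increase the distance between
the upper endpoints. -/
theorem parallel_half {x y u v : Z} {l : ℝ} (h1 : dist x u = l) (h2 : dist y v = l)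
    (h3 : dist (mid x y) (mid u v) = l) :
    dist x (mid x u) = l / 2 ∧ dist y (mid y v) = l / 2 ∧
      dist (mid x y) (mid (mid x u) (mid y v)) = l / 2 ∧
      dist (mid x u) (mid y v) ≤ dist u v := by
  have a1 : dist x (mid x u) = l / 2 := by rw [dist_left_mid, h1]
  have a2 : dist y (mid y v) = l / 2 := by rw [dist_left_mid, h2]
  have b1 := dist_mid_mid_le x y (mid x u) (mid y v)
  have b2 := dist_mid_mid_le (mid x u) (mid y v) u v
  rw [dist_mid_right, dist_mid_right] at b2
  have b3 := dist_triangle (mid x y) (mid (mid x u) (mid y v)) (mid u v)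
  have a3 : dist (mid x y) (mid (mid x u) (mid y v)) = l / 2 := by linarith
  have a3' : dist (mid (mid x u) (mid y v)) (mid u v) = l / 2 := by linarith
  have d1 := dist_mid_mid_le x y x v
  have d2 := dist_mid_mid_le x v u v
  rw [dist_self] at d1 d2
  have d3 := dist_triangle (mid x y) (mid x v) (mid u v)
  -- the diagonal `[x, v]` passes through the midpoint of the two middle points
  have key : mid x v = mid (mid x u) (mid y v) := by
    rw [eq_mid (x := mid x y) (y := mid u v) (m := mid x v) (by linarith) (by linarith),
      eq_mid (x := mid x y) (y := mid u v) (m := mid (mid x u) (mid y v))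
        (by linarith) (by linarith)]
  refine ⟨a1, a2, a3, ?_⟩
  have e1 := dist_left_mid (mid x u) (mid y v)
  rw [← key] at e1
  have e2 := dist_mid_mid_le x u x v
  rw [dist_self] at e2
  linarith

/-- In a parallelogram, the segment joining the midpoints of two opposite sides is at least as
long as the third side `[x, y]`: iterate `parallel_half`, which shrinks the parallelogram towards
that side. -/
theorem dist_le_of_parallel {x y u v : Z} {l : ℝ} (h1 : dist x u = l) (h2 : dist y v = l)
    (h3 : dist (mid x y) (mid u v) = l) : dist x y ≤ dist (mid x u) (mid y v) := by
  have key : ∀ n : ℕ, ∀ (u v : Z) (l : ℝ), dist x u = l → dist y v = l →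
      dist (mid x y) (mid u v) = l → dist x y ≤ dist u v + 2 * (l / 2 ^ n) := by
    intro n
    induction n with
    | zero =>
      intro u v l h1 h2 _
      have := dist_triangle4 x u v y
      rw [dist_comm v y] at this
      simp only [pow_zero, div_one]
      linarith
    | succ n ih =>
      intro u v l h1 h2 h3
      obtain ⟨a1, a2, a3, a4⟩ := parallel_half h1 h2 h3
      have := ih _ _ _ a1 a2 a3
      have e : l / 2 / 2 ^ n = l / 2 ^ (n + 1) := by rw [pow_succ]; field_simp
      rw [e] at this
      linarith
  obtain ⟨a1, a2, a3, -⟩ := parallel_half h1 h2 h3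
  have hlim : Tendsto (fun n : ℕ => dist (mid x u) (mid y v) + 2 * (l / 2 / 2 ^ n)) atTop
      (𝓝 (dist (mid x u) (mid y v) + 2 * 0)) := by
    refine tendsto_const_nhds.add (tendsto_const_nhds.mul ?_)
    have := (tendsto_pow_atTop_nhds_zero_of_lt_one (r := (1 / 2 : ℝ)) (by norm_num)
      (by norm_num)).const_mul (l / 2)
    rw [mul_zero] at this
    refine this.congr fun n => ?_
    rw [one_div, inv_pow]; rfl
  rw [mul_zero, add_zero] at hlim
  exact ge_of_tendsto' hlim fun n => key n _ _ _ a1 a2 a3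

end Basic

/-! ### Minimal invariant convex sets -/

section Minimal

open MidSpace

variable {Z : Type*} [MetricSpace Z] [MidSpace Z] {H : Type*} [Group H]

/-- A nonempty closed convex subset which is invariant under an isometric action. -/
structure IsInvConvex (σ : H →* (Z ≃ᵢ Z)) (C : Set Z) : Prop where
  nonempty : C.Nonempty
  isClosed : IsClosed C
  midConvex : MidConvex C
  map_mem : ∀ h, ∀ x ∈ C, σ h x ∈ C

/-- If the nonempty closed convex invariant subsets of `C₀` stay at bounded distance from a point,
then there is a minimal one. -/
theorem exists_minimal_isInvConvex [CompleteSpace Z] (σ : H →* (Z ≃ᵢ Z)) {C₀ : Set Z}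
    (hC₀ : IsInvConvex σ C₀) (x : Z) (R : ℝ)
    (hR : ∀ C ⊆ C₀, IsInvConvex σ C → ∃ y ∈ C, dist x y ≤ R) :
    ∃ C ⊆ C₀, Minimal (IsInvConvex σ) C := by
  have hz : ∃ C ⊆ C₀, Minimal (fun C => C ∈ {C | C ⊆ C₀ ∧ IsInvConvex σ C}) C := by
    refine zorn_superset_nonempty {C | C ⊆ C₀ ∧ IsInvConvex σ C} ?_ C₀ ⟨subset_rfl, hC₀⟩
    intro c hcS hchain hcne
    have hnear : ∀ C : c, ∃ p ∈ (C : Set Z), ∀ q ∈ (C : Set Z), dist x p ≤ dist x q := fun C =>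
      exists_nearest x (hcS C.2).2.nonempty (hcS C.2).2.isClosed (hcS C.2).2.midConvex
    choose p hp hpmin using hnear
    have hpR : ∀ C : c, dist x (p C) ^ 2 ≤ R ^ 2 := fun C => by
      obtain ⟨y, hy, hyR⟩ := hR C (hcS C.2).1 (hcS C.2).2
      exact pow_le_pow_left₀ dist_nonneg ((hpmin C y hy).trans hyR) 2
    have : Nonempty c := hcne.to_subtype
    set m := ⨆ C : c, dist x (p C) ^ 2 with hm
    have hbdd : BddAbove (Set.range fun C : c => dist x (p C) ^ 2) :=
      ⟨R ^ 2, by rintro _ ⟨C, rfl⟩; exact hpR C⟩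
    have hpm : ∀ C : c, dist x (p C) ^ 2 ≤ m := fun C => le_ciSup hbdd C
    -- the points of `S C` nearly minimize the distance to `x` on `C` once `C` is far along the chain
    set S : c → Set Z := fun C => (C : Set Z) ∩ {y | dist x y ^ 2 ≤ m} with hS
    have hdir : Directed (· ≥ ·) fun C : c => 𝓟 (S C) := by
      intro C C'
      rcases hchain.total C.2 C'.2 with h | h
      · exact ⟨C, le_rfl, principal_mono.2 (Set.inter_subset_inter_left _ h)⟩
      · exact ⟨C', principal_mono.2 (Set.inter_subset_inter_left _ h), le_rfl⟩
    have hneB : (⨅ C : c, 𝓟 (S C)).NeBot :=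
      iInf_neBot_of_directed' hdir fun C => principal_neBot_iff.2 ⟨p C, hp C, hpm C⟩
    have hcau : Cauchy (⨅ C : c, 𝓟 (S C)) := by
      refine Metric.cauchy_iff.2 ⟨hneB, fun η hη => ?_⟩
      obtain ⟨δ, hδ, Hδ⟩ := (ucFun_dist_sq x).exists_dist_le m (half_pos hη)
      obtain ⟨C, hC⟩ := exists_lt_of_lt_ciSup (show m - δ < m by linarith)
      refine ⟨S C, mem_iInf_of_mem C (mem_principal_self _), fun y hy z hz => ?_⟩
      refine (Hδ (dist x (p C) ^ 2) y z (hpm C) ?_ ?_ ?_).trans_lt (half_lt_self hη)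
      · have := hy.2; simp only [Set.mem_ofPred_eq] at this; linarith
      · have := hz.2; simp only [Set.mem_ofPred_eq] at this; linarith
      · exact pow_le_pow_left₀ dist_nonneg
          (hpmin C _ ((hcS C.2).2.midConvex _ hy.1 _ hz.1)) 2
    obtain ⟨q, hq⟩ := CompleteSpace.complete hcau
    have hqC : ∀ C ∈ c, q ∈ C := fun C hC => by
      have h1 : IsClosed C := (hcS hC).2.isClosed
      refine h1.mem_of_frequently_of_tendsto (b := ⨅ C : c, 𝓟 (S C)) (f := id) ?_ hq
      refine Eventually.frequently ?_
      exact mem_iInf_of_mem (⟨C, hC⟩ : c) (mem_principal.2 fun y hy => hy.1)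
    obtain ⟨C₁, hC₁⟩ := hcne
    refine ⟨⋂₀ c, ⟨(Set.sInter_subset_of_mem hC₁).trans (hcS hC₁).1, ⟨q, hqC⟩, ?_, ?_, ?_⟩,
      fun s hs => Set.sInter_subset_of_mem hs⟩
    · exact isClosed_sInter fun C hC => (hcS hC).2.isClosed
    · exact fun y hy z hz C hC => (hcS hC).2.midConvex _ (hy C hC) _ (hz C hC)
    · exact fun h y hy C hC => (hcS hC).2.map_mem h y (hy C hC)
  obtain ⟨C, hCC₀, ⟨-, hC⟩, hmin⟩ := hz
  exact ⟨C, hCC₀, hC, fun C' hC' hle => hmin ⟨hle.trans hCC₀, hC'⟩ hle⟩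

/-- On a minimal invariant convex set, a continuous convex function which does not increase along
the action is constant. -/
theorem minimal_eq_of_convex {σ : H →* (Z ≃ᵢ Z)} {C : Set Z} (hC : Minimal (IsInvConvex σ) C)
    {F : Z → ℝ} (hF : ContinuousOn F C) (hconv : ∀ x ∈ C, ∀ y ∈ C, F (mid x y) ≤ (F x + F y) / 2)
    (hinv : ∀ h, ∀ x ∈ C, F (σ h x) ≤ F x) {x y : Z} (hx : x ∈ C) (hy : y ∈ C) : F x = F y := by
  have key : ∀ x ∈ C, ∀ y ∈ C, F x ≤ F y := fun x hx y hy => by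
    have hsub : IsInvConvex σ (C ∩ F ⁻¹' Set.Iic (F y)) := by
      refine ⟨⟨y, hy, le_refl (F y)⟩, hF.preimage_isClosed_of_isClosed hC.1.isClosed isClosed_Iic,
        fun a ha b hb => ⟨hC.1.midConvex a ha.1 b hb.1, ?_⟩,
        fun h a ha => ⟨hC.1.map_mem h a ha.1, (hinv h a ha.1).trans ha.2⟩⟩
      have h1 := hconv a ha.1 b hb.1
      have h2 : F a ≤ F y := ha.2
      have h3 : F b ≤ F y := hb.2
      show F (mid a b) ≤ F y
      linarith
    exact (hC.2 hsub Set.inter_subset_left hx).2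
  exact le_antisymm (key x hx y hy) (key y hy x hx)

/-- A bounded minimal invariant convex set is a single fixed point. -/
theorem minimal_subsingleton_of_isBounded {σ : H →* (Z ≃ᵢ Z)} {C : Set Z}
    (hC : Minimal (IsInvConvex σ) C) (hb : Bornology.IsBounded C) : C.Subsingleton := by
  obtain ⟨B, hB⟩ := Metric.isBounded_iff.1 hb
  obtain ⟨x₀, hx₀⟩ := hC.1.nonempty
  have : Nonempty C := ⟨⟨x₀, hx₀⟩⟩
  -- the circumradius function of `C`
  set F : Z → ℝ := fun x => ⨆ y : C, dist x y with hF
  have hbdd : ∀ x ∈ C, BddAbove (Set.range fun y : C => dist x y) := fun x hx =>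
    ⟨B, by rintro _ ⟨y, rfl⟩; exact hB hx y.2⟩
  have hle : ∀ x ∈ C, ∀ y ∈ C, dist x y ≤ F x := fun x hx y hy => le_ciSup (hbdd x hx) ⟨y, hy⟩
  have hFle : ∀ (x : Z) (a : ℝ), (∀ y ∈ C, dist x y ≤ a) → F x ≤ a := fun x a h =>
    ciSup_le fun y => h y y.2
  have hcont : ContinuousOn F C := by
    refine LipschitzOnWith.continuousOn (K := 1) (LipschitzOnWith.of_dist_le_mul fun x hx y hy => ?_)
    rw [NNReal.coe_one, one_mul, Real.dist_eq, abs_sub_le_iff]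
    constructor
    · have := hFle x (dist x y + F y) fun z hz =>
        (dist_triangle x y z).trans (by linarith [hle y hy z hz])
      linarith
    · have := hFle y (dist x y + F x) fun z hz =>
        (dist_triangle y x z).trans (by rw [dist_comm y x]; linarith [hle x hx z hz])
      linarith
  have hconst : ∀ x ∈ C, ∀ y ∈ C, F x = F y := fun x hx y hy => by
    refine minimal_eq_of_convex hC hcont (fun a ha b hb => hFle _ _ fun z hz => ?_)
      (fun h a ha => hFle _ _ fun z hz => ?_) hx hy
    · have h1 := dist_mid_mid_le a b z z
      rw [mid_self] at h1
      linarith [hle a ha z hz, hle b hb z hz]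
    · have h1 := hle a ha _ (hC.1.map_mem h⁻¹ z hz)
      have h2 : σ h (σ h⁻¹ z) = z := by
        rw [← IsometryEquiv.mul_apply, ← map_mul, mul_inv_cancel, map_one]; rfl
      rw [← h2, IsometryEquiv.dist_eq]
      exact h1
  intro y₁ h₁ y₂ h₂
  rw [← dist_eq_zero]
  set r := F x₀
  have hr : ∀ x ∈ C, ∀ y ∈ C, dist x y ≤ r := fun x hx y hy => by
    exact (hle x hx y hy).trans_eq (hconst x hx x₀ hx₀)
  refine eq_zero_of_sq_le_mul (M := 2 * r ^ 2) fun ε hε => ?_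
  obtain ⟨c, hc, Hc⟩ := uc (Z := Z) ε hε
  have hm := hC.1.midConvex y₁ h₁ y₂ h₂
  have hr0 : 0 ≤ r := dist_nonneg.trans (hr x₀ hx₀ x₀ hx₀)
  by_contra! hlt
  -- the midpoint of `y₁` and `y₂` would have a circumradius smaller than `r`
  have h3 : r ≤ Real.sqrt (r ^ 2 - c * (dist y₁ y₂ ^ 2 - ε * (2 * r ^ 2))) := by
    refine (hconst x₀ hx₀ _ hm).trans_le (hFle _ _ fun z hz => Real.le_sqrt_of_sq_le ?_)
    have h4 := Hc z y₁ y₂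
    have h5 := pow_le_pow_left₀ dist_nonneg (hr z hz y₁ h₁) 2
    have h6 := pow_le_pow_left₀ dist_nonneg (hr z hz y₂ h₂) 2
    rw [dist_comm]
    have h7 : (1 / 2 + c * ε) * (dist z y₁ ^ 2 + dist z y₂ ^ 2) ≤ (1 / 2 + c * ε) * (2 * r ^ 2) :=
      mul_le_mul_of_nonneg_left (by linarith) (by positivity)
    nlinarith
  have h4 : 0 < c * (dist y₁ y₂ ^ 2 - ε * (2 * r ^ 2)) := mul_pos hc (by linarith)
  rcases hr0.eq_or_lt with h0 | h0
  · have := hr y₁ h₁ y₂ h₂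
    have h5 : dist y₁ y₂ = 0 := le_antisymm (this.trans h0.ge) dist_nonneg
    rw [h5, ← h0] at hlt
    norm_num at hlt
  · have h5 : Real.sqrt (r ^ 2 - c * (dist y₁ y₂ ^ 2 - ε * (2 * r ^ 2))) < r :=
      (Real.sqrt_lt' h0).2 (by linarith)
    linarith

end Minimal

/-! ### Midpoints in uniformly convex Busemann spaces -/

section Spaces

open MidSpace

variable {X : Type*} [MetricSpace X]

theorem isConstSpeedGeodesic_const (x : X) : IsConstSpeedGeodesic fun _ : ℝ => x := by
  intro s _ t _
  simp

theorem IsConstSpeedGeodesic.isMidpoint {c : ℝ → X} (hc : IsConstSpeedGeodesic c) :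
    IsMidpoint (c (1 / 2)) (c 0) (c 1) := by
  have h1 := hc 0 (by norm_num) (1 / 2) (by norm_num)
  have h2 := hc (1 / 2) (by norm_num) 1 (by norm_num)
  norm_num at h1 h2
  constructor <;> norm_num <;> linarith

theorem IsBNPC.dist_half_le (hX : IsBNPC X) {c c' : ℝ → X} (hc : IsConstSpeedGeodesic c)
    (hc' : IsConstSpeedGeodesic c') :
    dist (c (1 / 2)) (c' (1 / 2)) ≤ (dist (c 0) (c' 0) + dist (c 1) (c' 1)) / 2 := by
  have h := (hX.convex_dist c c' hc hc').2 (show (0 : ℝ) ∈ Set.Icc 0 1 by norm_num)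
    (show (1 : ℝ) ∈ Set.Icc 0 1 by norm_num) (show (0 : ℝ) ≤ 1 / 2 by norm_num)
    (show (0 : ℝ) ≤ 1 / 2 by norm_num) (by norm_num)
  norm_num at h
  norm_num
  linarith

/-- Numerical inequality converting a gain of a factor `1 - δ` against the larger of two distances
into a gain for squared distances: either `a` and `b` differ so much that the mean of the squares is
well above the square of the mean, or both are close to the maximum. -/
theorem sq_add_le_of_le_mul_max {a b M δ : ℝ} (ha : 0 ≤ a) (hb : 0 ≤ b) (hM : 0 ≤ M) (hδ : 0 < δ)
    (hδ1 : δ ≤ 1) (h1 : M ≤ (a + b) / 2) (h2 : M ≤ (1 - δ) * max a b) :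
    M ^ 2 + δ ^ 2 / 16 * max a b ^ 2 ≤ (a ^ 2 + b ^ 2) / 2 := by
  wlog hab : a ≤ b generalizing a b
  · rw [max_comm, add_comm (a ^ 2)]
    exact this hb ha (by linarith) (by rwa [max_comm]) (le_of_not_ge hab)
  rw [max_eq_right hab] at h2 ⊢
  by_cases hcase : δ / 2 * b ≤ b - a
  · have e1 : (δ / 2 * b) ^ 2 ≤ (b - a) ^ 2 := pow_le_pow_left₀ (by positivity) hcase 2
    have e2 : M ^ 2 ≤ ((a + b) / 2) ^ 2 := pow_le_pow_left₀ hM h1 2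
    nlinarith
  · have e1 : (1 - δ / 2) * b ≤ a := by linarith
    have e2 : ((1 - δ / 2) * b) ^ 2 ≤ a ^ 2 :=
      pow_le_pow_left₀ (mul_nonneg (by linarith) hb) e1 2
    have e3 : M ^ 2 ≤ ((1 - δ) * b) ^ 2 := pow_le_pow_left₀ hM h2 2
    have e4 : (1 - δ) ^ 2 + δ ^ 2 / 16 ≤ (1 + (1 - δ / 2) ^ 2) / 2 := by nlinarith
    have e5 := mul_le_mul_of_nonneg_right e4 (sq_nonneg b)
    linarith [mul_pow (1 - δ / 2) b 2, mul_pow (1 - δ) b 2]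

/-- The scale invariant modulus of uniform convexity yields the inequality for squared distances
required in `MidSpace`. -/
theorem IsUniformlyConvex.exists_sq_ineq (hUC : IsUniformlyConvex X) {ε : ℝ} (hε : 0 < ε) :
    ∃ c : ℝ, 0 < c ∧ ∀ x y z m : X, IsMidpoint m y z → dist x m ≤ (dist x y + dist x z) / 2 →
      dist x m ^ 2 + c * dist y z ^ 2 ≤ (1 / 2 + c * ε) * (dist x y ^ 2 + dist x z ^ 2) := by
  obtain ⟨δ', hδ', H⟩ := hUC (Real.sqrt ε) (Real.sqrt_pos.2 hε)
  set δ := min δ' 1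
  have hδ : 0 < δ := lt_min hδ' one_pos
  have hδ1 : δ ≤ 1 := min_le_right _ _
  refine ⟨δ ^ 2 / 64, by positivity, fun x y z m hm hB => ?_⟩
  have tri : dist y z ≤ dist x y + dist x z := by
    rw [dist_comm x y]; exact dist_triangle _ _ _
  set a := dist x y
  set b := dist x z
  set D := dist y z
  have ha : 0 ≤ a := dist_nonneg
  have hb : 0 ≤ b := dist_nonneg
  have hD : 0 ≤ D := dist_nonneg
  have hM : 0 ≤ dist x m := dist_nonneg
  have hBs : dist x m ^ 2 ≤ ((a + b) / 2) ^ 2 := pow_le_pow_left₀ hM hB 2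
  by_cases hcase : D ^ 2 ≤ ε * (a ^ 2 + b ^ 2)
  · have : δ ^ 2 / 64 * D ^ 2 ≤ δ ^ 2 / 64 * (ε * (a ^ 2 + b ^ 2)) :=
      mul_le_mul_of_nonneg_left hcase (by positivity)
    nlinarith [sq_nonneg (a - b)]
  push Not at hcase
  set r := max a b
  have har : a ≤ r := le_max_left _ _
  have hbr : b ≤ r := le_max_right _ _
  have hr0 : 0 ≤ r := ha.trans har
  have hrS : r ^ 2 ≤ a ^ 2 + b ^ 2 := by
    rcases max_cases a b with h | h <;> simp only [r, h.1] <;> nlinarith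
  have hr : 0 < r := by
    rcases hr0.eq_or_lt with h | h
    · have : a = 0 := by linarith
      have : b = 0 := by linarith
      have hD0 : D = 0 := by linarith
      have hS0 : a ^ 2 + b ^ 2 = 0 := by rw [‹a = 0›, ‹b = 0›]; norm_num
      rw [hD0, hS0] at hcase
      norm_num at hcase
    · exact h
  have hDr : Real.sqrt ε * r ≤ D := by
    have : Real.sqrt (ε * r ^ 2) ≤ D := by
      rw [Real.sqrt_le_left hD]
      nlinarith
    rwa [Real.sqrt_mul hε.le, Real.sqrt_sq hr0] at this
  have h1 := H r hr x y z m har hbr hDr hm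
  have h2 : dist x m ≤ (1 - δ) * r := by
    have : δ * r ≤ δ' * r := mul_le_mul_of_nonneg_right (min_le_left _ _) hr0
    linarith
  have gain := sq_add_le_of_le_mul_max ha hb hM hδ hδ1 hB h2
  have hDle : D ^ 2 ≤ 4 * r ^ 2 := by nlinarith
  have h7 : δ ^ 2 / 64 * D ^ 2 ≤ δ ^ 2 / 16 * r ^ 2 := by nlinarith [sq_nonneg δ]
  have h8 : 0 ≤ δ ^ 2 / 64 * ε * (a ^ 2 + b ^ 2) := by positivity
  linarith

/-- Midpoints in a uniformly convex Busemann space. -/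
noncomputable abbrev IsBNPC.midSpace (hX : IsBNPC X) (hUC : IsUniformlyConvex X) : MidSpace X where
  mid x y := (hX.exists_geodesic x y).choose (1 / 2)
  dist_left_mid x y := by
    obtain ⟨h, h0, h1⟩ := (hX.exists_geodesic x y).choose_spec
    have := h.isMidpoint.1
    rwa [h0, h1] at this
  dist_mid_right x y := by
    obtain ⟨h, h0, h1⟩ := (hX.exists_geodesic x y).choose_spec
    have := h.isMidpoint.2
    rwa [h0, h1] at this
  dist_mid_mid_le x y x' y' := by
    obtain ⟨h, h0, h1⟩ := (hX.exists_geodesic x y).choose_spec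
    obtain ⟨h', h0', h1'⟩ := (hX.exists_geodesic x' y').choose_spec
    have := hX.dist_half_le h h'
    rwa [h0, h1, h0', h1'] at this
  uc ε hε := by
    obtain ⟨c, hc, H⟩ := hUC.exists_sq_ineq hε
    refine ⟨c, hc, fun x y z => ?_⟩
    obtain ⟨h, h0, h1⟩ := (hX.exists_geodesic y z).choose_spec
    refine H x y z _ ?_ ?_
    · have := h.isMidpoint
      rwa [h0, h1] at this
    · have := hX.dist_half_le (isConstSpeedGeodesic_const x) h
      rwa [h0, h1] at this

/-- For closed sets, midpoint convexity implies convexity along every geodesic. -/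
theorem MidConvex.isGeodesicallyConvex [MidSpace X] {C : Set X} (hC : MidConvex C)
    (hcl : IsClosed C) : IsGeodesicallyConvex C := by
  intro c hc h0 h1 t ht
  have hcont : ContinuousOn c (Set.Icc 0 1) := by
    refine LipschitzOnWith.continuousOn (K := (dist (c 0) (c 1)).toNNReal)
      (LipschitzOnWith.of_dist_le_mul fun s hs t ht => ?_)
    rw [hc s hs t ht, Real.coe_toNNReal _ dist_nonneg, Real.dist_eq, mul_comm]
  set S := Set.Icc (0 : ℝ) 1 ∩ c ⁻¹' C
  have hS : IsClosed S := hcont.preimage_isClosed_of_isClosed isClosed_Icc hcl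
  have hmid : ∀ s ∈ S, ∀ t ∈ S, (s + t) / 2 ∈ S := by
    intro s hs t ht
    have hm : (s + t) / 2 ∈ Set.Icc (0 : ℝ) 1 :=
      ⟨by linarith [hs.1.1, ht.1.1], by linarith [hs.1.2, ht.1.2]⟩
    refine ⟨hm, ?_⟩
    have e : c ((s + t) / 2) = mid (c s) (c t) := by
      apply eq_mid
      · rw [hc s hs.1 _ hm, hc s hs.1 t ht.1, show s - (s + t) / 2 = (s - t) / 2 by ring, abs_div,
          abs_two]
        ring
      · rw [hc _ hm t ht.1, hc s hs.1 t ht.1, show (s + t) / 2 - t = (s - t) / 2 by ring, abs_div,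
          abs_two]
        ring
    rw [Set.mem_preimage, e]
    exact hC _ hs.2 _ ht.2
  have hS0 : (0 : ℝ) ∈ S := ⟨by norm_num, h0⟩
  have hS1 : (1 : ℝ) ∈ S := ⟨by norm_num, h1⟩
  -- the endpoints of a gap of `S` around `t` would have their midpoint outside of `S`
  set a := sSup (S ∩ Set.Iic t)
  set b := sInf (S ∩ Set.Ici t)
  have ha : a ∈ S ∩ Set.Iic t :=
    (hS.inter isClosed_Iic).csSup_mem ⟨0, hS0, ht.1⟩ ⟨t, fun x hx => hx.2⟩
  have hb : b ∈ S ∩ Set.Ici t :=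
    (hS.inter isClosed_Ici).csInf_mem ⟨1, hS1, ht.2⟩ ⟨t, fun x hx => hx.2⟩
  have hat : a ≤ t := ha.2
  have htb : t ≤ b := hb.2
  have hm := hmid a ha.1 b hb.1
  have hab : a = b := by
    rcases le_total ((a + b) / 2) t with h | h
    · have : (a + b) / 2 ≤ a := le_csSup ⟨t, fun x hx => hx.2⟩ ⟨hm, h⟩
      linarith
    · have : b ≤ (a + b) / 2 := csInf_le ⟨t, fun x hx => hx.2⟩ ⟨hm, h⟩
      linarith
  have : t = a := by linarith
  rw [this]
  exact ha.1.2

end Spaces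

/-! ### Reduced actions -/

section Reduced

open MidSpace

variable {X : Type*} [MetricSpace X] {Γ : Type*} [Group Γ] {ρ : Γ →* (X ≃ᵢ X)}

theorem apply_inv_apply (ρ : Γ →* (X ≃ᵢ X)) (h : Γ) (x : X) : ρ h (ρ h⁻¹ x) = x := by
  rw [← IsometryEquiv.mul_apply, ← map_mul, mul_inv_cancel, map_one]; rfl

/-- A bounded displacement on `C` bounds the Hausdorff distance of `C` to its image. -/
theorem hausdorffEDist_image_ne_top {C : Set X} {T : X ≃ᵢ X} {B : ℝ}
    (h : ∀ x ∈ C, dist x (T x) ≤ B) : Metric.hausdorffEDist C (T '' C) ≠ ⊤ := by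
  refine ne_top_of_le_ne_top (ENNReal.ofReal_ne_top (r := B))
    (Metric.hausdorffEDist_le_of_mem_edist (fun x hx => ⟨T x, ⟨x, hx, rfl⟩, ?_⟩) ?_)
  · rw [edist_dist]; exact ENNReal.ofReal_le_ofReal (h x hx)
  · rintro _ ⟨x, hx, rfl⟩
    refine ⟨x, hx, ?_⟩
    rw [edist_comm, edist_dist]; exact ENNReal.ofReal_le_ofReal (h x hx)

variable [MidSpace X]

/-- Reducedness in terms of midpoint convex sets. -/
theorem IsReduced.eq_univ (hred : IsReduced ρ) {C : Set X} (hb : ¬ Bornology.IsBounded C)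
    (hcl : IsClosed C) (hconv : MidConvex C)
    (hd : ∀ h, Metric.hausdorffEDist C (ρ h '' C) ≠ ⊤) : C = Set.univ := by
  by_contra hne
  exact hred ⟨C, hb, hcl, hconv.isGeodesicallyConvex hcl, hne, hd⟩

/-- A reduced action without global fixed point is minimal. -/
theorem IsReduced.eq_univ_of_isInvConvex [CompleteSpace X] (hred : IsReduced ρ)
    (hfix : ¬ HasGlobalFixedPoint ρ) {C : Set X} (hC : IsInvConvex ρ C) : C = Set.univ := by
  by_cases hb : Bornology.IsBounded C
  · exfalso
    obtain ⟨x, hx⟩ := hC.nonempty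
    obtain ⟨B, hB⟩ := Metric.isBounded_iff.1 hb
    obtain ⟨C', hC'C, hC'⟩ := exists_minimal_isInvConvex ρ hC x B fun C' hC'C hC' => by
      obtain ⟨y, hy⟩ := hC'.nonempty
      exact ⟨y, hy, hB hx (hC'C hy)⟩
    obtain ⟨y, hy⟩ := hC'.1.nonempty
    exact hfix ⟨y, fun h => minimal_subsingleton_of_isBounded hC' (hb.subset hC'C)
      (hC'.1.map_mem h y hy) hy⟩
  · refine hred.eq_univ hb hC.isClosed hC.midConvex fun h => ?_
    have : ρ h '' C = C := by
      refine Set.Subset.antisymm (by rintro _ ⟨x, hx, rfl⟩; exact hC.map_mem h x hx) fun x hx => ?_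
      exact ⟨ρ h⁻¹ x, hC.map_mem _ x hx, apply_inv_apply ρ h x⟩
    rw [this, Metric.hausdorffEDist_self]
    exact ENNReal.zero_ne_top

/-- For a reduced action without global fixed point on a space without nontrivial Clifford
isometries, the points displaced by a bounded amount by a generating set form a bounded set.
Otherwise every group element has bounded displacement on the whole space, so that all unbounded
closed convex sets are equal to the space; sublevel sets of displacement functions being
unbounded, the displacement functions are constant. -/
theorem IsReduced.isBounded_displacement [CompleteSpace X] (hred : IsReduced ρ)
    (hfix : ¬ HasGlobalFixedPoint ρ)
    (hCL : ∀ T : X ≃ᵢ X, IsClifford T → T = IsometryEquiv.refl X)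
    {S : Set Γ} (hS : Subgroup.closure S = ⊤) (R : ℝ) :
    Bornology.IsBounded {x : X | ∀ s ∈ S, dist x (ρ s x) ≤ R} := by
  by_contra hunb
  set E := {x : X | ∀ s ∈ S, dist x (ρ s x) ≤ R} with hE
  have hdisp : ∀ h : Γ, ∃ B : ℝ, ∀ x ∈ E, dist x (ρ h x) ≤ B := by
    intro h
    have hh : h ∈ Subgroup.closure S := hS ▸ Subgroup.mem_top h
    induction hh using Subgroup.closure_induction with
    | mem s hs => exact ⟨R, fun x hx => hx s hs⟩
    | one => exact ⟨0, fun x _ => by simp⟩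
    | mul a b _ _ iha ihb =>
      obtain ⟨B₁, h₁⟩ := iha
      obtain ⟨B₂, h₂⟩ := ihb
      refine ⟨B₁ + B₂, fun x hx => ?_⟩
      rw [map_mul, IsometryEquiv.mul_apply]
      have := dist_triangle x (ρ a x) (ρ a (ρ b x))
      rw [IsometryEquiv.dist_eq] at this
      linarith [h₁ x hx, h₂ x hx]
    | inv a _ ih =>
      obtain ⟨B, h⟩ := ih
      refine ⟨B, fun x hx => ?_⟩
      rw [← (ρ a).dist_eq, apply_inv_apply, dist_comm]
      exact h x hx
  have hEcl : IsClosed E := by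
    simp only [hE, Set.ofPred_forall]
    exact isClosed_iInter fun s => isClosed_iInter fun _ =>
      isClosed_le (continuous_id.dist (ρ s).continuous) continuous_const
  have hEconv : MidConvex E := fun x hx y hy s hs =>
    (midConvexFun_dist_isometry (ρ s)).midConvex_le R x (hx s hs) y (hy s hs)
  have hEuniv : E = Set.univ := hred.eq_univ hunb hEcl hEconv fun h => by
    obtain ⟨B, hB⟩ := hdisp h
    exact hausdorffEDist_image_ne_top hB
  have hall : ∀ C : Set X, ¬ Bornology.IsBounded C → IsClosed C → MidConvex C → C = Set.univ :=
    fun C hb hcl hconv => hred.eq_univ hb hcl hconv fun h => by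
      obtain ⟨B, hB⟩ := hdisp h
      exact hausdorffEDist_image_ne_top fun x _ => hB x (hEuniv ▸ Set.mem_univ x)
  have htriv : ∀ h : Γ, ρ h = IsometryEquiv.refl X := by
    intro h
    obtain ⟨B, hB⟩ := hdisp h
    have hF := midConvexFun_dist_isometry (ρ h)
    have key : ∀ p q : X, dist p (ρ h p) ≤ dist q (ρ h q) := by
      intro p q
      by_contra! hlt
      set a := (dist p (ρ h p) + dist q (ρ h q)) / 2
      have hbd : Bornology.IsBounded {x : X | dist x (ρ h x) ≤ a} := by
        by_contra hb
        have := hall _ hb (isClosed_le (continuous_id.dist (ρ h).continuous) continuous_const)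
          (hF.midConvex_le a)
        have hp : p ∈ {x : X | dist x (ρ h x) ≤ a} := this ▸ Set.mem_univ p
        have hp' : dist p (ρ h p) ≤ a := hp
        simp only [a] at hp'
        linarith
      -- contracting a point very far away towards `q` by the factor `2 ^ n` brings its displacement
      -- below `a` but keeps it outside of any given ball
      obtain ⟨r, hr⟩ := (Metric.isBounded_iff_subset_closedBall q).1 hbd
      obtain ⟨n, hn⟩ := pow_unbounded_of_one_lt (B / (a - dist q (ρ h q))) (one_lt_two)
      have ha : 0 < a - dist q (ρ h q) := by simp only [a]; linarith
      have hfar : ∃ x : X, r * 2 ^ n < dist q x := by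
        by_contra! hx
        apply hunb
        rw [hEuniv]
        exact (Metric.isBounded_iff_subset_closedBall q).2
          ⟨r * 2 ^ n, fun x _ => by rw [Metric.mem_closedBall, dist_comm]; exact hx x⟩
      obtain ⟨x, hx⟩ := hfar
      have hmem : (mid q)^[n] x ∈ {x : X | dist x (ρ h x) ≤ a} := by
        have h1 := hF.iterate_mid_le q x n
        have h2 : (dist x (ρ h x) - dist q (ρ h q)) / 2 ^ n ≤ a - dist q (ρ h q) := by
          rw [div_le_iff₀ (by positivity)]
          rw [div_lt_iff₀ ha] at hn
          have := hB x (hEuniv ▸ Set.mem_univ x)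
          have := dist_nonneg (x := q) (y := ρ h q)
          nlinarith
        show dist ((mid q)^[n] x) (ρ h ((mid q)^[n] x)) ≤ a
        linarith
      have h3 := hr hmem
      rw [Metric.mem_closedBall, dist_comm, dist_iterate_mid, div_le_iff₀ (by positivity)] at h3
      linarith
    by_cases hX : Nonempty X
    · obtain ⟨x₀⟩ := hX
      exact hCL _ ⟨dist x₀ (ρ h x₀), fun x => le_antisymm (key x x₀) (key x₀ x)⟩
    · rw [not_nonempty_iff] at hX
      ext x
      exact hX.elim x
  have hne : E.Nonempty := by
    by_contra hemp
    rw [Set.not_nonempty_iff_eq_empty] at hemp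
    exact hunb (hemp ▸ Bornology.isBounded_empty)
  obtain ⟨x, -⟩ := hne
  exact hfix ⟨x, fun h => by rw [htriv h]; rfl⟩

end Reduced

/-! ### Continuous extension of actions of dense subgroups -/

section Extension

open MidSpace

variable {X : Type*} [MetricSpace X] {Γ H : Type*} [Group Γ] [Group H] [TopologicalSpace H]
  [IsTopologicalGroup H]

/-- An isometric action of a group `Γ` mapping densely to `H` extends continuously to `H` if its
orbit maps are continuous at the identity for the topology induced from `H`. -/
theorem exists_continuous_extension [CompleteSpace X] {π : Γ →* H} (hπ : DenseRange π)
    {ρ : Γ →* (X ≃ᵢ X)}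
    (hρ : ∀ x, Tendsto (fun γ => dist (ρ γ x) x) (comap π (𝓝 1)) (𝓝 0)) :
    ∃ α : H →* (X ≃ᵢ X), IsContinuousAction α ∧ ∀ γ, α (π γ) = ρ γ := by
  have hne : ∀ g : H, (comap π (𝓝 g)).NeBot := fun g => by
    rw [comap_neBot_iff]
    intro t ht
    obtain ⟨_, hx, γ, rfl⟩ := mem_closure_iff_nhds.1 (hπ g) t ht
    exact ⟨γ, hx⟩
  have hlim : ∀ (g : H) (x : X), ∃ y, Tendsto (fun γ => ρ γ x) (comap π (𝓝 g)) (𝓝 y) := by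
    intro g x
    have := hne g
    refine cauchy_map_iff_exists_tendsto.1 (cauchy_map_iff.2 ⟨hne g, ?_⟩)
    rw [Metric.uniformity_eq_comap_nhds_zero, tendsto_comap_iff]
    have h1 : Tendsto (fun p : Γ × Γ => p.2⁻¹ * p.1) (comap π (𝓝 g) ×ˢ comap π (𝓝 g))
        (comap π (𝓝 1)) := by
      rw [tendsto_comap_iff]
      have h2 : Tendsto (fun p : H × H => p.2⁻¹ * p.1) (𝓝 g ×ˢ 𝓝 g) (𝓝 (g⁻¹ * g)) := by
        rw [← nhds_prod_eq]
        exact (continuous_snd.inv.mul continuous_fst).tendsto (g, g)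
      rw [inv_mul_cancel] at h2
      refine (h2.comp (tendsto_comap.prodMap tendsto_comap)).congr fun p => ?_
      simp
    refine ((hρ x).comp h1).congr fun p => ?_
    simp only [Function.comp_apply]
    rw [← (ρ p.2).dist_eq, ← IsometryEquiv.mul_apply, ← map_mul, mul_inv_cancel_left]
  choose L hL using hlim
  have hdist : ∀ g x y, dist (L g x) (L g y) = dist x y := fun g x y => by
    have := hne g
    refine tendsto_nhds_unique ((hL g x).dist (hL g y)) ?_
    simp only [IsometryEquiv.dist_eq]
    exact tendsto_const_nhds
  have hmul : ∀ g h x, L (g * h) x = L g (L h x) := fun g h x => by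
    have := hne g
    have := hne h
    have h1 : Tendsto (fun p : Γ × Γ => p.1 * p.2) (comap π (𝓝 g) ×ˢ comap π (𝓝 h))
        (comap π (𝓝 (g * h))) := by
      rw [tendsto_comap_iff]
      have h2 : Tendsto (fun p : H × H => p.1 * p.2) (𝓝 g ×ˢ 𝓝 h) (𝓝 (g * h)) := by
        rw [← nhds_prod_eq]
        exact continuous_mul.tendsto (g, h)
      refine (h2.comp (tendsto_comap.prodMap tendsto_comap)).congr fun p => ?_
      simp
    refine tendsto_nhds_unique ((hL (g * h) x).comp h1) ?_
    rw [tendsto_iff_dist_tendsto_zero]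
    have h3 : Tendsto (fun p : Γ × Γ => dist (ρ p.2 x) (L h x) + dist (ρ p.1 (L h x)) (L g (L h x)))
        (comap π (𝓝 g) ×ˢ comap π (𝓝 h)) (𝓝 (0 + 0)) :=
      ((tendsto_iff_dist_tendsto_zero.1 (hL h x)).comp tendsto_snd).add
        ((tendsto_iff_dist_tendsto_zero.1 (hL g (L h x))).comp tendsto_fst)
    rw [add_zero] at h3
    refine squeeze_zero (fun _ => dist_nonneg) (fun p => ?_) h3
    simp only [Function.comp_apply, map_mul, IsometryEquiv.mul_apply]
    have := dist_triangle (ρ p.1 (ρ p.2 x)) (ρ p.1 (L h x)) (L g (L h x))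
    rwa [IsometryEquiv.dist_eq] at this
  have hext : ∀ γ x, L (π γ) x = ρ γ x := fun γ x => by
    have h1 : pure γ ≤ comap π (𝓝 (π γ)) := by
      rw [← map_le_iff_le_comap, map_pure]; exact pure_le_nhds _
    exact tendsto_nhds_unique ((hL (π γ) x).mono_left h1) (tendsto_pure_nhds _ _)
  have hone : ∀ x, L 1 x = x := fun x => by
    have := hext 1 x
    rwa [map_one, map_one] at this
  refine ⟨MonoidHom.mk' (fun g => IsometryEquiv.mk' (L g) (L g⁻¹)
    (fun x => by rw [← hmul, mul_inv_cancel, hone]) (Isometry.of_dist_eq (hdist g)))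
    fun g h => IsometryEquiv.ext fun x => hmul g h x, ?_,
    fun γ => IsometryEquiv.ext fun x => hext γ x⟩
  show Continuous fun p : H × X => L p.1 p.2
  rw [continuous_iff_continuousAt]
  rintro ⟨g, x⟩
  have horb : Tendsto (fun h => dist (L h x) x) (𝓝 1) (𝓝 0) := by
    rw [Metric.tendsto_nhds]
    intro ε hε
    have h1 := (hρ x).eventually_lt_const (half_pos hε)
    rw [eventually_comap] at h1
    obtain ⟨U, hU, hUo, hU1⟩ := eventually_nhds_iff.1 h1
    filter_upwards [hUo.mem_nhds hU1] with h hh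
    have := hne h
    have h2 : dist (L h x) x ≤ ε / 2 := by
      refine le_of_tendsto ((hL h x).dist tendsto_const_nhds) ?_
      filter_upwards [preimage_mem_comap (hUo.mem_nhds hh)] with γ hγ
      exact (hU _ hγ γ rfl).le
    rw [Real.dist_eq, sub_zero, abs_of_nonneg dist_nonneg]
    linarith
  rw [ContinuousAt, tendsto_iff_dist_tendsto_zero]
  have h4 : Tendsto (fun p : H × X => g⁻¹ * p.1) (𝓝 (g, x)) (𝓝 1) := by
    have : Tendsto (fun p : H × X => g⁻¹ * p.1) (𝓝 (g, x)) (𝓝 (g⁻¹ * g)) :=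
      (continuous_const.mul continuous_fst).tendsto (g, x)
    rwa [inv_mul_cancel] at this
  have h5 : Tendsto (fun p : H × X => dist p.2 x + dist (L (g⁻¹ * p.1) x) x) (𝓝 (g, x))
      (𝓝 (0 + 0)) := by
    refine Tendsto.add ?_ (horb.comp h4)
    exact tendsto_iff_dist_tendsto_zero.1 (continuous_snd.tendsto (g, x))
  rw [add_zero] at h5
  refine squeeze_zero (fun _ => dist_nonneg) (fun p => ?_) h5
  have h6 := dist_triangle (L p.1 p.2) (L p.1 x) (L g x)
  rw [hdist] at h6
  have h7 : dist (L (g⁻¹ * p.1) x) x = dist (L p.1 x) (L g x) := by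
    rw [← hdist g, ← hmul, mul_inv_cancel_left]
  rw [h7]
  exact h6

/-- The points whose orbit map is continuous for the topology induced from `H` form an invariant
closed convex set; for a minimal action it suffices to find one such point. -/
theorem IsReduced.exists_continuous_extension [MidSpace X] [CompleteSpace X]
    {π : Γ →* H} (hπ : DenseRange π)
    {ρ : Γ →* (X ≃ᵢ X)} (hred : IsReduced ρ) (hfix : ¬ HasGlobalFixedPoint ρ) (p : X)
    (hp : Tendsto (fun γ => dist (ρ γ p) p) (comap π (𝓝 1)) (𝓝 0)) :
    ∃ α : H →* (X ≃ᵢ X), IsContinuousAction α ∧ ∀ γ, α (π γ) = ρ γ := by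
  refine Superrigidity.exists_continuous_extension hπ ?_
  have hC : IsInvConvex ρ {x | Tendsto (fun γ => dist (ρ γ x) x) (comap π (𝓝 1)) (𝓝 0)} := by
    refine ⟨⟨p, hp⟩, ?_, fun x hx y hy => ?_, fun h x hx => ?_⟩
    · refine isClosed_of_closure_subset fun x hx => ?_
      show Tendsto _ _ _
      rw [Metric.tendsto_nhds]
      intro ε hε
      obtain ⟨y, hy, hxy⟩ := Metric.mem_closure_iff.1 hx (ε / 3) (by positivity)
      filter_upwards [hy.eventually_lt_const (show 0 < ε / 3 by positivity)] with γ hγ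
      rw [Real.dist_eq, sub_zero, abs_of_nonneg dist_nonneg]
      have h1 := dist_triangle4 (ρ γ x) (ρ γ y) y x
      rw [IsometryEquiv.dist_eq, dist_comm y x] at h1
      linarith
    · have h1 : Tendsto (fun γ => (dist (ρ γ x) x + dist (ρ γ y) y) / 2) (comap π (𝓝 1))
          (𝓝 ((0 + 0) / 2)) := (Tendsto.add hx hy).div_const 2
      norm_num at h1
      refine squeeze_zero (fun _ => dist_nonneg) (fun γ => ?_) h1
      rw [map_mid]
      exact dist_mid_mid_le _ _ _ _
    · have h1 : Tendsto (fun γ => h⁻¹ * γ * h) (comap π (𝓝 1)) (comap π (𝓝 1)) := by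
        rw [tendsto_comap_iff]
        have h2 : Tendsto (fun g : H => (π h)⁻¹ * g * π h) (𝓝 1) (𝓝 ((π h)⁻¹ * 1 * π h)) :=
          ((continuous_const.mul continuous_id).mul continuous_const).tendsto 1
        rw [mul_one, inv_mul_cancel] at h2
        refine (h2.comp tendsto_comap).congr fun γ => ?_
        simp
      refine (Tendsto.comp hx h1).congr fun γ => ?_
      simp only [Function.comp_apply]
      rw [← (ρ h).dist_eq, ← IsometryEquiv.mul_apply, ← map_mul, ← IsometryEquiv.mul_apply,
        ← map_mul]
      congr 3
      group
  intro x
  have hx : x ∈ {x | Tendsto (fun γ => dist (ρ γ x) x) (comap π (𝓝 1)) (𝓝 0)} := by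
    rw [hred.eq_univ_of_isInvConvex hfix hC]; exact Set.mem_univ x
  exact hx

end Extension

/-! ### Periodization over a discrete subgroup -/

section Periodization

variable {G : Type*} [Group G] (Γ : Subgroup G)

/-- The periodization `g ↦ ∑ γ, φ (g γ)` of a function on `G`. The finite sum `∑ᶠ` is meaningful for
compactly supported `φ` and discrete `Γ`, by `finite_support_mul`. -/
noncomputable def periodize (φ : G → ℝ) (g : G) : ℝ := ∑ᶠ γ : Γ, φ (g * γ)

theorem periodize_mul (φ : G → ℝ) (g : G) (γ : Γ) : periodize Γ φ (g * γ) = periodize Γ φ g := by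
  unfold periodize
  rw [← finsum_comp_equiv (Equiv.mulLeft γ) (f := fun γ' : Γ => φ (g * γ'))]
  simp [mul_assoc]

theorem periodize_comp_mul_left (φ : G → ℝ) (h g : G) :
    periodize Γ (fun x => φ (h * x)) g = periodize Γ φ (h * g) := by
  simp [periodize, mul_assoc]

theorem periodize_nonneg {φ : G → ℝ} (hφ : ∀ g, 0 ≤ φ g) (g : G) : 0 ≤ periodize Γ φ g :=
  finsum_nonneg fun _ => hφ _

variable [TopologicalSpace G] [IsTopologicalGroup G]

theorem exists_compact_image_mk_eq_univ [LocallyCompactSpace G] [CompactSpace (G ⧸ Γ)] :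
    ∃ K : Set G, IsCompact K ∧ ∀ q : G ⧸ Γ, ∃ g ∈ K, (g : G ⧸ Γ) = q := by
  choose N hN hNg using fun g : G => exists_compact_mem_nhds g
  obtain ⟨t, -, ht⟩ := isCompact_univ.elim_nhds_subcover
    (fun q : G ⧸ Γ => ((↑) : G → G ⧸ Γ) '' N q.out) (fun q _ => by
      have := (QuotientGroup.isOpenMap_coe (N := Γ)).image_mem_nhds (hNg q.out)
      rwa [QuotientGroup.out_eq' q] at this)
  refine ⟨⋃ q ∈ t, N q.out, t.isCompact_biUnion fun q _ => hN _, fun q => ?_⟩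
  obtain ⟨p, hp, g, hg, rfl⟩ := Set.mem_iUnion₂.1 (ht (Set.mem_univ q))
  exact ⟨g, Set.mem_iUnion₂.2 ⟨p, hp, hg⟩, rfl⟩

theorem exists_hasCompactSupport_eq [T2Space G] [LocallyCompactSpace G] {L : Set G}
    (hL : IsCompact L) {M : ℝ} (hM : 0 ≤ M) :
    ∃ φ : G → ℝ, Continuous φ ∧ HasCompactSupport φ ∧ (∀ g, 0 ≤ φ g) ∧ ∀ g ∈ L, φ g = M := by
  obtain ⟨f, hf1, hf2, hf3⟩ :=
    exists_continuousMap_one_of_isCompact_subset_isOpen hL isOpen_univ (Set.subset_univ L)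
  refine ⟨fun g => M * f g, by fun_prop, HasCompactSupport.mul_left (f := fun _ => M)
    (hasCompactSupport_def.2 hf2), fun g => mul_nonneg hM (hf3.2 g).1, fun g hg => ?_⟩
  simp [hf1 hg]

variable [T2Space G] [DiscreteTopology Γ]

/-- Only finitely many elements of a discrete subgroup translate a point of one compact set into
another one. -/
theorem finite_return {K L : Set G} (hK : IsCompact K) (hL : IsCompact L) :
    {γ : Γ | ∃ g ∈ K, g * γ ∈ L}.Finite := by
  have h1 := Γ.tendsto_coe_cofinite_of_discrete ⟨‹_›⟩ (hK.inv.mul hL).compl_mem_cocompact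
  rw [mem_map, mem_cofinite] at h1
  refine h1.subset fun γ hγ => ?_
  obtain ⟨g, hg, hgγ⟩ := hγ
  simp only [Set.mem_compl_iff, Set.mem_preimage, not_not]
  exact ⟨g⁻¹, Set.inv_mem_inv.2 hg, g * γ, hgγ, by group⟩

theorem continuous_periodize [LocallyCompactSpace G] {φ : G → ℝ} (hφ : Continuous φ)
    (hs : HasCompactSupport φ) : Continuous (periodize Γ φ) := by
  refine continuous_finsum (fun γ => hφ.comp (continuous_mul_const _)) fun g => ?_
  obtain ⟨N, hN, hNg⟩ := exists_compact_mem_nhds g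
  refine ⟨N, hNg, (finite_return Γ hN hs).subset ?_⟩
  rintro γ ⟨x, hx, hxN⟩
  exact ⟨x, hxN, subset_tsupport _ hx⟩

theorem finite_support_mul {φ : G → ℝ} (hs : HasCompactSupport φ) (g : G) :
    (Function.support fun γ : Γ => φ (g * γ)).Finite :=
  (finite_return Γ (isCompact_singleton (x := g)) hs).subset fun _ hγ =>
    ⟨g, rfl, subset_tsupport _ hγ⟩

/-- There is a compactly supported continuous weight whose periodization is `1`. -/
theorem exists_periodize_eq_one [LocallyCompactSpace G] [CompactSpace (G ⧸ Γ)] :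
    ∃ w : G → ℝ, Continuous w ∧ HasCompactSupport w ∧ (∀ g, 0 ≤ w g) ∧
      ∀ g, periodize Γ w g = 1 := by
  obtain ⟨K, hK, hKq⟩ := exists_compact_image_mk_eq_univ Γ
  obtain ⟨φ, hφ, hφs, hφ0, hφ1⟩ := exists_hasCompactSupport_eq hK zero_le_one
  have hpos : ∀ g, 0 < periodize Γ φ g := by
    intro g
    obtain ⟨k, hk, hkg⟩ := hKq g
    obtain ⟨γ, hγ⟩ : ∃ γ : Γ, g * γ = k :=
      ⟨⟨g⁻¹ * k, QuotientGroup.eq.1 hkg.symm⟩, mul_inv_cancel_left g k⟩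
    refine finsum_pos (fun _ => hφ0 _) ⟨γ, ?_⟩ (finite_support_mul Γ hφs g)
    rw [hγ, hφ1 k hk]
    exact one_pos
  refine ⟨fun g => φ g * (periodize Γ φ g)⁻¹,
    hφ.mul ((continuous_periodize Γ hφ hφs).inv₀ fun g => (hpos g).ne'),
    hφs.mul_right, fun g => mul_nonneg (hφ0 g) (inv_nonneg.2 (hpos g).le), fun g => ?_⟩
  simp only [periodize]
  have h1 : ∀ γ : Γ, φ (g * γ) * (∑ᶠ γ' : Γ, φ (g * γ * γ'))⁻¹
      = φ (g * γ) * (periodize Γ φ g)⁻¹ := fun γ => by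
    have := periodize_mul Γ φ g γ
    unfold periodize at this ⊢
    rw [this]
  simp only [h1]
  rw [← finsum_mul]
  exact mul_inv_cancel₀ (hpos g).ne'

end Periodization

/-! ### The invariant measure on the quotient by a uniform lattice -/

section InvariantMeasure

variable {G : Type*} [Group G] [TopologicalSpace G] [IsTopologicalGroup G]

theorem hasCompactSupport_comp_inv {φ : G → ℝ} (hφ : HasCompactSupport φ) :
    HasCompactSupport fun s => φ s⁻¹ :=
  hφ.comp_homeomorph (Homeomorph.inv G)

theorem t2Space_quotient [T2Space G] (Γ : Subgroup G) [DiscreteTopology Γ] : T2Space (G ⧸ Γ) := by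
  rw [t2Space_iff_of_isOpenQuotientMap (QuotientGroup.isOpenQuotientMap_mk (N := Γ))]
  have h1 : IsClosed (Γ : Set G) := Subgroup.isClosed_of_discrete
  have : {q : G × G | (q.1 : G ⧸ Γ) = q.2} = (fun q : G × G => q.1⁻¹ * q.2) ⁻¹' Γ := by
    ext q; exact QuotientGroup.eq
  rw [this]
  exact h1.preimage (by fun_prop)

variable [MeasurableSpace G] [BorelSpace G] (μ : Measure G) [μ.IsHaarMeasure]

theorem integral_inv_mul_right (ψ : G → ℝ) (a : G) :
    ∫ s, ψ (s⁻¹ * a) ∂μ = ∫ s, ψ s⁻¹ ∂μ := by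
  rw [← integral_mul_left_eq_self (μ := μ) (fun s => ψ s⁻¹) a⁻¹]
  simp

/-- Right translations scale the integral against Haar measure by a constant, a value of the modular
function. -/
theorem exists_integral_mul_inv (h : G) : ∃ c : ℝ, ∀ ψ : G → ℝ, Continuous ψ →
    HasCompactSupport ψ → ∫ s, ψ (h * s⁻¹) ∂μ = c * ∫ s, ψ s⁻¹ ∂μ := by
  refine ⟨(Measure.haarScalarFactor (Measure.map (· * h⁻¹) μ) μ : ℝ), fun ψ hψ hs => ?_⟩
  have h1 := Measure.integral_isMulLeftInvariant_eq_smul_of_hasCompactSupport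
    (Measure.map (· * h⁻¹) μ) μ (f := fun s => ψ s⁻¹) (hψ.comp continuous_inv)
    (hs.comp_homeomorph (Homeomorph.inv G))
  have hm : AEStronglyMeasurable (fun s => ψ s⁻¹) (Measure.map (· * h⁻¹) μ) :=
    (hψ.comp continuous_inv).aestronglyMeasurable
  rw [integral_map (by fun_prop) hm, integral_smul_nnreal_measure] at h1
  simpa [NNReal.smul_def] using h1

theorem integrable_comp_inv {φ : G → ℝ} (hφ : Continuous φ) (hs : HasCompactSupport φ) :
    Integrable (fun s => φ s⁻¹) μ :=
  (hφ.comp continuous_inv).integrable_of_hasCompactSupport (hasCompactSupport_comp_inv hs)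

variable [T2Space G] (Γ : Subgroup G) [DiscreteTopology Γ]

/-- Unfolding: periodization can be moved from one factor to the other. The integrals are taken over
`s⁻¹`, i.e. against a right Haar measure, since `Γ` acts on `G` from the right. -/
theorem integral_mul_periodize {φ w F : G → ℝ} (hφ : Continuous φ) (hφs : HasCompactSupport φ)
    (hw : Continuous w) (hws : HasCompactSupport w) (hF : Continuous F)
    (hFΓ : ∀ g, ∀ γ : Γ, F (g * γ) = F g) :
    ∫ s, φ s⁻¹ * periodize Γ w s⁻¹ * F s⁻¹ ∂μ = ∫ s, w s⁻¹ * periodize Γ φ s⁻¹ * F s⁻¹ ∂μ := by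
  have hT := finite_return Γ (hφs.union hws) (hφs.union hws)
  set T := hT.toFinset with hTdef
  have hTinv : ∀ γ : Γ, γ ∈ T ↔ γ⁻¹ ∈ T := by
    have : ∀ γ : Γ, γ ∈ T → γ⁻¹ ∈ T := fun γ hγ => by
      rw [hTdef, Set.Finite.mem_toFinset] at hγ ⊢
      obtain ⟨g, hg, hgγ⟩ := hγ
      exact ⟨g * γ, hgγ, by simpa using hg⟩
    exact fun γ => ⟨this γ, fun h => by simpa using this _ h⟩
  have key : ∀ a b : G → ℝ, (tsupport a ⊆ tsupport φ ∪ tsupport w) →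
      (tsupport b ⊆ tsupport φ ∪ tsupport w) → ∀ g,
      a g * periodize Γ b g * F g = ∑ γ ∈ T, a g * b (g * γ) * F g := by
    intro a b ha hb g
    by_cases hag : a g = 0
    · simp [hag]
    · rw [periodize, finsum_eq_sum_of_support_subset (s := T), Finset.mul_sum, Finset.sum_mul]
      intro γ hγ
      rw [hTdef, Set.Finite.coe_toFinset]
      exact ⟨g, ha (subset_tsupport _ hag), hb (subset_tsupport _ hγ)⟩
  simp only [key φ w Set.subset_union_left Set.subset_union_right,
    key w φ Set.subset_union_right Set.subset_union_left]
  have hint : ∀ a b : G → ℝ, Continuous a → HasCompactSupport a → Continuous b → ∀ γ : Γ,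
      Integrable (fun s => a s⁻¹ * b (s⁻¹ * γ) * F s⁻¹) μ := fun a b ha has hb γ => by
    refine integrable_comp_inv μ (φ := fun g => a g * b (g * γ) * F g) (by fun_prop) ?_
    simp only [mul_assoc]
    exact has.mul_right
  rw [integral_finsetSum _ fun γ _ => hint φ w hφ hφs hw γ,
    integral_finsetSum _ fun γ _ => hint w φ hw hws hφ γ]
  refine Finset.sum_bij' (fun γ _ => γ⁻¹) (fun γ _ => γ⁻¹) (fun γ h => (hTinv γ).1 h)
    (fun γ h => (hTinv γ).1 h) (fun γ _ => inv_inv γ) (fun γ _ => inv_inv γ) fun γ _ => ?_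
  rw [← integral_inv_mul_right μ (fun g => w g * φ (g * ((γ⁻¹ : Γ) : G)) * F g) γ]
  refine integral_congr_ae (Eventually.of_forall fun s => ?_)
  simp only [hFΓ, Subgroup.coe_inv, mul_inv_cancel_right]
  ring

variable [LocallyCompactSpace G] [CompactSpace (G ⧸ Γ)] [MeasurableSpace (G ⧸ Γ)]
  [BorelSpace (G ⧸ Γ)]

/-- A uniform lattice `Γ` admits an invariant probability measure on `G ⧸ Γ`; it is comparable with
the image of Haar measure on large compact sets. The measure is the Riesz measure of the functional
`F ↦ ∫ w(s⁻¹) F(s⁻¹ Γ) dμ(s)`, where the weight `w` has periodization `1`, divided by its value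
at `1`. Invariance holds up to a constant by `exists_integral_mul_inv`, and the constant is `1`
because the total mass is finite: `G` is unimodular. -/
theorem exists_invariant_measure : ∃ ν : Measure (G ⧸ Γ), IsProbabilityMeasure ν ∧ ν.Regular ∧
    ν.IsOpenPosMeasure ∧ SMulInvariantMeasure G (G ⧸ Γ) ν ∧
    (∀ θ : G → ℝ, Continuous θ → HasCompactSupport θ → ∃ C : ℝ, 0 ≤ C ∧ ∀ F : C(G ⧸ Γ, ℝ),
      (∀ q, 0 ≤ F q) → ∀ x : G ⧸ Γ, ∫ s, |θ s| * F (s⁻¹ • x) ∂μ ≤ C * ∫ q, F q ∂ν) ∧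
    (∃ θ : G → ℝ, Continuous θ ∧ HasCompactSupport θ ∧ (∀ s, 0 ≤ θ s) ∧ ∀ F : C(G ⧸ Γ, ℝ),
      (∀ q, 0 ≤ F q) → ∀ x : G ⧸ Γ, ∫ q, F q ∂ν ≤ ∫ s, θ s * F (s⁻¹ • x) ∂μ) := by
  have := t2Space_quotient Γ
  obtain ⟨K, hK, hKq⟩ := exists_compact_image_mk_eq_univ Γ
  obtain ⟨w, hw, hws, hw0, hw1⟩ := exists_periodize_eq_one Γ
  have hcoe : Continuous ((↑) : G → G ⧸ Γ) := QuotientGroup.continuous_mk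
  have hint : ∀ F : G ⧸ Γ → ℝ, Continuous F → Integrable (fun s : G => w s⁻¹ * F (s⁻¹ : G)) μ :=
    fun F hF => integrable_comp_inv μ (φ := fun g => w g * F (g : G)) (by fun_prop) hws.mul_right
  set m := ∫ s, w s⁻¹ ∂μ with hm
  -- positivity of the functional
  have hpos : ∀ F : G ⧸ Γ → ℝ, Continuous F → (∀ q, 0 ≤ F q) → (∃ q, F q ≠ 0) →
      0 < ∫ s, w s⁻¹ * F (s⁻¹ : G) ∂μ := by
    rintro F hF hF0 ⟨q, hq⟩
    obtain ⟨g, -, rfl⟩ := hKq q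
    obtain ⟨γ, hγ⟩ : ∃ γ : Γ, w (g * γ) ≠ 0 := by
      by_contra! hall
      have h1 := hw1 g
      simp [periodize, hall] at h1
    have hc : Continuous fun s : G => w s⁻¹ * F (s⁻¹ : G) := by fun_prop
    refine hc.integral_pos_of_hasCompactSupport_nonneg_nonzero (x := (g * γ)⁻¹)
      (hasCompactSupport_comp_inv (φ := fun g : G => w g * F g) hws.mul_right)
      (fun s => mul_nonneg (hw0 _) (hF0 _)) ?_
    simp only [inv_inv]
    have : ((g * γ : G) : G ⧸ Γ) = g := by
      rw [QuotientGroup.eq]; simp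
    rw [this]
    exact mul_ne_zero hγ hq
  have hm0 : 0 < m := by
    have := hpos (fun _ => 1) continuous_const (fun _ => zero_le_one)
      ⟨((1 : G) : G ⧸ Γ), one_ne_zero⟩
    simpa [hm] using this
  let Λ₀ : CompactlySupportedContinuousMap (G ⧸ Γ) ℝ →ₗ[ℝ] ℝ :=
    { toFun := fun F => m⁻¹ * ∫ s, w s⁻¹ * F (s⁻¹ : G) ∂μ
      map_add' := fun F F' => by
        simp only [CompactlySupportedContinuousMap.coe_add, Pi.add_apply, mul_add]
        have := integral_add (hint _ F.continuous) (hint _ F'.continuous)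
        rw [← mul_add]
        exact congrArg _ this
      map_smul' := fun c F => by
        simp only [CompactlySupportedContinuousMap.coe_smul, Pi.smul_apply, smul_eq_mul,
          RingHom.id_apply]
        simp only [mul_left_comm _ c]
        rw [integral_const_mul, mul_left_comm] }
  let Λ : CompactlySupportedContinuousMap (G ⧸ Γ) ℝ →ₚ[ℝ] ℝ :=
    PositiveLinearMap.mk₀ Λ₀ fun F hF => mul_nonneg (inv_nonneg.2 hm0.le)
      (integral_nonneg fun s => mul_nonneg (hw0 _) (hF _))
  set ν := RealRMK.rieszMeasure Λ with hν
  have hνF : ∀ F : G ⧸ Γ → ℝ, Continuous F →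
      ∫ q, F q ∂ν = m⁻¹ * ∫ s, w s⁻¹ * F (s⁻¹ : G) ∂μ := fun F hF =>
    RealRMK.integral_rieszMeasure Λ ⟨⟨F, hF⟩, HasCompactSupport.of_compactSpace _⟩
  have hprob : IsProbabilityMeasure ν := by
    have h1 := hνF (fun _ => 1) continuous_const
    simp only [integral_const, mul_one, smul_eq_mul] at h1
    rw [← hm, inv_mul_cancel₀ hm0.ne'] at h1
    exact isProbabilityMeasure_iff_real.2 h1
  -- unfolding: only the periodization of a weight matters
  have hunfold : ∀ (φ : G → ℝ), Continuous φ → HasCompactSupport φ → ∀ F : G ⧸ Γ → ℝ,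
      Continuous F → ∫ s, φ s⁻¹ * F (s⁻¹ : G) ∂μ
        = ∫ s, w s⁻¹ * periodize Γ φ s⁻¹ * F (s⁻¹ : G) ∂μ := fun φ hφ hφs F hF => by
    rw [← integral_mul_periodize μ Γ hφ hφs hw hws (F := fun g => F g) (by fun_prop)
      fun g γ => congrArg F (by rw [QuotientGroup.eq]; simp)]
    simp [hw1]
  refine ⟨ν, hprob, inferInstance, ⟨fun U hU hUne hU0 => ?_⟩, ?_, ?_, ?_⟩
  · obtain ⟨q, hq⟩ := hUne
    obtain ⟨F, hF1, -, hF2, hF3⟩ := exists_continuousMap_one_of_isCompact_subset_isOpen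
      (isCompact_singleton (x := q)) hU (Set.singleton_subset_iff.2 hq)
    have h1 := hpos F F.continuous (fun q => (hF3 q).1) ⟨q, by rw [hF1 rfl]; exact one_ne_zero⟩
    have h2 := hνF F F.continuous
    have h3 : ∫ q, F q ∂ν = 0 := by
      refine integral_eq_zero_of_ae ?_
      filter_upwards [measure_eq_zero_iff_ae_notMem.1 hU0] with x hx
      by_contra hne
      exact hx (hF2 (subset_tsupport _ hne))
    rw [h3] at h2
    have := mul_pos (inv_pos.2 hm0) h1
    linarith
  · have hmp : ∀ h : G, Measure.map (fun q : G ⧸ Γ => h • q) ν = ν := fun h => by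
      have hreg : (Measure.map (fun q : G ⧸ Γ => h • q) ν).Regular :=
        Measure.Regular.map (Homeomorph.smul h)
      have hfin : IsFiniteMeasure (Measure.map (fun q : G ⧸ Γ => h • q) ν) := inferInstance
      obtain ⟨c, hc⟩ := exists_integral_mul_inv μ h
      have hinv : ∀ F : G ⧸ Γ → ℝ, Continuous F →
          ∫ s, w s⁻¹ * F (h • ((s⁻¹ : G) : G ⧸ Γ)) ∂μ = c * ∫ s, w s⁻¹ * F (s⁻¹ : G) ∂μ := by
        intro F hF
        have hwh : HasCompactSupport fun g => w (h⁻¹ * g) :=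
          hws.comp_homeomorph (Homeomorph.mulLeft h⁻¹)
        have h1 := hc (fun g => w (h⁻¹ * g) * F (g : G)) (by fun_prop) hwh.mul_right
        rw [hunfold (fun g => w (h⁻¹ * g)) (by fun_prop) hwh F hF] at h1
        simp only [periodize_comp_mul_left, hw1, mul_one, inv_mul_cancel_left] at h1
        exact h1
      have hc1 : c = 1 := by
        have h1 := hinv (fun _ => 1) continuous_const
        simp only [mul_one, ← hm] at h1
        exact mul_right_cancel₀ hm0.ne' (h1.symm.trans (one_mul m).symm)
      refine Measure.ext_of_integral_eq_on_compactlySupported fun F => ?_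
      have hFc : Continuous fun q => F q := F.continuous
      rw [integral_map (by fun_prop) hFc.aestronglyMeasurable, hνF F F.continuous,
        hνF (fun q => F (h • q)) (by fun_prop), hinv F F.continuous, hc1, one_mul]
    exact ⟨fun h s hs => by
      rw [← Measure.map_apply (by fun_prop) hs, hmp]⟩
  · intro θ hθ hθs
    obtain ⟨M, hM⟩ := hθ.bounded_above_of_compact_support hθs
    have hM0 : 0 ≤ M := (norm_nonneg _).trans (hM 1)
    obtain ⟨φ, hφ, hφs, hφ0, hφM⟩ :=
      exists_hasCompactSupport_eq ((IsCompact.inv hθs).mul hK) hM0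
    obtain ⟨P, hP⟩ := hK.exists_bound_of_continuousOn (continuous_periodize Γ hφ hφs).continuousOn
    have hPg : ∀ g, periodize Γ φ g ≤ |P| := fun g => by
      obtain ⟨k, hk, hkg⟩ := hKq g
      obtain ⟨γ, rfl⟩ : ∃ γ : Γ, g = k * γ :=
        ⟨⟨k⁻¹ * g, QuotientGroup.eq.1 hkg⟩, (mul_inv_cancel_left k g).symm⟩
      rw [periodize_mul]
      exact (le_abs_self _).trans ((hP k hk).trans (le_abs_self _))
    refine ⟨|P| * m, by positivity, fun F hF0 x => ?_⟩
    obtain ⟨a, ha, rfl⟩ := hKq x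
    have hFc := F.continuous
    calc ∫ s, |θ s| * F (s⁻¹ • (a : G ⧸ Γ)) ∂μ
        ≤ ∫ s, φ (s⁻¹ * a) * F ((s⁻¹ * a : G) : G ⧸ Γ) ∂μ := by
          refine integral_mono_of_nonneg
            (Eventually.of_forall fun s => mul_nonneg (abs_nonneg _) (hF0 _))
            (Continuous.integrable_of_hasCompactSupport (by fun_prop) ?_)
            (Eventually.of_forall fun s => mul_le_mul_of_nonneg_right ?_ (hF0 _))
          · have : HasCompactSupport fun s => φ (s⁻¹ * a) :=
              hφs.comp_homeomorph ((Homeomorph.inv G).trans (Homeomorph.mulRight a))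
            exact this.mul_right
          · by_cases hs : s ∈ tsupport θ
            · rw [hφM _ (Set.mul_mem_mul (Set.inv_mem_inv.2 hs) ha)]
              exact hM s
            · rw [image_eq_zero_of_notMem_tsupport hs, abs_zero]
              exact hφ0 _
      _ = ∫ s, φ s⁻¹ * F (s⁻¹ : G) ∂μ :=
          integral_inv_mul_right μ (fun g => φ g * F (g : G ⧸ Γ)) a
      _ = ∫ s, w s⁻¹ * periodize Γ φ s⁻¹ * F (s⁻¹ : G) ∂μ := hunfold φ hφ hφs F hFc
      _ ≤ ∫ s, |P| * (w s⁻¹ * F (s⁻¹ : G)) ∂μ := by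
          refine integral_mono_of_nonneg (Eventually.of_forall fun s =>
            mul_nonneg (mul_nonneg (hw0 _) (periodize_nonneg Γ hφ0 _)) (hF0 _))
            ((hint F hFc).const_mul _) (Eventually.of_forall fun s => ?_)
          have := mul_le_mul_of_nonneg_left (hPg s⁻¹) (mul_nonneg (hw0 s⁻¹) (hF0 (s⁻¹ : G)))
          simp only []
          linarith
      _ = |P| * m * ∫ q, F q ∂ν := by
          rw [integral_const_mul, hνF F hFc, mul_assoc, mul_inv_cancel_left₀ hm0.ne']
  · obtain ⟨M, hM⟩ := hw.bounded_above_of_compact_support hws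
    have hM0 : 0 ≤ m⁻¹ * M := mul_nonneg (inv_nonneg.2 hm0.le) ((norm_nonneg _).trans (hM 1))
    obtain ⟨θ, hθ, hθs, hθ0, hθM⟩ := exists_hasCompactSupport_eq (hK.mul (IsCompact.inv hws)) hM0
    refine ⟨θ, hθ, hθs, hθ0, fun F hF0 x => ?_⟩
    obtain ⟨a, ha, rfl⟩ := hKq x
    have hFc := F.continuous
    rw [hνF F hFc, ← integral_inv_mul_right μ (fun g => w g * F (g : G ⧸ Γ)) a,
      ← integral_const_mul]
    refine integral_mono_of_nonneg (Eventually.of_forall fun s =>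
      mul_nonneg (inv_nonneg.2 hm0.le) (mul_nonneg (hw0 _) (hF0 _)))
      (Continuous.integrable_of_hasCompactSupport (by fun_prop) hθs.mul_right)
      (Eventually.of_forall fun s => ?_)
    simp only [← mul_assoc]
    refine mul_le_mul_of_nonneg_right ?_ (hF0 _)
    by_cases hs : s⁻¹ * a ∈ tsupport w
    · rw [hθM s ⟨a, ha, (s⁻¹ * a)⁻¹, Set.inv_mem_inv.2 hs, by simp⟩]
      exact mul_le_mul_of_nonneg_left ((le_abs_self _).trans (hM _)) (inv_nonneg.2 hm0.le)
    · rw [image_eq_zero_of_notMem_tsupport hs, mul_zero]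
      exact hθ0 _

end InvariantMeasure

/-! ### Order and strict convexity of `L²` -/

section LpOrder

variable {Q : Type*} [MeasurableSpace Q] (ν : Measure Q)

theorem smul_le_smul_Lp {a : ℝ} (ha : 0 ≤ a) {f h : Lp ℝ 2 ν} (hfh : f ≤ h) : a • f ≤ a • h := by
  rw [← Lp.coeFn_le] at hfh ⊢
  filter_upwards [hfh, Lp.coeFn_smul a f, Lp.coeFn_smul a h] with q h1 h2 h3
  rw [h2, h3]
  exact mul_le_mul_of_nonneg_left h1 ha

theorem isOrderedModule_Lp : IsOrderedModule ℝ (Lp ℝ 2 ν) :=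
  IsOrderedModule.of_smul_nonneg fun a ha f hf => by
    simpa using smul_le_smul_Lp ν ha hf

/-- Equality case of the triangle inequality: nonnegative classes of given equal norms whose
half-sum dominates an element of the same norm coincide. -/
theorem eq_of_le_half_add {f h m : Lp ℝ 2 ν} (hm : 0 ≤ m) (hle : m ≤ (1 / 2 : ℝ) • (f + h))
    (h1 : ‖f‖ = ‖m‖) (h2 : ‖h‖ = ‖m‖) : f = h := by
  refine eq_of_norm_eq_of_norm_add_eq (h1.trans h2.symm) (le_antisymm (norm_add_le _ _) ?_)
  have h3 : ‖m‖ ≤ ‖(1 / 2 : ℝ) • (f + h)‖ := norm_le_norm_of_abs_le_abs (by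
    rwa [abs_of_nonneg hm, abs_of_nonneg (hm.trans hle)])
  rw [norm_smul] at h3
  norm_num at h3
  linarith

end LpOrder

/-! ### Continuous functions in `L²` -/

section SquareIntegrable

variable {Q : Type*} [TopologicalSpace Q] [CompactSpace Q] [MeasurableSpace Q] [BorelSpace Q]
  (ν : Measure Q) [IsProbabilityMeasure ν]

/-- The class in `L²(ν)` of a continuous function. -/
noncomputable abbrev toL2 : C(Q, ℝ) →L[ℝ] Lp ℝ 2 ν := ContinuousMap.toLp 2 ν ℝ

theorem integrable_continuousMap (F : C(Q, ℝ)) : Integrable F ν :=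
  F.continuous.integrable_of_hasCompactSupport (HasCompactSupport.of_compactSpace _)

theorem norm_toL2_sq (F : C(Q, ℝ)) : ‖toL2 ν F‖ ^ 2 = ∫ q, F q ^ 2 ∂ν := by
  rw [← real_inner_self_eq_norm_sq, ContinuousMap.inner_toLp]
  simp [sq]

theorem integral_abs_le_norm (F : C(Q, ℝ)) : ∫ q, |F q| ∂ν ≤ ‖toL2 ν F‖ := by
  set a := ∫ q, |F q| ∂ν with ha
  have ha0 : 0 ≤ a := integral_nonneg fun q => abs_nonneg _
  have h1 : Integrable (fun q => F q ^ 2) ν := integrable_continuousMap ν (F ^ 2)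
  have h2 : Integrable (fun q => |F q|) ν := integrable_continuousMap ν |F|
  have h : 0 ≤ ∫ q, (F q ^ 2 - 2 * a * |F q| + a ^ 2) ∂ν :=
    integral_nonneg fun q => by
      have := sq_abs (F q)
      change 0 ≤ F q ^ 2 - 2 * a * |F q| + a ^ 2
      nlinarith [sq_nonneg (|F q| - a)]
  rw [integral_add (f := fun q => F q ^ 2 - 2 * a * |F q|) (h1.sub (h2.const_mul _))
    (integrable_const _), integral_sub h1 (h2.const_mul _), integral_const_mul,
    ← norm_toL2_sq] at h
  simp only [integral_const, probReal_univ, one_smul, ← ha] at h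
  exact abs_le_of_sq_le_sq' (by nlinarith) (norm_nonneg _) |>.2

theorem toL2_mono {F H : C(Q, ℝ)} (h : ∀ q, F q ≤ H q) : toL2 ν F ≤ toL2 ν H := by
  rw [← Lp.coeFn_le]
  filter_upwards [ContinuousMap.coeFn_toLp ν F (p := 2) (𝕜 := ℝ),
    ContinuousMap.coeFn_toLp ν H (p := 2) (𝕜 := ℝ)] with q h1 h2
  rw [h1, h2]
  exact h q

theorem le_of_toL2_le [ν.IsOpenPosMeasure] {F H : C(Q, ℝ)} (h : toL2 ν F ≤ toL2 ν H) (q : Q) :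
    F q ≤ H q := by
  have h0 : toL2 ν (F ⊔ H) = toL2 ν H := by
    apply Lp.ext
    filter_upwards [ContinuousMap.coeFn_toLp ν F (p := 2) (𝕜 := ℝ), (Lp.coeFn_le _ _).2 h,
      ContinuousMap.coeFn_toLp ν H (p := 2) (𝕜 := ℝ),
      ContinuousMap.coeFn_toLp ν (F ⊔ H) (p := 2) (𝕜 := ℝ)] with q h1 h2 h3 h4
    rw [h1, h3] at h2
    rw [h4, h3]
    exact sup_eq_right.2 h2
  have := ContinuousMap.toLp_injective ν h0
  rw [← this]
  exact le_sup_left (a := F q)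

theorem norm_toL2_le (F : C(Q, ℝ)) : ‖toL2 ν F‖ ≤ ‖F‖ := by
  refine ((toL2 ν).le_opNorm F).trans ?_
  have h1 : ‖toL2 ν‖ ≤ 1 := by
    refine (ContinuousMap.toLp_norm_le ν (p := 2) (𝕜 := ℝ) (E := ℝ)).trans ?_
    simp [measureUnivNNReal]
  nlinarith [norm_nonneg F]

/-- The norm in `L²` is monotone with respect to absolute values. -/
theorem norm_toL2_mono {F H : C(Q, ℝ)} (h : ∀ q, |F q| ≤ H q) : ‖toL2 ν F‖ ≤ ‖toL2 ν H‖ := by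
  have h2 : ‖toL2 ν F‖ ^ 2 ≤ ‖toL2 ν H‖ ^ 2 := by
    rw [norm_toL2_sq, norm_toL2_sq]
    refine integral_mono (integrable_continuousMap ν (F ^ 2)) (integrable_continuousMap ν (H ^ 2))
      fun q => ?_
    change F q ^ 2 ≤ H q ^ 2
    rw [← sq_abs (F q)]
    exact pow_le_pow_left₀ (abs_nonneg _) (h q) 2
  exact (pow_le_pow_iff_left₀ (norm_nonneg _) (norm_nonneg _) two_ne_zero).1 h2

theorem norm_toL2_const (a : ℝ) : ‖toL2 ν (ContinuousMap.const Q a)‖ = |a| := by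
  have := norm_toL2_sq ν (ContinuousMap.const Q a)
  simp only [ContinuousMap.const_apply, integral_const, probReal_univ, one_smul] at this
  rw [← abs_norm]
  exact (sq_eq_sq_iff_abs_eq_abs _ _).1 this

end SquareIntegrable

/-! ### Translations of functions -/

section Translation

variable {G Q : Type*} [Group G] [TopologicalSpace G]
  [TopologicalSpace Q] [MulAction G Q] [ContinuousSMul G Q]

/-- The left translate `q ↦ F (g⁻¹ q)` of a continuous function. -/
def trC (g : G) (F : C(Q, ℝ)) : C(Q, ℝ) := ⟨fun q => F (g⁻¹ • q), by fun_prop⟩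

@[simp] theorem trC_apply (g : G) (F : C(Q, ℝ)) (q : Q) : trC g F q = F (g⁻¹ • q) := rfl

theorem continuous_trC [IsTopologicalGroup G] [CompactSpace Q] (F : C(Q, ℝ)) :
    Continuous fun g : G => trC g F :=
  ContinuousMap.continuous_of_continuous_uncurry _ (by
    change Continuous fun p : G × Q => F (p.1⁻¹ • p.2)
    fun_prop)

variable [MeasurableSpace Q] [BorelSpace Q] (ν : Measure Q) [SMulInvariantMeasure G Q ν]

/-- The left translation by `g` on `L²(ν)`. -/
noncomputable def trL (g : G) : Lp ℝ 2 ν →ₗᵢ[ℝ] Lp ℝ 2 ν :=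
  Lp.compMeasurePreservingₗᵢ ℝ (fun q => g⁻¹ • q) (measurePreserving_smul g⁻¹ ν)

theorem coeFn_trL (g : G) (f : Lp ℝ 2 ν) : trL ν g f =ᵐ[ν] fun q => f (g⁻¹ • q) :=
  Lp.coeFn_compMeasurePreserving f (measurePreserving_smul g⁻¹ ν)

theorem trL_mul (g h : G) (f : Lp ℝ 2 ν) : trL ν (g * h) f = trL ν g (trL ν h f) := by
  apply Lp.ext
  filter_upwards [coeFn_trL ν (g * h) f, coeFn_trL ν g (trL ν h f),
    (measurePreserving_smul g⁻¹ ν).quasiMeasurePreserving.ae (coeFn_trL ν h f)] with q h1 h2 h3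
  rw [h1, h2, h3]
  simp [mul_smul]

@[simp] theorem trL_one (f : Lp ℝ 2 ν) : trL ν (1 : G) f = f := by
  apply Lp.ext
  filter_upwards [coeFn_trL ν (1 : G) f] with q h1
  simpa using h1

theorem trL_mono (g : G) {f h : Lp ℝ 2 ν} (hfh : f ≤ h) : trL ν g f ≤ trL ν g h := by
  rw [← Lp.coeFn_le] at hfh ⊢
  filter_upwards [coeFn_trL ν g f, coeFn_trL ν g h,
    (measurePreserving_smul g⁻¹ ν).quasiMeasurePreserving.ae hfh] with q h1 h2 h3
  rw [h1, h2]
  exact h3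

theorem toL2_trC [CompactSpace Q] [IsProbabilityMeasure ν] (g : G) (F : C(Q, ℝ)) :
    toL2 ν (trC g F) = trL ν g (toL2 ν F) := by
  apply Lp.ext
  filter_upwards [coeFn_trL ν g (toL2 ν F), ContinuousMap.coeFn_toLp ν (trC g F) (p := 2) (𝕜 := ℝ),
    (measurePreserving_smul g⁻¹ ν).quasiMeasurePreserving.ae
      (ContinuousMap.coeFn_toLp ν F (p := 2) (𝕜 := ℝ))] with q h1 h2 h3
  rw [h2, h1, h3]
  rfl

theorem trL_const [CompactSpace Q] [IsProbabilityMeasure ν] (g : G) (a : ℝ) :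
    trL ν g (toL2 ν (ContinuousMap.const Q a)) = toL2 ν (ContinuousMap.const Q a) := by
  rw [← toL2_trC]
  rfl

theorem continuous_trL [IsTopologicalGroup G] [CompactSpace Q] [T2Space Q]
    [IsProbabilityMeasure ν] [ν.Regular] (f : Lp ℝ 2 ν) : Continuous fun g : G => trL ν g f := by
  have h : Continuous fun g : G => (⟨fun q => g⁻¹ • q, by fun_prop⟩ : C(Q, Q)) :=
    ContinuousMap.continuous_of_continuous_uncurry _ (by
      change Continuous fun p : G × Q => p.1⁻¹ • p.2
      fun_prop)
  exact Continuous.compMeasurePreservingLp (continuous_const (y := f)) h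
    (fun g => measurePreserving_smul g⁻¹ ν) (by norm_num)

end Translation

/-! ### Approximate identities -/

section ApproximateIdentity

variable {G : Type*} [Group G] [TopologicalSpace G] [IsTopologicalGroup G] [LocallyCompactSpace G]
  [MeasurableSpace G] [BorelSpace G] (μ : Measure G) [μ.IsHaarMeasure]

theorem exists_approximate_identity {U : Set G} (hU : U ∈ 𝓝 (1 : G)) :
    ∃ θ : G → ℝ, Continuous θ ∧ HasCompactSupport θ ∧ (∀ g, 0 ≤ θ g) ∧ ∫ g, θ g ∂μ = 1 ∧
      ∀ g ∉ U, θ g = 0 := by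
  obtain ⟨f, hf1, hf2, hf3, hf4⟩ := exists_continuousMap_one_of_isCompact_subset_isOpen
    (isCompact_singleton (x := (1 : G))) isOpen_interior
    (Set.singleton_subset_iff.2 (mem_interior_iff_mem_nhds.2 hU))
  have hf0 : (0 : G → ℝ) ≤ f := fun g => (hf4 g).1
  have hpos : 0 < ∫ g, f g ∂μ :=
    f.continuous.integral_pos_of_hasCompactSupport_nonneg_nonzero hf2 hf0 (x := 1)
      (by simp [hf1 rfl])
  refine ⟨fun g => (∫ g, f g ∂μ)⁻¹ * f g, by fun_prop, HasCompactSupport.mul_left hf2,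
    fun g => mul_nonneg (inv_nonneg.2 hpos.le) (hf0 g), ?_, fun g hg => ?_⟩
  · rw [integral_const_mul, inv_mul_cancel₀ hpos.ne']
  · beta_reduce
    rw [image_eq_zero_of_notMem_tsupport fun h => hg (interior_subset (hf3 h)), mul_zero]

end ApproximateIdentity

/-! ### Averages of translates -/

section Mollification

/-- Averages `∫ |θ s| F(s⁻¹ x) dμ(s)` of nonnegative continuous functions, with a compactly supported
weight, are bounded by a multiple of the integral of `F` with respect to `ν`. -/
def BoundedAverages {G Q : Type*} [Group G] [TopologicalSpace G] [MeasurableSpace G]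
    (μ : Measure G) [TopologicalSpace Q] [MulAction G Q] [MeasurableSpace Q] (ν : Measure Q) :
    Prop :=
  ∀ θ : G → ℝ, Continuous θ → HasCompactSupport θ →
    ∃ C : ℝ, 0 ≤ C ∧ ∀ F : C(Q, ℝ), (∀ q, 0 ≤ F q) → ∀ x : Q,
      ∫ s, |θ s| * F (s⁻¹ • x) ∂μ ≤ C * ∫ q, F q ∂ν

theorem abs_le_iff_Lp {Q : Type*} [MeasurableSpace Q] {ν : Measure Q} {f e : Lp ℝ 2 ν} :
    |f| ≤ e ↔ -e ≤ f ∧ f ≤ e := by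
  rw [abs, sup_le_iff, neg_le, and_comm]

variable {G Q : Type*} [Group G] [TopologicalSpace G] [IsTopologicalGroup G]
  [MeasurableSpace G] [BorelSpace G] (μ : Measure G) [IsFiniteMeasureOnCompacts μ]
  [TopologicalSpace Q] [CompactSpace Q] [T2Space Q] [MulAction G Q] [ContinuousSMul G Q]
  [MeasurableSpace Q] [BorelSpace Q] (ν : Measure Q) [IsProbabilityMeasure ν] [ν.Regular]
  [SMulInvariantMeasure G Q ν] {θ : G → ℝ}

/-- The average of the translates of `f` with respect to the weight `θ`. -/
noncomputable def mollify (θ : G → ℝ) (f : Lp ℝ 2 ν) : Lp ℝ 2 ν := ∫ g, θ g • trL ν g f ∂μ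

theorem integrable_smul_trL (hθ : Continuous θ) (hs : HasCompactSupport θ) (f : Lp ℝ 2 ν) :
    Integrable (fun g => θ g • trL ν g f) μ :=
  (hθ.smul (continuous_trL ν f)).integrable_of_hasCompactSupport hs.smul_right

/-- Averages of `B`-invariant functions are `B`-invariant, since `B` is normal. -/
theorem trL_mollify {B : Subgroup G} [B.Normal] (hθ : Continuous θ) (hs : HasCompactSupport θ)
    {f : Lp ℝ 2 ν} (hf : ∀ b ∈ B, trL ν b f = f) {b : G} (hb : b ∈ B) :
    trL ν b (mollify μ ν θ f) = mollify μ ν θ f := by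
  unfold mollify
  rw [← LinearIsometry.coe_toContinuousLinearMap,
    ← ContinuousLinearMap.integral_comp_comm _ (integrable_smul_trL μ ν hθ hs f)]
  congr 1
  ext1 g
  rw [map_smul, LinearIsometry.coe_toContinuousLinearMap, ← trL_mul,
    show b * g = g * (g⁻¹ * b * g) by group, trL_mul ν g,
    hf _ (by simpa using Subgroup.Normal.conj_mem ‹B.Normal› b hb g⁻¹)]

theorem norm_mollify_sub_le (hθ : Continuous θ) (hs : HasCompactSupport θ) (h0 : ∀ g, 0 ≤ θ g)
    (f h : Lp ℝ 2 ν) : ‖mollify μ ν θ f - mollify μ ν θ h‖ ≤ (∫ g, θ g ∂μ) * ‖f - h‖ := by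
  unfold mollify
  rw [← integral_sub (integrable_smul_trL μ ν hθ hs f) (integrable_smul_trL μ ν hθ hs h),
    ← integral_mul_const]
  refine norm_integral_le_of_norm_le ((hθ.integrable_of_hasCompactSupport hs).mul_const _)
    (ae_of_all _ fun g => ?_)
  rw [← smul_sub, ← map_sub, norm_smul, LinearIsometry.norm_map, Real.norm_of_nonneg (h0 g)]

theorem mollify_sub_eq (hθ : Continuous θ) (hs : HasCompactSupport θ) (h1 : ∫ g, θ g ∂μ = 1)
    (f : Lp ℝ 2 ν) : mollify μ ν θ f - f = ∫ g, θ g • (trL ν g f - f) ∂μ := by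
  have hi := hθ.integrable_of_hasCompactSupport hs (μ := μ)
  simp_rw [smul_sub]
  rw [integral_sub (integrable_smul_trL μ ν hθ hs f) (hi.smul_const f), integral_smul_const, h1,
    one_smul]
  rfl

theorem norm_mollify_sub_self_le (hθ : Continuous θ) (hs : HasCompactSupport θ)
    (h0 : ∀ g, 0 ≤ θ g) (h1 : ∫ g, θ g ∂μ = 1) {f : Lp ℝ 2 ν} {ε : ℝ}
    (h : ∀ g, θ g ≠ 0 → ‖trL ν g f - f‖ ≤ ε) : ‖mollify μ ν θ f - f‖ ≤ ε := by
  have hi := hθ.integrable_of_hasCompactSupport hs (μ := μ)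
  rw [mollify_sub_eq μ ν hθ hs h1, ← one_mul ε, ← h1, ← integral_mul_const]
  refine norm_integral_le_of_norm_le (hi.mul_const _) (ae_of_all _ fun g => ?_)
  rw [norm_smul, Real.norm_of_nonneg (h0 g)]
  by_cases hg : θ g = 0
  · simp [hg]
  · exact mul_le_mul_of_nonneg_left (h g hg) (h0 g)

theorem abs_mollify_sub_self_le (hθ : Continuous θ) (hs : HasCompactSupport θ)
    (h0 : ∀ g, 0 ≤ θ g) (h1 : ∫ g, θ g ∂μ = 1) {f e : Lp ℝ 2 ν}
    (h : ∀ g, θ g ≠ 0 → |trL ν g f - f| ≤ e) : |mollify μ ν θ f - f| ≤ e := by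
  have := isOrderedModule_Lp ν
  have hi := hθ.integrable_of_hasCompactSupport hs (μ := μ)
  have hi' : Integrable (fun g => θ g • (trL ν g f - f)) μ := by
    simp_rw [smul_sub]
    exact (integrable_smul_trL μ ν hθ hs f).sub (hi.smul_const f)
  have key : ∀ e' : Lp ℝ 2 ν, ∫ g, θ g • e' ∂μ = e' := fun e' => by
    rw [integral_smul_const, h1, one_smul]
  rw [mollify_sub_eq μ ν hθ hs h1, abs_le_iff_Lp]
  constructor
  · rw [← key (-e)]
    refine integral_mono (hi.smul_const _) hi' fun g => ?_
    by_cases hg : θ g = 0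
    · simp [hg]
    · exact smul_le_smul_Lp ν (h0 g) (abs_le_iff_Lp.1 (h g hg)).1
  · rw [← key e]
    refine integral_mono hi' (hi.smul_const _) fun g => ?_
    by_cases hg : θ g = 0
    · simp [hg]
    · exact smul_le_smul_Lp ν (h0 g) (abs_le_iff_Lp.1 (h g hg)).2

/-- Averages of square-integrable functions over `G` are continuous, because the bound `hUp` makes
averaging of continuous functions continuous from the `L²`-norm to the uniform norm. -/
theorem exists_toL2_eq_mollify (hθ : Continuous θ) (hs : HasCompactSupport θ)
    (h0 : ∀ g, 0 ≤ θ g)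
    (hUp : BoundedAverages μ ν) (f : Lp ℝ 2 ν) :
    ∃ H : C(Q, ℝ), toL2 ν H = mollify μ ν θ f := by
  obtain ⟨C, hC, hUp⟩ := hUp θ hθ hs
  have hint : ∀ F : C(Q, ℝ), Integrable (fun g => θ g • trC g F) μ := fun F =>
    (hθ.smul (continuous_trC F)).integrable_of_hasCompactSupport hs.smul_right
  set M : C(Q, ℝ) → C(Q, ℝ) := fun F => ∫ g, θ g • trC g F ∂μ with hM
  have hML : ∀ F, toL2 ν (M F) = mollify μ ν θ (toL2 ν F) := fun F => by
    rw [hM, mollify, ← ContinuousLinearMap.integral_comp_comm _ (hint F)]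
    simp_rw [map_smul, toL2_trC]
  have hsub : ∀ F F', M F - M F' = M (F - F') := fun F F' => by
    simp only [hM]
    rw [← integral_sub (hint F) (hint F')]
    congr 1
    ext g q
    simp [mul_sub]
  have hnorm : ∀ F, ‖M F‖ ≤ C * ‖toL2 ν F‖ := fun F => by
    rw [ContinuousMap.norm_le _ (mul_nonneg hC (norm_nonneg _))]
    intro q
    rw [hM, ContinuousMap.integral_apply (hint F)]
    calc ‖∫ g, (θ g • trC g F) q ∂μ‖ ≤ ∫ g, ‖(θ g • trC g F) q‖ ∂μ :=
          norm_integral_le_integral_norm _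
      _ = ∫ g, |θ g| * |F| (g⁻¹ • q) ∂μ := by simp
      _ ≤ C * ∫ q, |F| q ∂ν := hUp |F| (fun q => abs_nonneg _) q
      _ ≤ C * ‖toL2 ν F‖ := mul_le_mul_of_nonneg_left (integral_abs_le_norm ν F) hC
  obtain ⟨u, hu, hlim⟩ := mem_closure_iff_seq_limit.1
    (ContinuousMap.toLp_denseRange ℝ ν ℝ (p := 2) (by norm_num) f)
  choose F hF using hu
  have hcau : CauchySeq fun n => M (F n) := by
    rw [Metric.cauchySeq_iff']
    intro ε hε
    obtain ⟨N, hN⟩ := Metric.cauchySeq_iff'.1 hlim.cauchySeq (ε / (C + 1)) (by positivity)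
    refine ⟨N, fun n hn => ?_⟩
    have h1 := hN n hn
    rw [← hF, ← hF, dist_eq_norm, ← map_sub, lt_div_iff₀ (by positivity)] at h1
    rw [dist_eq_norm, hsub]
    refine (hnorm _).trans_lt ?_
    nlinarith [norm_nonneg (toL2 ν (F n - F N))]
  obtain ⟨H, hH⟩ := cauchySeq_tendsto_of_complete hcau
  refine ⟨H, tendsto_nhds_unique (((toL2 ν).continuous.tendsto H).comp hH) ?_⟩
  have h2 : Tendsto (fun n => mollify μ ν θ (u n)) atTop (𝓝 (mollify μ ν θ f)) := by
    rw [tendsto_iff_norm_sub_tendsto_zero] at hlim ⊢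
    refine squeeze_zero (fun _ => norm_nonneg _)
      (fun n => norm_mollify_sub_le μ ν hθ hs h0 (u n) f) ?_
    simpa using hlim.const_mul (∫ g, θ g ∂μ)
  refine h2.congr fun n => ?_
  rw [Function.comp_apply, hML, ← hF]

end Mollification

/-! ### A continuity criterion and ergodicity -/

section Applications

variable {G Q : Type*} [Group G] [TopologicalSpace G] [IsTopologicalGroup G]
  [LocallyCompactSpace G] [MeasurableSpace G] [BorelSpace G] (μ : Measure G)
  [μ.IsHaarMeasure]
  [TopologicalSpace Q] [CompactSpace Q] [T2Space Q] [MulAction G Q] [ContinuousSMul G Q]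
  [MeasurableSpace Q] [BorelSpace Q] (ν : Measure Q) [IsProbabilityMeasure ν] [ν.Regular]
  [SMulInvariantMeasure G Q ν]

/-- A square-integrable function whose translates by small elements are uniformly close to it is
continuous. -/
theorem exists_toL2_eq_of_modulus (hUp : BoundedAverages μ ν) [ν.IsOpenPosMeasure] {f : Lp ℝ 2 ν}
    (h : ∀ ε : ℝ, 0 < ε → ∀ᶠ g : G in 𝓝 1,
      |trL ν g f - f| ≤ toL2 ν (ContinuousMap.const Q ε)) :
    ∃ H : C(Q, ℝ), toL2 ν H = f := by
  have key : ∀ ε : ℝ, 0 < ε → ∃ H : C(Q, ℝ), |toL2 ν H - f| ≤ toL2 ν (ContinuousMap.const Q ε) := by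
    intro ε hε
    obtain ⟨θ, hθ, hs, h0, h1, hU⟩ := exists_approximate_identity μ (h ε hε)
    obtain ⟨H, hH⟩ := exists_toL2_eq_mollify μ ν hθ hs h0 hUp f
    refine ⟨H, hH ▸ abs_mollify_sub_self_le μ ν hθ hs h0 h1 fun g hg => ?_⟩
    by_contra hgU
    exact hg (hU g hgU)
  choose! H hH using key
  set u : ℕ → ℝ := fun n => 1 / ((n : ℝ) + 1) with hu
  have hu0 : ∀ n, 0 < u n := fun n => by positivity
  have hulim : Tendsto u atTop (𝓝 0) := tendsto_one_div_add_atTop_nhds_zero_nat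
  have hdist : ∀ ε δ : ℝ, 0 < ε → 0 < δ → dist (H ε) (H δ) ≤ ε + δ := by
    intro ε δ hε hδ
    rw [ContinuousMap.dist_le (by positivity)]
    intro q
    rw [Real.dist_eq, abs_le, neg_le_sub_iff_le_add, sub_le_iff_le_add']
    have h1 := abs_le_iff_Lp.1 (hH ε hε)
    have h2 := abs_le_iff_Lp.1 (hH δ hδ)
    constructor
    · refine le_of_toL2_le ν (F := H δ) (H := H ε + ContinuousMap.const Q (ε + δ)) ?_ q
      have : ContinuousMap.const Q (ε + δ) = ContinuousMap.const Q ε + ContinuousMap.const Q δ := rfl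
      rw [this, map_add, map_add]
      have h3 := h2.2
      have h4 := h1.1
      rw [sub_le_iff_le_add] at h3
      rw [neg_le_sub_iff_le_add] at h4
      calc toL2 ν (H δ) ≤ toL2 ν (ContinuousMap.const Q δ) + f := h3
        _ ≤ toL2 ν (ContinuousMap.const Q δ) + (toL2 ν (H ε) + toL2 ν (ContinuousMap.const Q ε)) :=
          by gcongr
        _ = _ := by abel
    · refine le_of_toL2_le ν (F := H ε) (H := H δ + ContinuousMap.const Q (ε + δ)) ?_ q
      have : ContinuousMap.const Q (ε + δ) = ContinuousMap.const Q ε + ContinuousMap.const Q δ := rfl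
      rw [this, map_add, map_add]
      have h3 := h1.2
      have h4 := h2.1
      rw [sub_le_iff_le_add] at h3
      rw [neg_le_sub_iff_le_add] at h4
      calc toL2 ν (H ε) ≤ toL2 ν (ContinuousMap.const Q ε) + f := h3
        _ ≤ toL2 ν (ContinuousMap.const Q ε) + (toL2 ν (H δ) + toL2 ν (ContinuousMap.const Q δ)) :=
          by gcongr
        _ = _ := by abel
  have hcau : CauchySeq fun n => H (u n) := by
    rw [Metric.cauchySeq_iff]
    intro ε hε
    obtain ⟨N, hN⟩ := eventually_atTop.1 (hulim.eventually (gt_mem_nhds (half_pos hε)))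
    refine ⟨N, fun m hm n hn => (hdist _ _ (hu0 m) (hu0 n)).trans_lt ?_⟩
    linarith [hN m hm, hN n hn]
  obtain ⟨H₀, hH₀⟩ := cauchySeq_tendsto_of_complete hcau
  refine ⟨H₀, tendsto_nhds_unique (((toL2 ν).continuous.tendsto H₀).comp hH₀) ?_⟩
  rw [tendsto_iff_norm_sub_tendsto_zero]
  refine squeeze_zero (fun _ => norm_nonneg _) (fun n => ?_) hulim
  have h1 := norm_le_norm_of_abs_le_abs ((hH (u n) (hu0 n)).trans (le_abs_self _))
  rwa [norm_toL2_const, abs_of_pos (hu0 n)] at h1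

/-- Ergodicity of a normal subgroup `B` whose invariant continuous functions are constant. -/
theorem eq_const_of_invariant (hUp : BoundedAverages μ ν) [ν.IsOpenPosMeasure] (B : Subgroup G)
    [B.Normal] (hB : ∀ F : C(Q, ℝ), (∀ b ∈ B, trC b F = F) → ∃ a, F = ContinuousMap.const Q a)
    {f : Lp ℝ 2 ν} (hf : ∀ b ∈ B, trL ν b f = f) :
    ∃ a, f = toL2 ν (ContinuousMap.const Q a) := by
  have hcl : IsClosed (Set.range fun a : ℝ => toL2 ν (ContinuousMap.const Q a)) := by
    have hiso : Isometry fun a : ℝ => toL2 ν (ContinuousMap.const Q a) := ?_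
    · exact hiso.isClosedEmbedding.isClosed_range
    refine Isometry.of_dist_eq fun a b => ?_
    rw [dist_eq_norm, ← map_sub,
      show ContinuousMap.const Q a - ContinuousMap.const Q b = ContinuousMap.const Q (a - b) from rfl,
      norm_toL2_const, Real.dist_eq]
  have hmem : f ∈ closure (Set.range fun a : ℝ => toL2 ν (ContinuousMap.const Q a)) := by
    rw [Metric.mem_closure_iff]
    intro ε hε
    have hev : ∀ᶠ g : G in 𝓝 1, ‖trL ν g f - f‖ ≤ ε / 2 := by
      have h1 : Tendsto (fun g : G => ‖trL ν g f - f‖) (𝓝 1) (𝓝 ‖trL ν (1 : G) f - f‖) :=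
        ((continuous_trL ν f).sub continuous_const).norm.tendsto 1
      rw [trL_one, sub_self, norm_zero] at h1
      exact h1.eventually (ge_mem_nhds (half_pos hε))
    obtain ⟨θ, hθ, hs, h0, h1, hU⟩ := exists_approximate_identity μ hev
    obtain ⟨H, hH⟩ := exists_toL2_eq_mollify μ ν hθ hs h0 hUp f
    obtain ⟨a, rfl⟩ := hB H fun b hb => by
      apply ContinuousMap.toLp_injective ν (p := 2) (𝕜 := ℝ)
      rw [toL2_trC, hH, trL_mollify μ ν hθ hs hf hb]
    refine ⟨_, ⟨a, rfl⟩, ?_⟩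
    simp only [hH]
    rw [dist_comm, dist_eq_norm]
    refine (norm_mollify_sub_self_le μ ν hθ hs h0 h1 fun g hg => ?_).trans_lt (half_lt_self hε)
    by_contra hgU
    exact hg (hU g hgU)
  rw [hcl.closure_eq] at hmem
  obtain ⟨a, ha⟩ := hmem
  exact ⟨a, ha.symm⟩

end Applications

/-! ### Continuous equivariant maps -/

section EquivariantMaps

open MidSpace

variable {G : Type*} [Group G] [TopologicalSpace G] {Γ : Subgroup G}
  {X : Type*} [MetricSpace X] (ρ : Γ →* (X ≃ᵢ X)) [MeasurableSpace (G ⧸ Γ)] (ν : Measure (G ⧸ Γ))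

/-- Continuous maps `u : G → X` with `u (g γ) = γ⁻¹ u(g)`, i.e. continuous sections of the bundle
over `G ⧸ Γ` with fibre `X` attached to the action `ρ`. The measure `ν` does not enter the
definition: it selects the `L²`-distance put on this type. -/
structure EquivMap {G : Type*} [Group G] [TopologicalSpace G] {Γ : Subgroup G} {X : Type*}
    [MetricSpace X] (ρ : Γ →* (X ≃ᵢ X)) [MeasurableSpace (G ⧸ Γ)] (_ν : Measure (G ⧸ Γ)) where
  /-- the underlying map -/
  toFun : G → X
  continuous_toFun : Continuous toFun
  map_mul' : ∀ (g : G) (γ : Γ), toFun (g * γ) = ρ γ⁻¹ (toFun g)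

variable {ρ ν}

namespace EquivMap

instance : CoeFun (EquivMap ρ ν) fun _ => G → X := ⟨toFun⟩

theorem continuous (u : EquivMap ρ ν) : Continuous u := u.continuous_toFun

theorem map_mul (u : EquivMap ρ ν) (g : G) (γ : Γ) : u (g * γ) = ρ γ⁻¹ (u g) := u.map_mul' g γ

theorem ext {u v : EquivMap ρ ν} (h : ∀ g, u g = v g) : u = v := by
  cases u; cases v
  congr 1
  exact funext h

/-- The distance `g Γ ↦ d(u(g), v(g))` between two equivariant maps, as a function on `G ⧸ Γ`. -/
noncomputable def gap (u v : EquivMap ρ ν) : C(G ⧸ Γ, ℝ) where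
  toFun := fun q => Quotient.liftOn' q (fun g => dist (u g) (v g)) fun a b hab => by
    obtain ⟨γ, rfl⟩ : ∃ γ : Γ, b = a * γ :=
      ⟨⟨a⁻¹ * b, QuotientGroup.leftRel_apply.1 hab⟩, by simp⟩
    simp only [map_mul, IsometryEquiv.dist_eq]
  continuous_toFun := continuous_coinduced_dom.2 (by
    change Continuous fun g => dist (u g) (v g)
    exact u.continuous.dist v.continuous)

@[simp] theorem gap_mk (u v : EquivMap ρ ν) (g : G) : gap u v (g : G ⧸ Γ) = dist (u g) (v g) := rfl

theorem gap_nonneg (u v : EquivMap ρ ν) (q : G ⧸ Γ) : 0 ≤ gap u v q := by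
  obtain ⟨g, rfl⟩ := QuotientGroup.mk_surjective q
  exact dist_nonneg

theorem gap_comm (u v : EquivMap ρ ν) : gap u v = gap v u := by
  ext q
  obtain ⟨g, rfl⟩ := QuotientGroup.mk_surjective q
  exact dist_comm _ _

theorem gap_self (u : EquivMap ρ ν) : gap u u = 0 := by
  ext q
  obtain ⟨g, rfl⟩ := QuotientGroup.mk_surjective q
  simp

theorem gap_triangle (u v w : EquivMap ρ ν) (q : G ⧸ Γ) : gap u w q ≤ gap u v q + gap v w q := by
  obtain ⟨g, rfl⟩ := QuotientGroup.mk_surjective q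
  exact dist_triangle _ _ _

theorem abs_gap_sub_gap_le (u v u' v' : EquivMap ρ ν) (q : G ⧸ Γ) :
    |gap u v q - gap u' v' q| ≤ gap u u' q + gap v v' q := by
  obtain ⟨g, rfl⟩ := QuotientGroup.mk_surjective q
  exact dist_dist_dist_le (u g) (v g) (u' g) (v' g)

/-- The pointwise midpoint of equivariant maps. -/
noncomputable def midMap [MidSpace X] (u v : EquivMap ρ ν) : EquivMap ρ ν where
  toFun := fun g => mid (u g) (v g)
  continuous_toFun := continuous_mid.comp (u.continuous.prodMk v.continuous)
  map_mul' := fun g γ => by rw [map_mul, map_mul, map_mid]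

theorem gap_midMap_midMap_le [MidSpace X] (u v u' v' : EquivMap ρ ν) (q : G ⧸ Γ) :
    gap (midMap u v) (midMap u' v') q ≤ (gap u u' q + gap v v' q) / 2 := by
  obtain ⟨g, rfl⟩ := QuotientGroup.mk_surjective q
  exact dist_mid_mid_le _ _ _ _

theorem gap_left_midMap [MidSpace X] (u v : EquivMap ρ ν) :
    gap u (midMap u v) = (1 / 2 : ℝ) • gap u v := by
  ext q
  obtain ⟨g, rfl⟩ := QuotientGroup.mk_surjective q
  change dist (u g) (mid (u g) (v g)) = (1 / 2 : ℝ) * dist (u g) (v g)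
  rw [dist_left_mid]
  ring

theorem gap_midMap_right [MidSpace X] (u v : EquivMap ρ ν) :
    gap (midMap u v) v = (1 / 2 : ℝ) • gap u v := by
  ext q
  obtain ⟨g, rfl⟩ := QuotientGroup.mk_surjective q
  change dist (mid (u g) (v g)) (v g) = (1 / 2 : ℝ) * dist (u g) (v g)
  rw [dist_mid_right]
  ring

section Metric

variable [CompactSpace (G ⧸ Γ)] [BorelSpace (G ⧸ Γ)] [IsProbabilityMeasure ν]

/-- The `L²`-distance of equivariant maps. It is declared as a pseudometric, which suffices for the
completion and does not require `ν` to charge all open sets. -/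
noncomputable instance : PseudoMetricSpace (EquivMap ρ ν) where
  dist u v := ‖toL2 ν (gap u v)‖
  dist_self u := by rw [gap_self, map_zero, norm_zero]
  dist_comm u v := by rw [gap_comm]
  dist_triangle u v w := by
    refine le_trans ?_ (norm_add_le _ _)
    rw [← map_add]
    apply norm_le_norm_of_abs_le_abs
    have h0 : ∀ u v : EquivMap ρ ν, 0 ≤ toL2 ν (gap u v) := fun u v => by
      rw [← map_zero (toL2 ν)]
      exact toL2_mono ν (gap_nonneg u v)
    rw [abs_of_nonneg (h0 u w), abs_of_nonneg (by rw [map_add]; exact add_nonneg (h0 _ _) (h0 _ _))]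
    exact toL2_mono ν (gap_triangle u v w)

theorem dist_def (u v : EquivMap ρ ν) : dist u v = ‖toL2 ν (gap u v)‖ := rfl

theorem dist_sq (u v : EquivMap ρ ν) : dist u v ^ 2 = ∫ q, gap u v q ^ 2 ∂ν := norm_toL2_sq ν _

theorem dist_le_norm_gap (u v : EquivMap ρ ν) : dist u v ≤ ‖gap u v‖ := norm_toL2_le ν _

theorem dist_toL2_gap_le (u v u' v' : EquivMap ρ ν) :
    dist (toL2 ν (gap u v)) (toL2 ν (gap u' v')) ≤ dist u u' + dist v v' := by
  rw [dist_eq_norm, ← map_sub, dist_def, dist_def]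
  refine le_trans ?_ (norm_add_le _ _)
  rw [← map_add]
  exact norm_toL2_mono ν fun q => abs_gap_sub_gap_le u v u' v' q

theorem uniformContinuous_toL2_gap :
    UniformContinuous₂ fun u v : EquivMap ρ ν => toL2 ν (gap u v) := by
  refine LipschitzWith.uniformContinuous (K := 2) (LipschitzWith.of_dist_le_mul ?_)
  rintro ⟨u, v⟩ ⟨u', v'⟩
  refine (dist_toL2_gap_le u v u' v').trans ?_
  rw [Prod.dist_eq]
  push_cast
  linarith [le_max_left (dist u u') (dist v v'), le_max_right (dist u u') (dist v v')]

variable [MidSpace X]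

theorem dist_midMap_midMap_le (u v u' v' : EquivMap ρ ν) :
    dist (midMap u v) (midMap u' v') ≤ (dist u u' + dist v v') / 2 := by
  have h : ‖toL2 ν ((1 / 2 : ℝ) • (gap u u' + gap v v'))‖ ≤ (dist u u' + dist v v') / 2 := by
    rw [map_smul, norm_smul, map_add]
    have := norm_add_le (toL2 ν (gap u u')) (toL2 ν (gap v v'))
    norm_num
    rw [dist_def, dist_def]
    linarith
  refine le_trans (norm_toL2_mono ν fun q => ?_) h
  rw [abs_of_nonneg (gap_nonneg _ _ _)]
  refine (gap_midMap_midMap_le u v u' v' q).trans_eq ?_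
  simp
  ring

theorem uniformContinuous_midMap : UniformContinuous₂ (midMap (ρ := ρ) (ν := ν)) := by
  refine LipschitzWith.uniformContinuous (K := 1) (LipschitzWith.of_dist_le_mul ?_)
  rintro ⟨u, v⟩ ⟨u', v'⟩
  refine (dist_midMap_midMap_le u v u' v').trans ?_
  rw [Prod.dist_eq]
  push_cast
  linarith [le_max_left (dist u u') (dist v v'), le_max_right (dist u u') (dist v v')]

variable (ρ ν) in
/-- The inequality `MidSpace.uc` for equivariant maps, obtained by integration over `G ⧸ Γ`. -/
theorem exists_uc (ε : ℝ) (hε : 0 < ε) : ∃ c : ℝ, 0 < c ∧ ∀ u v w : EquivMap ρ ν,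
    dist u (midMap v w) ^ 2 + c * dist v w ^ 2 ≤
      (1 / 2 + c * ε) * (dist u v ^ 2 + dist u w ^ 2) := by
  obtain ⟨c, hc, h⟩ := uc (Z := X) ε hε
  refine ⟨c, hc, fun u v w => ?_⟩
  have hi : ∀ F : C(G ⧸ Γ, ℝ), Integrable (fun q => F q ^ 2) ν := fun F =>
    integrable_continuousMap ν (F ^ 2)
  simp only [dist_sq]
  rw [← integral_const_mul, ← integral_add (hi _) ((hi _).const_mul _), ← integral_add (hi _) (hi _),
    ← integral_const_mul]
  refine integral_mono ((hi _).add ((hi _).const_mul _)) (((hi _).add (hi _)).const_mul _)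
    fun q => ?_
  obtain ⟨g, rfl⟩ := QuotientGroup.mk_surjective q
  exact h (u g) (v g) (w g)

end Metric

end EquivMap

end EquivariantMaps

/-! ### Square-integrable equivariant maps -/

section CompletedSpace

open MidSpace UniformSpace

variable {G : Type*} [Group G] [TopologicalSpace G] {Γ : Subgroup G}
  {X : Type*} [MetricSpace X] (ρ : Γ →* (X ≃ᵢ X)) [MeasurableSpace (G ⧸ Γ)] (ν : Measure (G ⧸ Γ))
  [CompactSpace (G ⧸ Γ)] [BorelSpace (G ⧸ Γ)] [IsProbabilityMeasure ν]

/-- The space of square-integrable equivariant maps `G → X`, defined as the completion of the space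
of continuous ones for the `L²`-distance. -/
abbrev L2Maps := Completion (EquivMap ρ ν)

variable {ρ ν}

/-- The class of `g Γ ↦ d(f(g), f'(g))` in `L²(G ⧸ Γ)`. -/
noncomputable def gapL2 (f f' : L2Maps ρ ν) : Lp ℝ 2 ν :=
  Completion.extension₂ (fun u v : EquivMap ρ ν => toL2 ν (u.gap v)) f f'

@[simp] theorem gapL2_coe (u v : EquivMap ρ ν) :
    gapL2 (u : L2Maps ρ ν) (v : L2Maps ρ ν) = toL2 ν (u.gap v) :=
  Completion.extension₂_coe_coe EquivMap.uniformContinuous_toL2_gap u v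

theorem uniformContinuous_gapL2 : UniformContinuous₂ (gapL2 (ρ := ρ) (ν := ν)) :=
  Completion.uniformContinuous_extension₂ _

theorem continuous_gapL2 : Continuous fun p : L2Maps ρ ν × L2Maps ρ ν => gapL2 p.1 p.2 :=
  uniformContinuous_gapL2.continuous

@[fun_prop]
theorem _root_.Continuous.gapL2 {A : Type*} [TopologicalSpace A] {a b : A → L2Maps ρ ν}
    (ha : Continuous a) (hb : Continuous b) : Continuous fun t => gapL2 (a t) (b t) :=
  continuous_gapL2.comp (ha.prodMk hb)

theorem norm_gapL2 (f f' : L2Maps ρ ν) : ‖gapL2 f f'‖ = dist f f' := by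
  refine Completion.induction_on₂ f f'
    (isClosed_eq (Continuous.gapL2 continuous_fst continuous_snd).norm continuous_dist) fun u v => ?_
  rw [gapL2_coe, Completion.dist_eq, EquivMap.dist_def]

theorem gapL2_self (f : L2Maps ρ ν) : gapL2 f f = 0 := by
  rw [← norm_eq_zero, norm_gapL2, dist_self]

theorem gapL2_nonneg (f f' : L2Maps ρ ν) : 0 ≤ gapL2 f f' := by
  refine Completion.induction_on₂ f f'
    (isClosed_le continuous_const (Continuous.gapL2 continuous_fst continuous_snd)) fun u v => ?_
  rw [gapL2_coe, ← map_zero (toL2 ν)]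
  exact toL2_mono ν (u.gap_nonneg v)

theorem gapL2_comm (f f' : L2Maps ρ ν) : gapL2 f f' = gapL2 f' f := by
  refine Completion.induction_on₂ f f'
    (isClosed_eq (Continuous.gapL2 continuous_fst continuous_snd)
      (Continuous.gapL2 continuous_snd continuous_fst)) fun u v => ?_
  rw [gapL2_coe, gapL2_coe, EquivMap.gap_comm]

theorem gapL2_triangle (f g h : L2Maps ρ ν) : gapL2 f h ≤ gapL2 f g + gapL2 g h := by
  refine Completion.induction_on₃ f g h
    (isClosed_le (Continuous.gapL2 continuous_fst (by fun_prop))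
      ((Continuous.gapL2 continuous_fst (by fun_prop)).add
        (Continuous.gapL2 (by fun_prop) (by fun_prop)))) fun u v w => ?_
  simp only [gapL2_coe]
  rw [← map_add]
  exact toL2_mono ν (u.gap_triangle v w)

variable [MidSpace X]

/-- Pointwise midpoints extend to the completion; all the inequalities of `MidSpace` are inherited
from `X` by integration and continuity. -/
noncomputable instance : MidSpace (L2Maps ρ ν) where
  mid := Completion.map₂ EquivMap.midMap
  dist_left_mid f h := by
    refine Completion.induction_on₂ f h (isClosed_eq
      (continuous_fst.dist (Completion.continuous_map₂ continuous_fst continuous_snd))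
      (continuous_dist.div_const 2)) fun u v => ?_
    rw [Completion.map₂_coe_coe _ _ _ EquivMap.uniformContinuous_midMap, Completion.dist_eq,
      Completion.dist_eq, EquivMap.dist_def, EquivMap.gap_left_midMap, map_smul, norm_smul,
      EquivMap.dist_def]
    norm_num
    ring
  dist_mid_right f h := by
    refine Completion.induction_on₂ f h (isClosed_eq
      ((Completion.continuous_map₂ continuous_fst continuous_snd).dist continuous_snd)
      (continuous_dist.div_const 2)) fun u v => ?_
    rw [Completion.map₂_coe_coe _ _ _ EquivMap.uniformContinuous_midMap, Completion.dist_eq,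
      Completion.dist_eq, EquivMap.dist_def, EquivMap.gap_midMap_right, map_smul, norm_smul,
      EquivMap.dist_def]
    norm_num
    ring
  dist_mid_mid_le f h f' h' := by
    refine Completion.induction_on₂ f h ?_ fun u v => Completion.induction_on₂ f' h' ?_ fun u' v' => ?_
    · exact isClosed_le ((Completion.continuous_map₂ continuous_fst continuous_snd).dist
        continuous_const) (by fun_prop)
    · exact isClosed_le (continuous_const.dist
        (Completion.continuous_map₂ continuous_fst continuous_snd)) (by fun_prop)
    · simp only [Completion.map₂_coe_coe _ _ _ EquivMap.uniformContinuous_midMap,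
        Completion.dist_eq]
      exact EquivMap.dist_midMap_midMap_le u v u' v'
  uc ε hε := by
    obtain ⟨c, hc, huc⟩ := EquivMap.exists_uc ρ ν ε hε
    refine ⟨c, hc, fun f h h' => ?_⟩
    refine Completion.induction_on₃ f h h' (isClosed_le
      (((continuous_fst.dist (Completion.continuous_map₂ (by fun_prop) (by fun_prop))).pow 2).add
        (by fun_prop)) (by fun_prop)) fun u v w => ?_
    simp only [Completion.map₂_coe_coe _ _ _ EquivMap.uniformContinuous_midMap, Completion.dist_eq]
    exact huc u v w

theorem mid_coe (u v : EquivMap ρ ν) :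
    mid (u : L2Maps ρ ν) (v : L2Maps ρ ν) = (EquivMap.midMap u v : EquivMap ρ ν) :=
  Completion.map₂_coe_coe _ _ _ EquivMap.uniformContinuous_midMap

theorem gapL2_mid_mid_le (f h f' h' : L2Maps ρ ν) :
    gapL2 (mid f h) (mid f' h') ≤ (1 / 2 : ℝ) • (gapL2 f f' + gapL2 h h') := by
  have hm : Continuous fun p : L2Maps ρ ν × L2Maps ρ ν => mid p.1 p.2 := continuous_mid
  refine Completion.induction_on₂ f h ?_ fun u v => Completion.induction_on₂ f' h' ?_ fun u' v' => ?_
  · exact isClosed_le (Continuous.gapL2 hm continuous_const) (by fun_prop)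
  · exact isClosed_le (Continuous.gapL2 continuous_const hm) (by fun_prop)
  · rw [mid_coe, mid_coe, gapL2_coe, gapL2_coe, gapL2_coe, ← map_add, ← map_smul]
    refine toL2_mono ν fun q => (EquivMap.gap_midMap_midMap_le u v u' v' q).trans_eq ?_
    simp
    ring

end CompletedSpace

/-! ### The translation action on equivariant maps -/

section Action

open MidSpace UniformSpace

variable {G : Type*} [Group G] [TopologicalSpace G] [IsTopologicalGroup G] {Γ : Subgroup G}
  {X : Type*} [MetricSpace X] {ρ : Γ →* (X ≃ᵢ X)} [MeasurableSpace (G ⧸ Γ)] {ν : Measure (G ⧸ Γ)}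

namespace EquivMap

/-- The group `G` acts on equivariant maps by left translation `(h u)(g) = u (h⁻¹ g)`. -/
noncomputable instance : MulAction G (EquivMap ρ ν) where
  smul h u :=
    { toFun := fun g => u (h⁻¹ * g)
      continuous_toFun := u.continuous.comp (continuous_const_mul _)
      map_mul' := fun g γ => by rw [← mul_assoc, u.map_mul] }
  one_smul u := ext fun g => by
    change u (1⁻¹ * g) = u g
    simp
  mul_smul h k u := ext fun g => by
    change u ((h * k)⁻¹ * g) = u (k⁻¹ * (h⁻¹ * g))
    rw [mul_inv_rev, mul_assoc]

theorem smul_apply (h : G) (u : EquivMap ρ ν) (g : G) : (h • u) g = u (h⁻¹ * g) := rfl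

theorem gap_smul_smul (h : G) (u v : EquivMap ρ ν) : gap (h • u) (h • v) = trC h (gap u v) := by
  ext q
  obtain ⟨g, rfl⟩ := QuotientGroup.mk_surjective q
  rfl

/-- Translations move continuous maps continuously in the uniform norm. -/
theorem continuous_gap_smul [CompactSpace (G ⧸ Γ)] (u v : EquivMap ρ ν) :
    Continuous fun g : G => gap (g • u) v := by
  apply ContinuousMap.continuous_of_continuous_uncurry
  have hq : IsOpenQuotientMap (Prod.map id ((↑) : G → G ⧸ Γ) : G × G → G × (G ⧸ Γ)) :=
    IsOpenQuotientMap.prodMap .id QuotientGroup.isOpenQuotientMap_mk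
  rw [hq.isQuotientMap.continuous_iff]
  change Continuous fun p : G × G => dist (u (p.1⁻¹ * p.2)) (v p.2)
  exact (u.continuous.comp (by fun_prop)).dist (v.continuous.comp continuous_snd)

variable [CompactSpace (G ⧸ Γ)] [BorelSpace (G ⧸ Γ)] [IsProbabilityMeasure ν]
  [SMulInvariantMeasure G (G ⧸ Γ) ν]

theorem dist_smul_smul (h : G) (u v : EquivMap ρ ν) : dist (h • u) (h • v) = dist u v := by
  rw [dist_def, gap_smul_smul, toL2_trC, LinearIsometry.norm_map, dist_def]

instance : IsIsometricSMul G (EquivMap ρ ν) := ⟨fun h => Isometry.of_dist_eq (dist_smul_smul h)⟩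

instance : UniformContinuousConstSMul G (EquivMap ρ ν) :=
  ⟨fun h => (isometry_smul (EquivMap ρ ν) h).uniformContinuous⟩

end EquivMap

variable [CompactSpace (G ⧸ Γ)] [BorelSpace (G ⧸ Γ)] [IsProbabilityMeasure ν]
  [SMulInvariantMeasure G (G ⧸ Γ) ν]

theorem gapL2_smul_smul (g : G) (f f' : L2Maps ρ ν) :
    gapL2 (g • f) (g • f') = trL ν g (gapL2 f f') := by
  refine Completion.induction_on₂ f f' (isClosed_eq
    (Continuous.gapL2 (continuous_fst.const_smul g) (continuous_snd.const_smul g))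
    ((trL ν g).continuous.comp (Continuous.gapL2 continuous_fst continuous_snd))) fun u v => ?_
  rw [← Completion.coe_smul, ← Completion.coe_smul, gapL2_coe, gapL2_coe, EquivMap.gap_smul_smul,
    toL2_trC]

instance : IsIsometricSMul G (L2Maps ρ ν) :=
  ⟨fun g => Isometry.of_dist_eq fun f f' => by
    rw [← norm_gapL2, gapL2_smul_smul, LinearIsometry.norm_map, norm_gapL2]⟩

/-- The isometric action of `G` on the square-integrable equivariant maps by left translation. -/
noncomputable def translation : G →* (L2Maps ρ ν ≃ᵢ L2Maps ρ ν) where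
  toFun := IsometryEquiv.constSMul
  map_one' := IsometryEquiv.ext fun f => one_smul G f
  map_mul' g h := IsometryEquiv.ext fun f => mul_smul g h f

@[simp] theorem translation_apply (g : G) (f : L2Maps ρ ν) : translation g f = g • f := rfl

theorem smul_mid [MidSpace X] (g : G) (f f' : L2Maps ρ ν) :
    g • mid f f' = mid (g • f) (g • f') := map_mid (translation g) f f'

/-- Orbit maps in the space of square-integrable equivariant maps are continuous. -/
theorem continuous_smul_const (f : L2Maps ρ ν) : Continuous fun g : G => g • f := by
  have h1 : ∀ f : L2Maps ρ ν, Tendsto (fun g : G => g • f) (𝓝 1) (𝓝 f) := by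
    intro f
    rw [Metric.tendsto_nhds]
    intro ε hε
    obtain ⟨_, ⟨u, rfl⟩, hu⟩ := Metric.mem_closure_iff.1
      (Completion.denseRange_coe (α := EquivMap ρ ν) f) (ε / 3) (by positivity)
    have h2 : Tendsto (fun g : G => ‖EquivMap.gap (g • u) u‖) (𝓝 1)
        (𝓝 ‖EquivMap.gap ((1 : G) • u) u‖) :=
      (EquivMap.continuous_gap_smul u u).norm.tendsto 1
    rw [one_smul, EquivMap.gap_self, norm_zero] at h2
    filter_upwards [h2.eventually (gt_mem_nhds (show (0 : ℝ) < ε / 3 by positivity))] with g hg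
    have h3 : dist (g • (u : L2Maps ρ ν)) u < ε / 3 := by
      rw [← Completion.coe_smul, Completion.dist_eq]
      exact (EquivMap.dist_le_norm_gap _ _).trans_lt hg
    have h4 : dist (g • f) (g • (u : L2Maps ρ ν)) < ε / 3 := by rwa [dist_smul]
    have h5 := dist_triangle4 (g • f) (g • (u : L2Maps ρ ν)) u f
    rw [dist_comm (u : L2Maps ρ ν) f] at h5
    linarith
  rw [continuous_iff_continuousAt]
  intro g
  have h3 : Tendsto (fun h : G => g⁻¹ * h) (𝓝 g) (𝓝 1) := by
    have := (continuous_const_mul g⁻¹).tendsto g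
    rwa [inv_mul_cancel] at this
  have h4 := ((isometry_smul (L2Maps ρ ν) g).continuous.tendsto f).comp ((h1 f).comp h3)
  refine h4.congr fun h => ?_
  simp [smul_smul]

end Action

/-! ### Barycentres and the existence of equivariant maps -/

section Barycentre

open MidSpace

/-- Uniform convexity of functions is stable under convex combinations. -/
theorem ucFun_sum {Z ι : Type*} [MetricSpace Z] [MidSpace Z] (F : Finset ι) {a : ι → ℝ}
    (ha : ∀ i, 0 ≤ a i) (h1 : ∑ i ∈ F, a i = 1) (z : ι → Z) :
    UCFun fun q => ∑ i ∈ F, a i * dist (z i) q ^ 2 := by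
  intro ε hε
  obtain ⟨c, hc, H⟩ := uc (Z := Z) ε hε
  refine ⟨c, hc, fun y y' => ?_⟩
  have hsum : c * dist y y' ^ 2 = ∑ i ∈ F, a i * (c * dist y y' ^ 2) := by
    rw [← Finset.sum_mul, h1, one_mul]
  rw [hsum, ← Finset.sum_add_distrib, ← Finset.sum_add_distrib, Finset.mul_sum]
  refine Finset.sum_le_sum fun i hi => ?_
  rw [← mul_add, ← mul_add, mul_left_comm]
  exact mul_le_mul_of_nonneg_left (H (z i) y y') (ha i)

variable {G : Type*} [Group G] [TopologicalSpace G] [IsTopologicalGroup G]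
  [LocallyCompactSpace G] [T2Space G] {Γ : Subgroup G} [DiscreteTopology Γ]
  [CompactSpace (G ⧸ Γ)]
  {X : Type*} [MetricSpace X] [CompleteSpace X] [MidSpace X] [Nonempty X] (ρ : Γ →* (X ≃ᵢ X))
  [MeasurableSpace (G ⧸ Γ)] (ν : Measure (G ⧸ Γ))

/-- There are continuous equivariant maps: send `g` to the barycentre of the points of an orbit
`γ p` with weights `w (g γ)`, where the weight `w` has periodization `1`. -/
theorem nonempty_equivMap : Nonempty (EquivMap ρ ν) := by
  obtain ⟨p⟩ := ‹Nonempty X›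
  obtain ⟨w, hw, hws, hw0, hw1⟩ := exists_periodize_eq_one Γ
  set Ψ : G → X → ℝ := fun x q => ∑ᶠ γ : Γ, w (x * γ) * dist (ρ γ p) q ^ 2 with hΨ
  -- near each point the sums extend over a fixed finite set of indices
  have hfin : ∀ N : Set G, IsCompact N → ∃ F : Finset Γ, ∀ x ∈ N,
      (∀ q, Ψ x q = ∑ γ ∈ F, w (x * γ) * dist (ρ γ p) q ^ 2) ∧ ∑ γ ∈ F, w (x * γ) = 1 := by
    intro N hN
    have hF := finite_return Γ hN hws
    have hmem : ∀ x ∈ N, ∀ γ : Γ, w (x * γ) ≠ 0 → γ ∈ hF.toFinset := fun x hx γ hγ => by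
      rw [Set.Finite.mem_toFinset]
      exact ⟨x, hx, subset_tsupport _ hγ⟩
    refine ⟨hF.toFinset, fun x hx => ⟨fun q => ?_, ?_⟩⟩
    · refine finsum_eq_sum_of_support_subset _ fun γ hγ => hmem x hx γ ?_
      exact left_ne_zero_of_mul hγ
    · rw [← hw1 x, periodize]
      exact (finsum_eq_sum_of_support_subset _ fun γ hγ => hmem x hx γ hγ).symm
  have huc : ∀ x, UCFun (Ψ x) := fun x => by
    obtain ⟨F, hF⟩ := hfin {x} isCompact_singleton
    rw [show Ψ x = fun q => _ from funext (hF x rfl).1]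
    exact ucFun_sum F (fun γ => hw0 _) (hF x rfl).2 _
  have hcont : ∀ x, Continuous (Ψ x) := fun x => by
    obtain ⟨F, hF⟩ := hfin {x} isCompact_singleton
    rw [show Ψ x = fun q => _ from funext (hF x rfl).1]
    fun_prop
  have h0 : ∀ x q, 0 ≤ Ψ x q := fun x q =>
    finsum_nonneg fun γ => mul_nonneg (hw0 _) (sq_nonneg _)
  have hmin : ∀ x, ∃ q, ∀ q', Ψ x q ≤ Ψ x q' := fun x => by
    obtain ⟨q, -, hq⟩ := (huc x).exists_isMinOn (hcont x) (h0 x) (C := Set.univ) ⟨p, trivial⟩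
      isClosed_univ (fun _ _ _ _ => trivial)
    exact ⟨q, fun q' => hq q' trivial⟩
  choose f hf using hmin
  have huniq : ∀ x q, (∀ q', Ψ x q ≤ Ψ x q') → q = f x := fun x q hq => by
    refine dist_le_zero.1 (le_of_forall_pos_le_add fun η hη => ?_)
    obtain ⟨δ, hδ, H⟩ := (huc x).exists_dist_le (Ψ x q) hη
    rw [zero_add]
    exact H (Ψ x q) _ _ le_rfl (by linarith) (by linarith [hf x q]) (hq _)
  have hequiv : ∀ x (γ : Γ) q, Ψ (x * γ) q = Ψ x (ρ γ q) := fun x γ q => by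
    simp only [hΨ]
    rw [← finsum_comp_equiv (Equiv.mulLeft γ) (f := fun γ' : Γ => w (x * γ') * _)]
    refine finsum_congr fun γ' => ?_
    simp [mul_assoc, (ρ γ).dist_eq]
  refine ⟨⟨f, continuous_iff_continuousAt.2 fun x₀ => ?_, fun x γ => ?_⟩⟩
  · obtain ⟨N, hN, hNx⟩ := exists_compact_mem_nhds x₀
    obtain ⟨F, hF⟩ := hfin N hN
    -- the barycentres stay in a fixed ball
    set M := ∑ γ ∈ F, dist (ρ γ p) p with hM
    have hM0 : 0 ≤ M := Finset.sum_nonneg fun _ _ => dist_nonneg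
    have hle : ∀ γ ∈ F, dist (ρ γ p) p ≤ M := fun γ hγ =>
      Finset.single_le_sum (f := fun γ : Γ => dist (ρ γ p) p) (fun _ _ => dist_nonneg) hγ
    have hbd : ∀ x ∈ N, dist (f x) p ≤ 2 * M := fun x hx => by
      have h1 : Ψ x p ≤ M ^ 2 := by
        rw [(hF x hx).1]
        calc ∑ γ ∈ F, w (x * γ) * dist (ρ γ p) p ^ 2 ≤ ∑ γ ∈ F, w (x * γ) * M ^ 2 :=
              Finset.sum_le_sum fun γ hγ => mul_le_mul_of_nonneg_left
                (pow_le_pow_left₀ dist_nonneg (hle γ hγ) 2) (hw0 _)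
          _ = M ^ 2 := by rw [← Finset.sum_mul, (hF x hx).2, one_mul]
      have h2 : dist (f x) p ^ 2 ≤ 2 * (Ψ x (f x) + Ψ x p) := by
        rw [(hF x hx).1, (hF x hx).1, ← Finset.sum_add_distrib, Finset.mul_sum,
          ← one_mul (dist (f x) p ^ 2), ← (hF x hx).2, Finset.sum_mul]
        refine Finset.sum_le_sum fun γ hγ => ?_
        rw [← mul_add, mul_left_comm]
        refine mul_le_mul_of_nonneg_left ?_ (hw0 _)
        have h3 := dist_triangle_left (f x) p (ρ γ p)
        nlinarith [sq_nonneg (dist (ρ γ p) (f x) - dist (ρ γ p) p), dist_nonneg (x := f x) (y := p)]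
      have h3 := hf x p
      exact abs_le_of_sq_le_sq' (by nlinarith) (by positivity) |>.2
    rw [Metric.continuousAt_iff']
    intro η hη
    obtain ⟨δ, hδ, H⟩ := (huc x₀).exists_dist_le (Ψ x₀ (f x₀)) (half_pos hη)
    set e : G → ℝ := fun x => ∑ γ ∈ F, |w (x * γ) - w (x₀ * γ)| * (3 * M) ^ 2 with he
    have hec : Continuous e := by fun_prop
    have he0 : e x₀ = 0 := by simp [he]
    have hclose : ∀ x ∈ N, ∀ q, dist q p ≤ 2 * M → |Ψ x q - Ψ x₀ q| ≤ e x := by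
      intro x hx q hq
      rw [(hF x hx).1, (hF x₀ (mem_of_mem_nhds hNx)).1, ← Finset.sum_sub_distrib]
      refine (Finset.abs_sum_le_sum_abs _ _).trans (Finset.sum_le_sum fun γ hγ => ?_)
      rw [← sub_mul, abs_mul, abs_of_nonneg (sq_nonneg (dist _ _))]
      refine mul_le_mul_of_nonneg_left (pow_le_pow_left₀ dist_nonneg ?_ 2) (abs_nonneg _)
      have h3 := dist_triangle (ρ γ p) p q
      rw [dist_comm p q] at h3
      linarith [hle γ hγ]
    have hev := (hec.tendsto x₀).eventually (gt_mem_nhds (show e x₀ < δ / 2 by rw [he0]; linarith))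
    filter_upwards [hev, hNx] with x hx hxN
    refine (H (Ψ x₀ (f x₀)) _ _ le_rfl ?_ (by linarith) (hf x₀ _)).trans_lt (half_lt_self hη)
    have h1 := abs_le.1 (hclose x hxN (f x) (hbd x hxN))
    have h2 := abs_le.1 (hclose x hxN (f x₀) (hbd x₀ (mem_of_mem_nhds hNx)))
    linarith [hf x (f x₀)]
  · refine (huniq _ _ fun q' => ?_).symm
    rw [hequiv, hequiv, apply_inv_apply]
    exact hf x _

end Barycentre

/-! ### Generators of a lattice -/

section Generation

variable {G : Type*} [Group G] {Γ : Subgroup G}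

/-- The Schreier argument: if `K Γ = G` and `L` generates `G`, then `Γ` is generated by its elements
in `K⁻¹ (L ∪ L⁻¹) K`. -/
theorem closure_schreier {K L : Set G} (hK1 : 1 ∈ K) (hL1 : 1 ∈ L)
    (hK : ∀ q : G ⧸ Γ, ∃ g ∈ K, (g : G ⧸ Γ) = q) (hL : Subgroup.closure L = ⊤) :
    Subgroup.closure {γ : Γ | (γ : G) ∈ K⁻¹ * (L ∪ L⁻¹) * K} = ⊤ := by
  set H := Subgroup.closure {γ : Γ | (γ : G) ∈ K⁻¹ * (L ∪ L⁻¹) * K} with hH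
  have hdec : ∀ g : G, ∃ k ∈ K, ∃ γ : Γ, g = k * γ := fun g => by
    obtain ⟨k, hk, hkg⟩ := hK g
    exact ⟨k, hk, ⟨k⁻¹ * g, QuotientGroup.eq.1 hkg⟩, by simp⟩
  have hstep : ∀ l ∈ L ∪ L⁻¹, ∀ g : G, (∃ k ∈ K, ∃ γ ∈ H, g = k * γ) →
      ∃ k ∈ K, ∃ γ ∈ H, l * g = k * γ := by
    rintro l hl _ ⟨k, hk, γ, hγ, rfl⟩
    obtain ⟨k', hk', γ', h⟩ := hdec (l * k)
    refine ⟨k', hk', γ' * γ, H.mul_mem (Subgroup.subset_closure ?_) hγ, ?_⟩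
    · have : (γ' : G) = k'⁻¹ * l * k := by rw [mul_assoc, h]; simp
      change (γ' : G) ∈ K⁻¹ * (L ∪ L⁻¹) * K
      rw [this]
      exact Set.mul_mem_mul (Set.mul_mem_mul (Set.inv_mem_inv.2 hk') hl) hk
    · rw [← mul_assoc, h, mul_assoc]
      rfl
  have hall : ∀ g : G, ∃ k ∈ K, ∃ γ ∈ H, g = k * γ := by
    intro g
    have hg : g ∈ Subgroup.closure L := hL ▸ Subgroup.mem_top g
    induction hg using Subgroup.closure_induction_left with
    | one => exact ⟨1, hK1, 1, H.one_mem, by simp⟩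
    | mul_left x hx y _ ih => exact hstep x (Or.inl hx) y ih
    | inv_mul_cancel x hx y _ ih => exact hstep x⁻¹ (Or.inr (Set.inv_mem_inv.2 hx)) y ih
  rw [eq_top_iff]
  intro γ _
  obtain ⟨k, hk, γ', hγ', h⟩ := hall γ
  have hkΓ : k = ((γ * γ'⁻¹ : Γ) : G) := by
    rw [Subgroup.coe_mul, h]
    simp
  have hmem : γ * γ'⁻¹ ∈ H := Subgroup.subset_closure (by
    change ((γ * γ'⁻¹ : Γ) : G) ∈ K⁻¹ * (L ∪ L⁻¹) * K
    rw [← hkΓ, ← one_mul k, ← mul_one (1 : G)]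
    exact Set.mul_mem_mul (Set.mul_mem_mul (Set.mem_inv.2 (by simpa using hK1)) (Or.inl hL1)) hk)
  simpa using H.mul_mem hmem hγ'

end Generation

/-! ### Properness of displacements -/

section Properness

open UniformSpace

variable {G : Type*} [Group G] [TopologicalSpace G] [IsTopologicalGroup G] {Γ : Subgroup G}
  {X : Type*} [MetricSpace X] {ρ : Γ →* (X ≃ᵢ X)} [MeasurableSpace (G ⧸ Γ)] {ν : Measure (G ⧸ Γ)}
  [MeasurableSpace G] [BorelSpace G] (μ : Measure G) [μ.IsHaarMeasure]

/-- The square of the displacement of `u x` under an element of `Γ` is controlled by the mean square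
of the distances `d(u x, u (s⁻¹ x))`. -/
theorem EquivMap.sq_displacement_le (u : EquivMap ρ ν) {φ ψ : G → ℝ} (hφ : Continuous φ)
    (hφs : HasCompactSupport φ) (hψ : Continuous ψ) (hψs : HasCompactSupport ψ)
    (hψ0 : ∀ s, 0 ≤ ψ s) (x : G) (γ : Γ) (h1 : ∀ s, ψ s ≤ φ s)
    (h2 : ∀ s, ψ s ≤ φ (x * γ * x⁻¹ * s)) :
    dist (u x) (ρ γ (u x)) ^ 2 * ∫ s, ψ s ∂μ ≤
      4 * ∫ s, φ s * dist (u x) (u (s⁻¹ * x)) ^ 2 ∂μ := by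
  set A : G → ℝ := fun s => dist (u x) (u (s⁻¹ * x)) ^ 2 with hA
  set g := x * γ * x⁻¹ with hg
  have hAc : Continuous A := (continuous_const.dist (u.continuous.comp (by fun_prop))).pow 2
  have hi : Integrable (fun s => φ s * A s) μ :=
    (hφ.mul hAc).integrable_of_hasCompactSupport hφs.mul_right
  have hi' : Integrable (fun s => φ (g * s) * A (g * s)) μ := hi.comp_mul_left g
  have hpt : ∀ s, ψ s * dist (u x) (ρ γ (u x)) ^ 2 ≤
      2 * (φ s * A s) + 2 * (φ (g * s) * A (g * s)) := by
    intro s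
    have e1 : dist (u x) (ρ γ (u x)) = dist (u (x * γ)) (u x) := by
      rw [u.map_mul, ← (ρ γ).dist_eq (ρ γ⁻¹ (u x)), apply_inv_apply]
    have e2 : dist (u (x * γ)) (u (s⁻¹ * x)) = dist (u x) (u ((g * s)⁻¹ * x)) := by
      have : s⁻¹ * x = (g * s)⁻¹ * x * γ := by rw [hg]; group
      rw [this, u.map_mul, u.map_mul, IsometryEquiv.dist_eq]
    have h3 := dist_triangle_right (u (x * γ)) (u x) (u (s⁻¹ * x))
    rw [← e1, e2] at h3
    have h4 : dist (u x) (ρ γ (u x)) ^ 2 ≤ 2 * A (g * s) + 2 * A s := by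
      simp only [hA]
      nlinarith [sq_nonneg (dist (u x) (u ((g * s)⁻¹ * x)) - dist (u x) (u (s⁻¹ * x))),
        dist_nonneg (x := u x) (y := ρ γ (u x))]
    have hA0 : ∀ s, 0 ≤ A s := fun s => sq_nonneg _
    nlinarith [mul_le_mul_of_nonneg_left h4 (hψ0 s), mul_le_mul_of_nonneg_right (h1 s) (hA0 s),
      mul_le_mul_of_nonneg_right (h2 s) (hA0 (g * s))]
  have hint : ∫ s, ψ s * dist (u x) (ρ γ (u x)) ^ 2 ∂μ ≤
      ∫ s, (2 * (φ s * A s) + 2 * (φ (g * s) * A (g * s))) ∂μ :=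
    integral_mono ((hψ.integrable_of_hasCompactSupport hψs).mul_const _)
      ((hi.const_mul 2).add (hi'.const_mul 2)) hpt
  rw [integral_mul_const, integral_add (hi.const_mul 2) (hi'.const_mul 2), integral_const_mul,
    integral_const_mul, integral_mul_left_eq_self (fun s => φ s * A s) g] at hint
  linarith

variable [CompactSpace (G ⧸ Γ)] [BorelSpace (G ⧸ Γ)] [IsProbabilityMeasure ν]

/-- If `u` has small displacement in the mean, then at some point `q` the mean square of the
distances `d(u(q), u(s⁻¹ q))` is small. -/
theorem EquivMap.exists_integral_gap_sq_le (u : EquivMap ρ ν) {φ : G → ℝ} (hφ : Continuous φ)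
    (hφs : HasCompactSupport φ) (hφ0 : ∀ s, 0 ≤ φ s) {R : ℝ}
    (h : ∀ s, φ s ≠ 0 → dist (s • u) u ≤ R) :
    ∃ q : G ⧸ Γ, ∫ s, φ s * gap (s • u) u q ^ 2 ∂μ ≤ R ^ 2 * ∫ s, φ s ∂μ := by
  have hi : Integrable (fun s => φ s • (gap (s • u) u) ^ 2) μ :=
    (hφ.smul ((continuous_gap_smul u u).pow 2)).integrable_of_hasCompactSupport hφs.smul_right
  set H : C(G ⧸ Γ, ℝ) := ∫ s, φ s • (gap (s • u) u) ^ 2 ∂μ with hH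
  obtain ⟨q, hq⟩ := exists_le_integral (μ := ν) (integrable_continuousMap ν H)
  refine ⟨q, ?_⟩
  have hHq : H q = ∫ s, φ s * gap (s • u) u q ^ 2 ∂μ := ContinuousMap.integral_apply hi q
  rw [← hHq]
  refine hq.trans ?_
  set ℓ : C(G ⧸ Γ, ℝ) →L[ℝ] ℝ := (innerSL ℝ (toL2 ν (1 : C(G ⧸ Γ, ℝ)))).comp (toL2 ν) with hℓ
  have hℓi : ∀ F, ℓ F = ∫ q, F q ∂ν := fun F => by
    rw [hℓ, ContinuousLinearMap.comp_apply, innerSL_apply_apply, ContinuousMap.inner_toLp]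
    simp
  rw [← hℓi, hH, ← ContinuousLinearMap.integral_comp_comm _ hi, ← integral_const_mul]
  refine integral_mono (ℓ.integrable_comp hi)
    ((hφ.integrable_of_hasCompactSupport hφs).const_mul _) fun s => ?_
  beta_reduce
  rw [map_smul, hℓi, smul_eq_mul, mul_comm (R ^ 2)]
  by_cases hs : φ s = 0
  · simp [hs]
  · refine mul_le_mul_of_nonneg_left ?_ (hφ0 s)
    refine (dist_sq (s • u) u).symm.trans_le ?_
    exact pow_le_pow_left₀ dist_nonneg (h s hs) 2

variable [T2Space G] [LocallyCompactSpace G]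
  [SMulInvariantMeasure G (G ⧸ Γ) ν]

/-- The displacement of the translation action is proper on the space of equivariant maps, if that
of `Γ` is proper on `X`. A map `u` moved little by a compact set of elements of `G` is, near some
point `x` of a fundamental set `K`, close in the mean to the constant `u x`; the point `u x` is then
moved little by the generators of `Γ`, hence stays in a bounded set, and `u` is close to it in the
mean on all of `G ⧸ Γ`. -/
theorem exists_isBounded_displacement (hG : IsCompactlyGeneratedGroup G)
    (hdisp : ∀ S : Set Γ, Subgroup.closure S = ⊤ → ∀ R : ℝ,
      Bornology.IsBounded {x : X | ∀ s ∈ S, dist x (ρ s x) ≤ R})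
    (hLow : ∃ θ : G → ℝ, Continuous θ ∧ HasCompactSupport θ ∧ (∀ s, 0 ≤ θ s) ∧
      ∀ F : C(G ⧸ Γ, ℝ), (∀ q, 0 ≤ F q) → ∀ x : G ⧸ Γ,
        ∫ q, F q ∂ν ≤ ∫ s, θ s * F (s⁻¹ • x) ∂μ) (u₀ : EquivMap ρ ν) :
    ∃ S : Set G, IsCompact S ∧ ∀ R : ℝ,
      ∃ B : ℝ, ∀ f : L2Maps ρ ν, (∀ s ∈ S, dist (s • f) f ≤ R) → dist f u₀ ≤ B := by
  obtain ⟨θ, hθ, hθs, hθ0, hLow⟩ := hLow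
  obtain ⟨L₀, hL₀, hLgen⟩ := hG
  obtain ⟨K₀, hK₀, hKq⟩ := exists_compact_image_mk_eq_univ Γ
  set K : Set G := insert 1 K₀ with hKdef
  set L : Set G := insert 1 L₀ with hLdef
  have hK : IsCompact K := hK₀.insert 1
  have hL : IsCompact L := hL₀.insert 1
  have hLtop : Subgroup.closure L = ⊤ := by
    rw [eq_top_iff, ← hLgen]
    exact Subgroup.closure_mono (Set.subset_insert _ _)
  have hKq' : ∀ q : G ⧸ Γ, ∃ g ∈ K, (g : G ⧸ Γ) = q := fun q =>
    let ⟨g, hg, hgq⟩ := hKq q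
    ⟨g, Set.mem_insert_of_mem _ hg, hgq⟩
  set E : Set Γ := {γ : Γ | (γ : G) ∈ K⁻¹ * (L ∪ L⁻¹) * K} with hE
  have hgen : Subgroup.closure E = ⊤ :=
    closure_schreier (Set.mem_insert _ _) (Set.mem_insert _ _) hKq' hLtop
  set T : Set G := K * (K⁻¹ * (L ∪ L⁻¹) * K) * K⁻¹ with hT
  have hTc : IsCompact T := (hK.mul ((hK.inv.mul (hL.union hL.inv)).mul hK)).mul hK.inv
  obtain ⟨ψ, hψ, hψs, hψ0, hψ1, -⟩ :=
    exists_approximate_identity μ (Filter.univ_mem (f := 𝓝 (1 : G)))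
  obtain ⟨M, hM⟩ := hψs.exists_bound_of_continuous hψ
  have hM0 : 0 ≤ M := (norm_nonneg _).trans (hM 1)
  obtain ⟨φ₁, hφ₁, hφ₁s, hφ₁0, hφ₁M⟩ :=
    exists_hasCompactSupport_eq (hψs.isCompact.union (hTc.mul hψs.isCompact)) hM0
  -- the weight `φ` dominates the bump `ψ` and its translates by `T`, as needed to estimate the
  -- displacement of `u x` under `Γ`, and the weight `θ`, as needed to estimate the distance to `u₀`
  set φ : G → ℝ := fun s => φ₁ s + θ s with hφdef
  have hφ : Continuous φ := hφ₁.add hθ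
  have hφs : HasCompactSupport φ := hφ₁s.add hθs
  have hφ0 : ∀ s, 0 ≤ φ s := fun s => add_nonneg (hφ₁0 s) (hθ0 s)
  have hθφ : ∀ s, θ s ≤ φ s := fun s => le_add_of_nonneg_left (hφ₁0 s)
  have hψle : ∀ s ∈ tsupport ψ ∪ T * tsupport ψ, ∀ t, ψ t ≤ φ s := fun s hs t =>
    ((le_abs_self _).trans (hM t)).trans
      ((hφ₁M s hs).symm.le.trans (le_add_of_nonneg_right (hθ0 s)))
  have hψφ : ∀ s, ψ s ≤ φ s := fun s => by
    by_cases hs : s ∈ tsupport ψ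
    · exact hψle s (Or.inl hs) s
    · rw [image_eq_zero_of_notMem_tsupport hs]
      exact hφ0 s
  have hψφT : ∀ g ∈ T, ∀ s, ψ s ≤ φ (g * s) := fun g hg s => by
    by_cases hs : s ∈ tsupport ψ
    · exact hψle (g * s) (Or.inr (Set.mul_mem_mul hg hs)) s
    · rw [image_eq_zero_of_notMem_tsupport hs]
      exact hφ0 _
  set I := ∫ s, φ s ∂μ with hI
  set p₀ : X := u₀ 1 with hp₀
  obtain ⟨B₂, hB₂⟩ : ∃ B₂ : ℝ, ∀ s ∈ tsupport θ, ∀ x ∈ K, dist (u₀ (s⁻¹ * x)) p₀ ≤ B₂ := by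
    have hc : Continuous fun p : G × G => dist (u₀ (p.1⁻¹ * p.2)) p₀ :=
      (u₀.continuous.comp (by fun_prop)).dist continuous_const
    obtain ⟨B, hB⟩ := (hθs.isCompact.prod hK).bddAbove_image hc.continuousOn
    exact ⟨B, fun s hs x hx => hB ⟨(s, x), ⟨hs, hx⟩, rfl⟩⟩
  have key : ∀ R : ℝ, ∃ B : ℝ, ∀ u : EquivMap ρ ν,
      (∀ s ∈ tsupport φ, dist (s • u) u ≤ R) → dist u u₀ ≤ B := by
    intro R
    obtain ⟨B₁, hB₁⟩ := (hdisp E hgen (√(4 * (R ^ 2 * I)))).subset_closedBall p₀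
    refine ⟨√(3 * (R ^ 2 * I + (B₁ ^ 2 + B₂ ^ 2) * ∫ s, θ s ∂μ)), fun u hu => ?_⟩
    obtain ⟨q, hq⟩ := u.exists_integral_gap_sq_le μ hφ hφs hφ0
      (fun s hs => hu s (subset_tsupport _ hs))
    obtain ⟨x, hx, rfl⟩ := hKq' q
    have hgap : ∀ s, EquivMap.gap (s • u) u (x : G ⧸ Γ) = dist (u x) (u (s⁻¹ * x)) := fun s =>
      dist_comm _ _
    simp only [hgap] at hq
    -- the point `u x` has small displacement under the generators
    have hpx : dist (u x) p₀ ≤ B₁ := by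
      refine hB₁ (fun γ hγ => Real.le_sqrt_of_sq_le ?_)
      have := u.sq_displacement_le μ hφ hφs hψ hψs hψ0 x γ hψφ
        (hψφT _ (Set.mul_mem_mul (Set.mul_mem_mul hx hγ) (Set.inv_mem_inv.2 hx)))
      rw [hψ1, mul_one] at this
      linarith
    refine Real.le_sqrt_of_sq_le ?_
    rw [EquivMap.dist_sq]
    refine (hLow ((u.gap u₀) ^ 2) (fun q => sq_nonneg _) x).trans ?_
    have hAc : Continuous fun s : G => dist (u x) (u (s⁻¹ * x)) ^ 2 :=
      (continuous_const.dist (u.continuous.comp (by fun_prop))).pow 2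
    have hi : Integrable (fun s => φ s * dist (u x) (u (s⁻¹ * x)) ^ 2) μ :=
      (hφ.mul hAc).integrable_of_hasCompactSupport hφs.mul_right
    have hiθ : Integrable (fun s => (B₁ ^ 2 + B₂ ^ 2) * θ s) μ :=
      (hθ.integrable_of_hasCompactSupport hθs).const_mul _
    have hFc : Continuous fun s : G => ((u.gap u₀) ^ 2) (s⁻¹ • (x : G ⧸ Γ)) := by fun_prop
    calc ∫ s, θ s * ((u.gap u₀) ^ 2) (s⁻¹ • (x : G ⧸ Γ)) ∂μ
        ≤ ∫ s, 3 * (φ s * dist (u x) (u (s⁻¹ * x)) ^ 2 + (B₁ ^ 2 + B₂ ^ 2) * θ s) ∂μ := by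
          refine integral_mono ((hθ.mul hFc).integrable_of_hasCompactSupport hθs.mul_right)
            ((hi.add hiθ).const_mul 3) fun s => ?_
          change θ s * dist (u (s⁻¹ * x)) (u₀ (s⁻¹ * x)) ^ 2 ≤ _
          by_cases hs : s ∈ tsupport θ
          · have h1 := dist_triangle4 (u (s⁻¹ * x)) (u x) p₀ (u₀ (s⁻¹ * x))
            rw [dist_comm (u (s⁻¹ * x)) (u x), dist_comm p₀] at h1
            have h2 := hB₂ s hs x hx
            set a := dist (u x) (u (s⁻¹ * x))
            have h3 : dist (u (s⁻¹ * x)) (u₀ (s⁻¹ * x)) ^ 2 ≤ (a + B₁ + B₂) ^ 2 :=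
              pow_le_pow_left₀ dist_nonneg (by linarith) 2
            have h4 : dist (u (s⁻¹ * x)) (u₀ (s⁻¹ * x)) ^ 2 ≤ 3 * (a ^ 2 + (B₁ ^ 2 + B₂ ^ 2)) := by
              nlinarith [sq_nonneg (a - B₁), sq_nonneg (a - B₂), sq_nonneg (B₁ - B₂)]
            nlinarith [mul_le_mul_of_nonneg_left h4 (hθ0 s),
              mul_le_mul_of_nonneg_right (hθφ s) (sq_nonneg a)]
          · rw [image_eq_zero_of_notMem_tsupport hs]
            have := mul_nonneg (hφ0 s) (sq_nonneg (dist (u x) (u (s⁻¹ * x))))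
            linarith
      _ = 3 * (∫ s, φ s * dist (u x) (u (s⁻¹ * x)) ^ 2 ∂μ + (B₁ ^ 2 + B₂ ^ 2) * ∫ s, θ s ∂μ) := by
          rw [integral_const_mul, integral_add hi hiθ, integral_const_mul]
      _ ≤ _ := by linarith
  refine ⟨tsupport φ, hφs, fun R => ?_⟩
  obtain ⟨B, hB⟩ := key (R + 2)
  refine ⟨1 + B, fun f hf => ?_⟩
  obtain ⟨_, ⟨u, rfl⟩, hu⟩ := Metric.mem_closure_iff.1
    (Completion.denseRange_coe (α := EquivMap ρ ν) f) 1 one_pos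
  have h1 : dist u u₀ ≤ B := hB u fun s hs => by
    rw [← Completion.dist_eq, Completion.coe_smul]
    have h2 := dist_triangle4 (s • (u : L2Maps ρ ν)) (s • f) f u
    rw [dist_smul, dist_comm (u : L2Maps ρ ν) f] at h2
    linarith [hf s hs]
  rw [← Completion.dist_eq] at h1
  have h2 := dist_triangle f (u : L2Maps ρ ν) (u₀ : L2Maps ρ ν)
  linarith

end Properness

/-! ### Linear growth of displacements -/

section LinearGrowth

open MidSpace

variable {G : Type*} [Group G] [TopologicalSpace G] [IsTopologicalGroup G] {Γ : Subgroup G}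
  {X : Type*} [MetricSpace X] [MidSpace X] {ρ : Γ →* (X ≃ᵢ X)} [MeasurableSpace (G ⧸ Γ)]
  {ν : Measure (G ⧸ Γ)} [CompactSpace (G ⧸ Γ)] [BorelSpace (G ⧸ Γ)] [IsProbabilityMeasure ν]
  [SMulInvariantMeasure G (G ⧸ Γ) ν]

/-- Displacements grow linearly: if all sets of bounded displacement are bounded, convexity of the
displacement functions gives a lower bound by a multiple of the distance to a base point. -/
theorem exists_linear_growth {S : Set G} (hS : IsCompact S) (f₀ : L2Maps ρ ν)
    (h : ∀ R : ℝ, ∃ B : ℝ, ∀ f : L2Maps ρ ν, (∀ s ∈ S, dist (s • f) f ≤ R) → dist f f₀ ≤ B) :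
    ∃ R₀ : ℝ, 0 < R₀ ∧ ∀ f : L2Maps ρ ν, R₀ < dist f f₀ →
      ∃ s ∈ S, dist f f₀ ≤ R₀ * dist (s • f) f := by
  obtain ⟨M, hM⟩ := hS.bddAbove_image
    ((continuous_smul_const f₀).dist (continuous_const (y := f₀))).continuousOn
  obtain ⟨B, hB⟩ := h (M + 1)
  set R₁ := |B| + 1 with hR₁
  have hR₁0 : 0 < R₁ := by positivity
  refine ⟨2 * R₁, by positivity, fun f hf => ?_⟩
  -- contracting towards `f₀` by the factor `2 ^ n` brings `f` just outside of the ball of radius `B`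
  obtain ⟨n, hn1, hn2⟩ : ∃ n : ℕ, R₁ ≤ dist f f₀ / 2 ^ n ∧ dist f f₀ / 2 ^ n ≤ 2 * R₁ := by
    obtain ⟨n, hn1, hn2⟩ := exists_nat_pow_near (x := dist f f₀ / R₁) (y := 2)
      ((one_le_div hR₁0).2 (by linarith)) one_lt_two
    refine ⟨n, ?_, ?_⟩
    · rwa [le_div_iff₀ hR₁0, mul_comm, ← le_div_iff₀ (by positivity)] at hn1
    · rw [div_le_iff₀ (by positivity)]
      rw [div_lt_iff₀ hR₁0, pow_succ] at hn2
      linarith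
  have hfar : ¬ ∀ s ∈ S, dist (s • (mid f₀)^[n] f) ((mid f₀)^[n] f) ≤ M + 1 := fun hall => by
    have h1 := hB _ hall
    rw [dist_comm, dist_iterate_mid, dist_comm] at h1
    linarith [le_abs_self B]
  push Not at hfar
  obtain ⟨s, hs, hlt⟩ := hfar
  refine ⟨s, hs, ?_⟩
  have h1 := (midConvexFun_dist_isometry (translation (ρ := ρ) (ν := ν) s)).iterate_mid_le f₀ f n
  simp only [translation_apply] at h1
  rw [dist_comm, dist_comm f₀, dist_comm f] at h1
  have h2 : dist (s • f₀) f₀ ≤ M := hM ⟨s, hs, rfl⟩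
  have hp : (0 : ℝ) < 2 ^ n := by positivity
  have h3 : 1 < dist (s • f) f / 2 ^ n := by
    have : (dist (s • f) f - dist (s • f₀) f₀) / 2 ^ n ≤ dist (s • f) f / 2 ^ n := by
      gcongr
      linarith [dist_nonneg (x := s • f₀) (y := f₀)]
    linarith
  rw [one_lt_div hp] at h3
  rw [div_le_iff₀ hp] at hn2
  nlinarith

end LinearGrowth

/-! ### Continuity of square-integrable equivariant maps -/

section Regularity

open MidSpace UniformSpace

variable {G : Type*} [Group G] [TopologicalSpace G] {Γ : Subgroup G}
  {X : Type*} [MetricSpace X] {ρ : Γ →* (X ≃ᵢ X)} [MeasurableSpace (G ⧸ Γ)] {ν : Measure (G ⧸ Γ)}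
  [CompactSpace (G ⧸ Γ)] [BorelSpace (G ⧸ Γ)] [IsProbabilityMeasure ν] [ν.IsOpenPosMeasure]

/-- As `ν` charges all open sets, a continuous map is determined by its class. -/
theorem EquivMap.coe_injective :
    Function.Injective fun u : EquivMap ρ ν => (u : L2Maps ρ ν) := fun u v h => by
  have h1 : gapL2 (u : L2Maps ρ ν) v = 0 := by
    rw [show (u : L2Maps ρ ν) = v from h, gapL2_self]
  rw [gapL2_coe, ← map_zero (toL2 ν)] at h1
  have h2 := ContinuousMap.toLp_injective ν h1
  refine EquivMap.ext fun g => dist_eq_zero.1 ?_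
  rw [← EquivMap.gap_mk, h2]
  rfl

/-- Continuity criterion: if `f` is at continuous distance `H u` from every continuous equivariant
map `u`, and at every point some of these distances are arbitrarily small, then `f` is continuous. -/
theorem exists_coe_eq_of_gap [CompleteSpace X] {f : L2Maps ρ ν} {H : EquivMap ρ ν → C(G ⧸ Γ, ℝ)}
    (hH : ∀ u : EquivMap ρ ν, toL2 ν (H u) = gapL2 (u : L2Maps ρ ν) f)
    (hinf : ∀ (x : G) (ε : ℝ), 0 < ε → ∃ u, H u (x : G ⧸ Γ) ≤ ε) :
    ∃ v : EquivMap ρ ν, (v : L2Maps ρ ν) = f := by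
  have htri : ∀ u u' q, EquivMap.gap u u' q ≤ H u q + H u' q := fun u u' q => by
    refine le_of_toL2_le ν (H := H u + H u') ?_ q
    rw [map_add, hH, hH, ← gapL2_coe, gapL2_comm (u' : L2Maps ρ ν) f]
    exact gapL2_triangle _ _ _
  have htri' : ∀ u u' q, H u q ≤ EquivMap.gap u u' q + H u' q := fun u u' q => by
    refine le_of_toL2_le ν (H := EquivMap.gap u u' + H u') ?_ q
    rw [map_add, hH, hH, ← gapL2_coe]
    exact gapL2_triangle _ _ _
  have hpt : ∀ x : G, ∃ y : X, ∀ u, dist (u x) y = H u (x : G ⧸ Γ) := by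
    intro x
    choose w hw using fun n : ℕ => hinf x (1 / ((n : ℝ) + 1)) (by positivity)
    have hlim := tendsto_one_div_add_atTop_nhds_zero_nat (𝕜 := ℝ)
    have hcau : CauchySeq fun n => w n x := by
      rw [Metric.cauchySeq_iff]
      intro ε hε
      obtain ⟨N, hN⟩ := eventually_atTop.1 (hlim.eventually (gt_mem_nhds (half_pos hε)))
      refine ⟨N, fun m hm n hn => ?_⟩
      have := htri (w m) (w n) x
      rw [EquivMap.gap_mk] at this
      linarith [hw m, hw n, hN m hm, hN n hn]
    obtain ⟨y, hy⟩ := cauchySeq_tendsto_of_complete hcau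
    refine ⟨y, fun u => ?_⟩
    have h1 : Tendsto (fun n => dist (u x) (w n x)) atTop (𝓝 (dist (u x) y)) :=
      tendsto_const_nhds.dist hy
    refine tendsto_nhds_unique h1 ?_
    rw [tendsto_iff_dist_tendsto_zero]
    refine squeeze_zero (fun _ => dist_nonneg) (fun n => ?_) hlim
    have h2 := htri u (w n) x
    have h3 := htri' u (w n) x
    rw [EquivMap.gap_mk] at h2 h3
    rw [Real.dist_eq, abs_le]
    constructor <;> linarith [hw n]
  have huniq : ∀ (x : G) (y y' : X), (∀ u : EquivMap ρ ν, dist (u x) y = H u (x : G ⧸ Γ)) →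
      (∀ u : EquivMap ρ ν, dist (u x) y' = H u (x : G ⧸ Γ)) → y = y' := fun x y y' hy hy' => by
    refine dist_le_zero.1 (le_of_forall_pos_le_add fun ε hε => ?_)
    obtain ⟨u, hu⟩ := hinf x (ε / 2) (half_pos hε)
    have := dist_triangle_left y y' (u x)
    rw [hy, hy'] at this
    linarith
  choose v hv using hpt
  have hvc : Continuous v := by
    rw [continuous_iff_continuousAt]
    intro x
    rw [Metric.continuousAt_iff']
    intro ε hε
    obtain ⟨u, hu⟩ := hinf x (ε / 5) (by positivity)
    have h1 : Tendsto (fun x' : G => H u (x' : G ⧸ Γ)) (𝓝 x) (𝓝 (H u (x : G ⧸ Γ))) :=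
      ((H u).continuous.comp QuotientGroup.continuous_mk).tendsto x
    filter_upwards [h1.eventually (gt_mem_nhds (show H u (x : G ⧸ Γ) < 2 * (ε / 5) by linarith)),
      (Metric.continuousAt_iff'.1 u.continuous.continuousAt) (ε / 5) (by positivity)] with x' h2 h3
    have h4 := dist_triangle4 (v x') (u x') (u x) (v x)
    rw [dist_comm (v x') (u x'), hv, hv] at h4
    linarith
  refine ⟨⟨v, hvc, fun x γ => huniq (x * γ) _ _ (hv _) fun u => ?_⟩, ?_⟩
  · rw [u.map_mul, IsometryEquiv.dist_eq, hv]
    congr 1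
    exact QuotientGroup.eq.2 (by simp)
  · set v' : EquivMap ρ ν := ⟨v, hvc, _⟩ with hv'
    have h1 : ∀ u, EquivMap.gap u v' = H u := fun u => by
      ext q
      obtain ⟨x, rfl⟩ := QuotientGroup.mk_surjective q
      exact hv x u
    rw [← dist_eq_zero, ← norm_gapL2, ← hH, ← h1, EquivMap.gap_self, map_zero,
      norm_zero]

variable [IsTopologicalGroup G] [LocallyCompactSpace G] [T2Space (G ⧸ Γ)] [ν.Regular]
  [MeasurableSpace G] [BorelSpace G] (μ : Measure G) [μ.IsHaarMeasure]
  [SMulInvariantMeasure G (G ⧸ Γ) ν] [CompleteSpace X]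

/-- A square-integrable equivariant map which is moved uniformly little by small elements of `G`
is continuous. -/
theorem exists_coe_eq_of_modulus
    (hUp : BoundedAverages μ ν) {f : L2Maps ρ ν}
    (hf : ∀ ε : ℝ, 0 < ε → ∀ᶠ g : G in 𝓝 1, gapL2 (g • f) f ≤ toL2 ν (ContinuousMap.const _ ε)) :
    ∃ v : EquivMap ρ ν, (v : L2Maps ρ ν) = f := by
  have hrep : ∀ u : EquivMap ρ ν, ∃ H : C(G ⧸ Γ, ℝ), toL2 ν H = gapL2 (u : L2Maps ρ ν) f := by
    intro u
    refine exists_toL2_eq_of_modulus μ ν hUp fun ε hε => ?_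
    have h2 : Tendsto (fun g : G => ‖EquivMap.gap (g • u) u‖) (𝓝 1)
        (𝓝 ‖EquivMap.gap ((1 : G) • u) u‖) :=
      (EquivMap.continuous_gap_smul u u).norm.tendsto 1
    rw [one_smul, EquivMap.gap_self, norm_zero] at h2
    filter_upwards [hf (ε / 2) (half_pos hε), h2.eventually (gt_mem_nhds (half_pos hε))] with g h3 h4
    have h5 : gapL2 (g • (u : L2Maps ρ ν)) u ≤ toL2 ν (ContinuousMap.const _ (ε / 2)) := by
      rw [← Completion.coe_smul, gapL2_coe]
      refine toL2_mono ν fun q => ?_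
      exact (le_abs_self _).trans ((ContinuousMap.norm_coe_le_norm _ q).trans h4.le)
    have h6 : toL2 ν (ContinuousMap.const _ ε) = toL2 ν (ContinuousMap.const _ (ε / 2)) +
        toL2 ν (ContinuousMap.const (G ⧸ Γ) (ε / 2)) := by
      rw [← map_add]
      congr 1
      ext
      simp
    rw [← gapL2_smul_smul, h6, abs_le_iff_Lp]
    constructor
    · rw [neg_le_sub_iff_le_add]
      calc gapL2 (u : L2Maps ρ ν) f
          ≤ gapL2 (u : L2Maps ρ ν) (g • (u : L2Maps ρ ν)) +
            (gapL2 (g • (u : L2Maps ρ ν)) (g • f) + gapL2 (g • f) f) :=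
            (gapL2_triangle _ _ _).trans (add_le_add_right (gapL2_triangle _ _ _) _)
        _ ≤ toL2 ν (ContinuousMap.const _ (ε / 2)) + (gapL2 (g • (u : L2Maps ρ ν)) (g • f) +
            toL2 ν (ContinuousMap.const _ (ε / 2))) := by
            rw [gapL2_comm (u : L2Maps ρ ν)]
            gcongr
        _ = _ := by abel
    · rw [sub_le_iff_le_add]
      calc gapL2 (g • (u : L2Maps ρ ν)) (g • f)
          ≤ gapL2 (g • (u : L2Maps ρ ν)) u + (gapL2 (u : L2Maps ρ ν) f + gapL2 f (g • f)) :=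
            (gapL2_triangle _ _ _).trans (add_le_add_right (gapL2_triangle _ _ _) _)
        _ ≤ toL2 ν (ContinuousMap.const _ (ε / 2)) + (gapL2 (u : L2Maps ρ ν) f +
            toL2 ν (ContinuousMap.const _ (ε / 2))) := by
            rw [gapL2_comm f]
            gcongr
        _ = _ := by abel
  choose H hH using hrep
  have hH0 : ∀ u q, 0 ≤ H u q := fun u q => by
    refine le_of_toL2_le ν (F := 0) ?_ q
    rw [map_zero, hH]
    exact gapL2_nonneg _ _
  refine exists_coe_eq_of_gap hH fun x ε hε => ?_
  obtain ⟨U, hU, hUo, hU1⟩ := eventually_nhds_iff.1 (hf (ε / 2) (half_pos hε))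
  -- the distance to a good approximation of `f` is small somewhere near `x`
  set V : Set (G ⧸ Γ) := (fun h : G => ((h * x : G) : G ⧸ Γ)) '' U with hV
  have hVo : IsOpen V := by
    have : IsOpenMap fun h : G => ((h * x : G) : G ⧸ Γ) :=
      QuotientGroup.isOpenMap_coe.comp (isOpenMap_mul_right x)
    exact this U hUo
  have hVpos : 0 < ν.real V := by
    rw [measureReal_def, ENNReal.toReal_pos_iff]
    exact ⟨hVo.measure_pos ν ⟨_, ⟨1, hU1, rfl⟩⟩, measure_lt_top _ _⟩
  obtain ⟨_, ⟨u, rfl⟩, hu⟩ := Metric.mem_closure_iff.1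
    (Completion.denseRange_coe (α := EquivMap ρ ν) f) (ε / 2 * ν.real V) (by positivity)
  obtain ⟨h, hhU, hh⟩ : ∃ h ∈ U, H u ((h * x : G) : G ⧸ Γ) ≤ ε / 2 := by
    by_contra! hall
    have h1 : V ⊆ {q | ε / 2 ≤ H u q} := by
      rintro _ ⟨h, hh, rfl⟩
      exact (hall h hh).le
    have h2 := mul_meas_ge_le_integral_of_nonneg (μ := ν) (ae_of_all _ (hH0 u))
      (integrable_continuousMap ν (H u)) (ε / 2)
    have h3 : ∫ q, H u q ∂ν ≤ dist f u := by
      rw [dist_comm, ← norm_gapL2, ← hH]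
      refine le_trans (le_of_eq ?_) (integral_abs_le_norm ν (H u))
      simp only [abs_of_nonneg (hH0 u _)]
    have h4 : ν.real V ≤ ν.real {q | ε / 2 ≤ H u q} := measureReal_mono h1
    nlinarith
  refine ⟨h⁻¹ • u, ?_⟩
  have h1 : ∀ q, H (h⁻¹ • u) q ≤ H u (h • q) + ε / 2 := fun q => by
    refine (le_of_toL2_le ν (F := H (h⁻¹ • u))
      (H := trC h⁻¹ (H u) + ContinuousMap.const _ (ε / 2)) ?_ q).trans_eq ?_
    · rw [map_add, hH, toL2_trC, hH, ← gapL2_smul_smul, Completion.coe_smul]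
      refine (gapL2_triangle _ (h⁻¹ • f) _).trans (add_le_add_right ?_ _)
      have h5 := trL_mono ν h⁻¹ (hU h hhU)
      rw [← gapL2_smul_smul, inv_smul_smul, trL_const, gapL2_comm] at h5
      exact h5
    · simp
  have h2 := h1 x
  have h3 : h • (x : G ⧸ Γ) = ((h * x : G) : G ⧸ Γ) := rfl
  rw [h3] at h2
  linarith

end Regularity

/-! ### Minimal sets for the action of a factor -/

section ProductDecomposition

open MidSpace UniformSpace

variable {G : Type*} [Group G] [TopologicalSpace G] [IsTopologicalGroup G] {Γ : Subgroup G}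
  {X : Type*} [MetricSpace X] {ρ : Γ →* (X ≃ᵢ X)} [MeasurableSpace (G ⧸ Γ)] {ν : Measure (G ⧸ Γ)}
  [CompactSpace (G ⧸ Γ)] [BorelSpace (G ⧸ Γ)] [IsProbabilityMeasure ν] {π : G →* G}

variable (π) in
/-- The square-integrable equivariant maps which are fixed by `N` and which every element `b` of
the kernel of `π` moves, uniformly, at most as far as it moves `u₀`. The endomorphism `π` stands for
the projection of a product onto a factor. -/
def TameMaps (N : Set G) (u₀ : EquivMap ρ ν) : Set (L2Maps ρ ν) :=
  {f | (∀ g ∈ N, g • f = f) ∧ ∀ b, π b = 1 →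
    gapL2 (b • f) f ≤ toL2 ν (ContinuousMap.const _ ‖EquivMap.gap (b • u₀) u₀‖)}

theorem dist_smul_le_of_mem_tameMaps {N : Set G} {u₀ : EquivMap ρ ν} {f : L2Maps ρ ν}
    (hf : f ∈ TameMaps π N u₀) {b : G} (hb : π b = 1) :
    dist (b • f) f ≤ ‖EquivMap.gap (b • u₀) u₀‖ := by
  rw [← norm_gapL2, ← abs_of_nonneg (norm_nonneg (EquivMap.gap (b • u₀) u₀)), ← norm_toL2_const ν]
  apply norm_le_norm_of_abs_le_abs
  rw [abs_of_nonneg (gapL2_nonneg _ _)]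
  exact (hf.2 b hb).trans (le_abs_self _)

variable [MidSpace X] [SMulInvariantMeasure G (G ⧸ Γ) ν]

/-- Tame maps are preserved by the image of `π`, because it commutes with the kernel. -/
theorem isInvConvex_tameMaps (hcomm : ∀ g h, π h = 1 → π g * h = h * π g) {N : Set G}
    (hN : ∀ g ∈ N, π g = 1) {u₀ : EquivMap ρ ν} (hu₀ : ∀ g ∈ N, g • u₀ = u₀) :
    IsInvConvex ((translation (ρ := ρ) (ν := ν)).comp π) (TameMaps π N u₀) where
  nonempty := by
    refine ⟨u₀, fun g hg => ?_, fun b _ => ?_⟩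
    · rw [← Completion.coe_smul, hu₀ g hg]
    · rw [← Completion.coe_smul, gapL2_coe]
      exact toL2_mono ν fun q => (le_abs_self _).trans
        (ContinuousMap.norm_coe_le_norm (EquivMap.gap (b • u₀) u₀) q)
  isClosed := by
    simp only [TameMaps, Set.ofPred_and, Set.ofPred_forall]
    refine (isClosed_iInter fun g => isClosed_iInter fun _ =>
      isClosed_eq (continuous_const_smul g) continuous_id).inter
      (isClosed_iInter fun b => isClosed_iInter fun _ =>
        isClosed_le (Continuous.gapL2 (continuous_const_smul b) continuous_id) continuous_const)
  midConvex f hf f' hf' := by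
    refine ⟨fun g hg => by rw [smul_mid, hf.1 g hg, hf'.1 g hg], fun b hb => ?_⟩
    rw [smul_mid]
    refine (gapL2_mid_mid_le _ _ _ _).trans ?_
    refine (smul_le_smul_Lp ν (by norm_num) (add_le_add (hf.2 b hb) (hf'.2 b hb))).trans_eq ?_
    rw [← two_smul ℝ, smul_smul]
    norm_num
  map_mem g f hf := by
    refine ⟨fun h hh => ?_, fun b hb => ?_⟩
    · change h • π g • f = π g • f
      rw [smul_smul, ← hcomm g h (hN h hh), mul_smul, hf.1 h hh]
    · change gapL2 (b • π g • f) (π g • f) ≤ _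
      rw [smul_smul, ← hcomm g b hb, mul_smul, gapL2_smul_smul,
        ← trL_const ν (π g) ‖EquivMap.gap (b • u₀) u₀‖]
      exact trL_mono ν _ (hf.2 b hb)

/-- Minimal invariant subsets exist: a nearest point projection of `u₀` has sublinear displacement
under the image of `π` and bounded displacement under the kernel, which contradicts linear growth
if it is far from `u₀`. -/
theorem exists_minimal_tameMaps (hπc : Continuous π) (hidem : ∀ g, π (π g) = π g)
    (hcomm : ∀ g h, π h = 1 → π g * h = h * π g) {N : Set G}
    (hN : ∀ g ∈ N, π g = 1) {u₀ : EquivMap ρ ν} (hu₀ : ∀ g ∈ N, g • u₀ = u₀)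
    {S : Set G} (hS : IsCompact S) {R₀ : ℝ} (hR₀ : 0 < R₀)
    (hgrow : ∀ f : L2Maps ρ ν, R₀ < dist f u₀ → ∃ s ∈ S, dist f u₀ ≤ R₀ * dist (s • f) f) :
    ∃ C ⊆ TameMaps π N u₀, Minimal (IsInvConvex ((translation (ρ := ρ) (ν := ν)).comp π)) C := by
  obtain ⟨M₁, hM₁⟩ := hS.bddAbove_image (f := fun s : G => dist (π s • (u₀ : L2Maps ρ ν)) u₀)
    (((continuous_smul_const (u₀ : L2Maps ρ ν)).comp hπc).dist continuous_const).continuousOn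
  have hc : Continuous fun s : G => ‖EquivMap.gap (((π s)⁻¹ * s) • u₀) u₀‖ :=
    ((EquivMap.continuous_gap_smul u₀ u₀).comp (hπc.inv.mul continuous_id)).norm
  obtain ⟨M₂, hM₂⟩ := hS.bddAbove_image hc.continuousOn
  obtain ⟨R₁, hR₁⟩ := exists_displacement_nearest_le (Z := L2Maps ρ ν) M₁
    (η := 1 / (2 * R₀)) (by positivity)
  refine exists_minimal_isInvConvex _ (isInvConvex_tameMaps hcomm hN hu₀) (u₀ : L2Maps ρ ν)
    (max (max R₀ R₁) (2 * R₀ * M₂)) fun C hCsub hC => ?_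
  obtain ⟨p, hp, hmin⟩ := exists_nearest (u₀ : L2Maps ρ ν) hC.nonempty hC.isClosed hC.midConvex
  refine ⟨p, hp, ?_⟩
  by_contra! hlt
  obtain ⟨h1, h2⟩ := max_lt_iff.1 hlt
  obtain ⟨h1, h3⟩ := max_lt_iff.1 h1
  obtain ⟨s, hs, hsd⟩ := hgrow p (by rwa [dist_comm])
  have h4 : dist (π s • p) p ≤ 1 / (2 * R₀) * dist (u₀ : L2Maps ρ ν) p := by
    rw [dist_comm (π s • p)]
    exact hR₁ (translation (π s)) C u₀ p hC.midConvex (fun q hq => hC.map_mem s q hq) hp hmin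
      (by rw [dist_comm]; exact hM₁ ⟨s, hs, rfl⟩) h3.le
  have h5 : dist (((π s)⁻¹ * s) • p) p ≤ M₂ :=
    (dist_smul_le_of_mem_tameMaps (hCsub hp) (by rw [map_mul, map_inv, hidem, inv_mul_cancel])).trans
      (hM₂ ⟨s, hs, rfl⟩)
  have h6 : dist (s • p) (π s • p) = dist (((π s)⁻¹ * s) • p) p := by
    rw [mul_smul, ← dist_smul (π s) ((π s)⁻¹ • s • p) p, smul_inv_smul]
  have h7 := dist_triangle (s • p) (π s • p) p
  rw [dist_comm p] at hsd
  have h8 : R₀ * (1 / (2 * R₀) * dist (u₀ : L2Maps ρ ν) p) = dist (u₀ : L2Maps ρ ν) p / 2 := by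
    field_simp
  have h9 : R₀ * dist (s • p) p ≤
      R₀ * (M₂ + 1 / (2 * R₀) * dist (u₀ : L2Maps ρ ν) p) :=
    mul_le_mul_of_nonneg_left (by linarith) hR₀.le
  rw [mul_add, h8] at h9
  linarith

variable {C : Set (L2Maps ρ ν)}

/-- On a minimal set, an element commuting with the image of `π` has the same displacement, as a
class in `L²`, at all points. -/
theorem gapL2_smul_eq_of_minimal
    (hC : Minimal (IsInvConvex ((translation (ρ := ρ) (ν := ν)).comp π)) C) {b : G}
    (hb : ∀ g, π g * b = b * π g) {f f' : L2Maps ρ ν} (hf : f ∈ C) (hf' : f' ∈ C) :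
    gapL2 (b • f) f = gapL2 (b • f') f' := by
  have hconst : ∀ f ∈ C, ∀ f' ∈ C, dist (b • f) f = dist (b • f') f' := fun f hf f' hf' => by
    refine minimal_eq_of_convex hC (F := fun f => dist (b • f) f)
      ((continuous_const_smul b).dist continuous_id).continuousOn (fun x _ y _ => ?_)
      (fun g x _ => ?_) hf hf'
    · rw [smul_mid]
      exact dist_mid_mid_le _ _ _ _
    · change dist (b • π g • x) (π g • x) ≤ _
      rw [smul_smul, ← hb, mul_smul, dist_smul]
  have hm := hC.1.midConvex f hf f' hf'
  refine eq_of_le_half_add ν (m := gapL2 (b • mid f f') (mid f f')) (gapL2_nonneg _ _) ?_ ?_ ?_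
  · rw [smul_mid]
    exact gapL2_mid_mid_le _ _ _ _
  · rw [norm_gapL2, norm_gapL2, hconst f hf _ hm]
  · rw [norm_gapL2, norm_gapL2, hconst f' hf' _ hm]

/-- On a minimal set, the distances between two points, as classes in `L²`, are invariant under the
elements commuting with the image of `π`. -/
theorem trL_gapL2_eq_of_minimal
    (hC : Minimal (IsInvConvex ((translation (ρ := ρ) (ν := ν)).comp π)) C) {b : G}
    (hb : ∀ g, π g * b = b * π g) {f f' : L2Maps ρ ν} (hf : f ∈ C) (hf' : f' ∈ C) :
    trL ν b (gapL2 f f') = gapL2 f f' := by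
  have hm := hC.1.midConvex f hf f' hf'
  have hd : ∀ h ∈ C, dist h (b • h) = dist f (b • f) := fun h hh => by
    rw [dist_comm, ← norm_gapL2, gapL2_smul_eq_of_minimal hC hb hh hf, norm_gapL2, dist_comm]
  have h1 : dist f f' ≤ dist (mid f (b • f)) (mid f' (b • f')) :=
    dist_le_of_parallel rfl (hd f' hf') (by rw [← smul_mid]; exact hd _ hm)
  have h2 : dist (mid f (b • f)) (mid f' (b • f')) ≤ dist f f' := by
    refine (dist_mid_mid_le _ _ _ _).trans_eq ?_
    rw [dist_smul]
    ring
  have h3 := le_antisymm h1 h2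
  refine (eq_of_le_half_add ν (m := gapL2 (mid f (b • f)) (mid f' (b • f'))) (gapL2_nonneg _ _)
    (f := gapL2 f f') ?_ ?_ ?_).symm
  · rw [← gapL2_smul_smul]
    exact gapL2_mid_mid_le _ _ _ _
  · rw [norm_gapL2, norm_gapL2, h3]
  · rw [LinearIsometry.norm_map, norm_gapL2, norm_gapL2, h3]

end ProductDecomposition

/-! ### The alternative for one factor -/

section Dichotomy

open MidSpace UniformSpace

variable {G : Type*} [Group G] [TopologicalSpace G] [IsTopologicalGroup G] [LocallyCompactSpace G]
  {Γ : Subgroup G} {X : Type*} [MetricSpace X] [MidSpace X]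
  {ρ : Γ →* (X ≃ᵢ X)} [MeasurableSpace (G ⧸ Γ)] {ν : Measure (G ⧸ Γ)}
  [CompactSpace (G ⧸ Γ)] [T2Space (G ⧸ Γ)] [BorelSpace (G ⧸ Γ)] [IsProbabilityMeasure ν]
  [ν.IsOpenPosMeasure] [ν.Regular] [SMulInvariantMeasure G (G ⧸ Γ) ν]
  [MeasurableSpace G] [BorelSpace G] (μ : Measure G) [μ.IsHaarMeasure] {π : G →* G}
  {C : Set (L2Maps ρ ν)}

/-- On a minimal set distances between points are constant functions, by ergodicity of the kernel
of `π`. -/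
theorem gapL2_eq_const_of_minimal
    (hUp : BoundedAverages μ ν)
    (hcomm : ∀ g h, π h = 1 → π g * h = h * π g)
    (herg : ∀ F : C(G ⧸ Γ, ℝ), (∀ b ∈ π.ker, trC b F = F) → ∃ a, F = ContinuousMap.const _ a)
    (hC : Minimal (IsInvConvex ((translation (ρ := ρ) (ν := ν)).comp π)) C)
    {f f' : L2Maps ρ ν} (hf : f ∈ C) (hf' : f' ∈ C) :
    gapL2 f f' = toL2 ν (ContinuousMap.const _ (dist f f')) := by
  obtain ⟨a, ha⟩ := eq_const_of_invariant μ ν hUp π.ker herg (f := gapL2 f f') fun b hb =>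
    trL_gapL2_eq_of_minimal hC (fun g => hcomm g b hb) hf hf'
  have h1 : |a| = dist f f' := by rw [← norm_gapL2, ha, norm_toL2_const]
  have h2 : 0 ≤ a := by
    refine le_of_toL2_le ν (F := 0) (H := ContinuousMap.const _ a) ?_ ((1 : G) : G ⧸ Γ)
    rw [map_zero, ← ha]
    exact gapL2_nonneg _ _
  rw [ha, ← h1, abs_of_nonneg h2]

variable [CompleteSpace X]

/-- The points of a minimal set of tame maps are continuous maps. -/
theorem exists_coe_eq_of_mem_minimal
    (hUp : BoundedAverages μ ν)
    (hπc : Continuous π) (hidem : ∀ g, π (π g) = π g)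
    (hcomm : ∀ g h, π h = 1 → π g * h = h * π g)
    (herg : ∀ F : C(G ⧸ Γ, ℝ), (∀ b ∈ π.ker, trC b F = F) → ∃ a, F = ContinuousMap.const _ a)
    (hC : Minimal (IsInvConvex ((translation (ρ := ρ) (ν := ν)).comp π)) C)
    {N : Set G} {u₀ : EquivMap ρ ν} (hCsub : C ⊆ TameMaps π N u₀) {f : L2Maps ρ ν} (hf : f ∈ C) :
    ∃ v : EquivMap ρ ν, (v : L2Maps ρ ν) = f := by
  refine exists_coe_eq_of_modulus μ hUp fun ε hε => ?_
  set m : G → ℝ := fun g =>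
    ‖EquivMap.gap (((π g)⁻¹ * g) • u₀) u₀‖ + dist (π g • f) f with hm
  have hmc : Continuous m :=
    ((EquivMap.continuous_gap_smul u₀ u₀).comp (hπc.inv.mul continuous_id)).norm.add
      (((continuous_smul_const f).comp hπc).dist continuous_const)
  have hm1 : m 1 = 0 := by simp [hm, EquivMap.gap_self]
  filter_upwards [(hmc.tendsto 1).eventually (gt_mem_nhds (show m 1 < ε by rwa [hm1]))] with g hg
  set b := (π g)⁻¹ * g with hb
  have hb1 : π b = 1 := by rw [hb, _root_.map_mul, map_inv, hidem, inv_mul_cancel]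
  have hgb : g = π g * b := by rw [hb, mul_inv_cancel_left]
  have h1 := trL_mono ν (π g) ((hCsub hf).2 b hb1)
  rw [← gapL2_smul_smul, trL_const, ← mul_smul, ← hgb] at h1
  have h2 := gapL2_eq_const_of_minimal μ hUp hcomm herg hC (hC.1.map_mem g f hf) hf
  refine (gapL2_triangle _ (π g • f) _).trans ((add_le_add h1 h2.le).trans ?_)
  rw [← map_add]
  exact toL2_mono ν fun q => hg.le

/-- The alternative at the heart of the argument. Here `π` is the projection of a product onto one
of its factors, viewed as an endomorphism, and the minimal set `C` of tame maps is either bounded,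
hence a point, or unbounded, in which case evaluation identifies it with `X`. -/
theorem exists_fixed_or_tendsto
    (hUp : BoundedAverages μ ν)
    (hπc : Continuous π) (hidem : ∀ g, π (π g) = π g)
    (hcomm : ∀ g h, π h = 1 → π g * h = h * π g)
    (herg : ∀ F : C(G ⧸ Γ, ℝ), (∀ b ∈ π.ker, trC b F = F) → ∃ a, F = ContinuousMap.const _ a)
    (hred : IsReduced ρ)
    (hCL : ∀ T : X ≃ᵢ X, IsClifford T → T = IsometryEquiv.refl X)
    {N : Set G} (hN : ∀ g ∈ N, π g = 1) {u₀ : EquivMap ρ ν} (hu₀ : ∀ g ∈ N, g • u₀ = u₀)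
    {S : Set G} (hS : IsCompact S) {R₀ : ℝ} (hR₀ : 0 < R₀)
    (hgrow : ∀ f : L2Maps ρ ν, R₀ < dist f u₀ → ∃ s ∈ S, dist f u₀ ≤ R₀ * dist (s • f) f) :
    (∃ v : EquivMap ρ ν, (∀ g ∈ N, g • v = v) ∧ ∀ g, π g • v = v) ∨
      ∃ p : X, Tendsto (fun γ : Γ => dist (ρ γ p) p) (comap (fun γ : Γ => π γ) (𝓝 1)) (𝓝 0) := by
  obtain ⟨C, hCsub, hC⟩ := exists_minimal_tameMaps hπc hidem hcomm hN hu₀ hS hR₀ hgrow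
  have hrep : ∀ f : C, ∃ v : EquivMap ρ ν, (v : L2Maps ρ ν) = f := fun f =>
    exists_coe_eq_of_mem_minimal μ hUp hπc hidem hcomm herg hC hCsub f.2
  choose v hv using hrep
  have hne : Nonempty C := hC.1.nonempty.to_subtype
  by_cases hb : Bornology.IsBounded C
  · left
    have hsub := minimal_subsingleton_of_isBounded hC hb
    obtain ⟨f⟩ := hne
    refine ⟨v f, fun g hg => EquivMap.coe_injective ?_, fun g => EquivMap.coe_injective ?_⟩
    · simp only [Completion.coe_smul, hv]
      exact (hCsub f.2).1 g hg
    · simp only [Completion.coe_smul, hv]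
      exact hsub (hC.1.map_mem g f f.2) f.2
  right
  have hgap : ∀ f f' : C, EquivMap.gap (v f) (v f') = ContinuousMap.const _ (dist f f') :=
    fun f f' => ContinuousMap.toLp_injective ν (p := 2) (𝕜 := ℝ) (by
      change toL2 ν _ = toL2 ν _
      rw [← gapL2_coe, hv, hv]
      exact gapL2_eq_const_of_minimal μ hUp hcomm herg hC f.2 f'.2)
  -- evaluation at `x` is an isometric embedding of `C`
  have hiso : ∀ x : G, Isometry fun f : C => v f x := fun x => Isometry.of_dist_eq fun f f' => by
    rw [← EquivMap.gap_mk, hgap]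
    rfl
  have hCcomplete : CompleteSpace C := hC.1.isClosed.completeSpace_coe
  have hmid : ∀ (f f' : C) (x : G),
      mid (v f x) (v f' x) = v ⟨mid f f', hC.1.midConvex f f.2 f' f'.2⟩ x := fun f f' x => by
    have : EquivMap.midMap (v f) (v f') = v ⟨mid f f', hC.1.midConvex f f.2 f' f'.2⟩ :=
      EquivMap.coe_injective (by
        simp only
        rw [← mid_coe, hv, hv, hv])
    rw [← this]
    rfl
  have hact : ∀ (f : C) (g x : G),
      v ⟨π g • (f : L2Maps ρ ν), hC.1.map_mem g f f.2⟩ x = v f ((π g)⁻¹ * x) := fun f g x => by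
    have : π g • v f = v ⟨π g • (f : L2Maps ρ ν), hC.1.map_mem g f f.2⟩ :=
      EquivMap.coe_injective (by simp only [Completion.coe_smul, hv])
    rw [← this]
    rfl
  have hker : ∀ (f : C) (b x : G), π b = 1 →
      dist (v f (b⁻¹ * x)) (v f x) ≤ ‖EquivMap.gap (b • u₀) u₀‖ := fun f b x hb => by
    have h1 := (hCsub f.2).2 b hb
    rw [← hv, ← Completion.coe_smul, gapL2_coe] at h1
    exact le_of_toL2_le ν h1 x
  have hrange : ∀ x : G, Set.range (fun f : C => v f x) = Set.univ := by
    intro x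
    refine hred.eq_univ (fun hbd => hb ?_) (hiso x).isClosedEmbedding.isClosed_range ?_ fun γ => ?_
    · obtain ⟨B, hB⟩ := Metric.isBounded_iff.1 hbd
      refine Metric.isBounded_iff.2 ⟨B, fun f hf f' hf' => ?_⟩
      have := hB ⟨⟨f, hf⟩, rfl⟩ ⟨⟨f', hf'⟩, rfl⟩
      rwa [(hiso x).dist_eq] at this
    · rintro _ ⟨f, rfl⟩ _ ⟨f', rfl⟩
      exact ⟨_, (hmid f f' x).symm⟩
    · -- `γ` moves `v f x` close to `v (π g • f) x`, where `g = x γ x⁻¹`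
      set g := x * γ * x⁻¹ with hg
      set b := ((π g)⁻¹ * g) with hbdef
      have hb1 : π b = 1 := by rw [hbdef, _root_.map_mul, map_inv, hidem, inv_mul_cancel]
      have hgb : g = π g * b := by rw [hbdef, mul_inv_cancel_left]
      set M := ‖EquivMap.gap (b • u₀) u₀‖ with hM
      have key : ∀ f : C, dist (ρ γ (v f x))
          (v ⟨π g • (f : L2Maps ρ ν), hC.1.map_mem g f f.2⟩ x) ≤ M := fun f => by
        have h1 : ρ γ (v f x) = v f (b⁻¹ * ((π g)⁻¹ * x)) := by
          have h2 : b⁻¹ * ((π g)⁻¹ * x) = x * (γ⁻¹ : Γ) := by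
            rw [← mul_assoc, ← mul_inv_rev, ← hgb, hg]
            simp [mul_assoc]
          rw [h2, EquivMap.map_mul, inv_inv]
        rw [h1, hact]
        exact hker f b _ hb1
      refine ne_top_of_le_ne_top (ENNReal.ofReal_ne_top (r := M))
        (Metric.hausdorffEDist_le_of_mem_edist ?_ ?_)
      · rintro _ ⟨f, rfl⟩
        have hinv : π g⁻¹ • (f : L2Maps ρ ν) ∈ C := hC.1.map_mem g⁻¹ f f.2
        refine ⟨_, ⟨_, ⟨⟨_, hinv⟩, rfl⟩, rfl⟩, ?_⟩
        have h1 := key ⟨_, hinv⟩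
        simp only [map_inv, smul_inv_smul] at h1
        rw [edist_comm, edist_dist]
        refine ENNReal.ofReal_le_ofReal ?_
        simp only [map_inv]
        exact h1
      · rintro _ ⟨_, ⟨f, rfl⟩, rfl⟩
        refine ⟨v ⟨π g • (f : L2Maps ρ ν), hC.1.map_mem g f f.2⟩ x, ⟨_, rfl⟩, ?_⟩
        rw [edist_dist]
        exact ENNReal.ofReal_le_ofReal (key f)
  -- comparing evaluations at `x` and `b x` gives Clifford isometries, so the maps are invariant
  -- under the kernel of `π`
  have hinv : ∀ (f : C) (b x : G), π b = 1 → v f (b * x) = v f x := by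
    intro f b x hb
    let e : G → (C ≃ᵢ X) := fun x => IsometryEquiv.mk (Equiv.ofBijective (fun f : C => v f x)
      ⟨(hiso x).injective, Set.range_eq_univ.1 (hrange x)⟩) (hiso x)
    have he : ∀ x (f : C), e x f = v f x := fun x f => rfl
    set T : X ≃ᵢ X := (e x).symm.trans (e (b * x)) with hT
    have hTv : ∀ f : C, T (v f x) = v f (b * x) := fun f => by
      rw [hT, IsometryEquiv.trans_apply, ← he x f, IsometryEquiv.symm_apply_apply, he]
    have hcl : IsClifford T := by
      refine ⟨dist (v f x) (v f (b * x)), fun y => ?_⟩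
      obtain ⟨f', rfl⟩ := Set.range_eq_univ.1 (hrange x) y
      simp only [hTv]
      have hg : EquivMap.gap (b⁻¹ • v f') (v f') = EquivMap.gap (b⁻¹ • v f) (v f) :=
        ContinuousMap.toLp_injective ν (p := 2) (𝕜 := ℝ) (by
          change toL2 ν _ = toL2 ν _
          rw [← gapL2_coe, ← gapL2_coe, Completion.coe_smul, Completion.coe_smul, hv, hv]
          exact gapL2_smul_eq_of_minimal hC
            (fun g => hcomm g b⁻¹ (by rw [map_inv, hb, inv_one])) f'.2 f.2)
      have h1 := DFunLike.congr_fun hg (x : G ⧸ Γ)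
      rw [EquivMap.gap_mk, EquivMap.gap_mk, EquivMap.smul_apply, EquivMap.smul_apply, inv_inv] at h1
      rw [dist_comm, h1, dist_comm]
    rw [← hTv, hCL T hcl]
    rfl
  obtain ⟨f⟩ := hne
  refine ⟨v f 1, ?_⟩
  have hlim : Tendsto (fun g : G => dist (v f 1) (v f g)) (𝓝 1) (𝓝 (dist (v f 1) (v f 1))) :=
    (continuous_const.dist (v f).continuous).tendsto 1
  rw [dist_self] at hlim
  refine (hlim.comp tendsto_comap).congr fun γ => ?_
  have hb1 : π ((γ : G) * (π γ)⁻¹) = 1 := by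
    rw [_root_.map_mul, map_inv, hidem, mul_inv_cancel]
  have h1 : v f (γ : G) = v f (π γ) := by
    rw [← hinv f _ (π γ) hb1, inv_mul_cancel_right]
  have h2 := EquivMap.map_mul (v f) 1 γ
  rw [one_mul] at h2
  rw [Function.comp_apply, ← h1, h2, ← (ρ γ).dist_eq, apply_inv_apply]

end Dichotomy

/-! ### Uniqueness of the extension -/

section Uniqueness

open MidSpace

variable {G : Type*} [Group G] [TopologicalSpace G] [IsTopologicalGroup G] {Γ : Subgroup G}
  {X : Type*} [MetricSpace X] {ρ : Γ →* (X ≃ᵢ X)} [MeasurableSpace (G ⧸ Γ)] {ν : Measure (G ⧸ Γ)}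

/-- The orbit map `g ↦ g⁻¹ x` of a continuous action extending that of `Γ`. -/
noncomputable def EquivMap.ofAction {α : G →* (X ≃ᵢ X)} (hα : IsContinuousAction α)
    (h : Extends α ρ) (x : X) : EquivMap ρ ν where
  toFun := fun g => α g⁻¹ x
  continuous_toFun := hα.comp (continuous_inv.prodMk continuous_const)
  map_mul' := fun g γ => by
    rw [mul_inv_rev, _root_.map_mul, ← h γ⁻¹]
    rfl

theorem EquivMap.ofAction_apply {α : G →* (X ≃ᵢ X)} (hα : IsContinuousAction α)
    (h : Extends α ρ) (x : X) (g : G) : ofAction (ν := ν) hα h x g = α g⁻¹ x := rfl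

theorem EquivMap.smul_ofAction {α : G →* (X ≃ᵢ X)} (hα : IsContinuousAction α)
    (h : Extends α ρ) (x : X) (γ : Γ) :
    (γ : G) • ofAction (ν := ν) hα h x = ofAction hα h (ρ γ x) := by
  refine EquivMap.ext fun g => ?_
  rw [smul_apply, ofAction_apply, ofAction_apply, mul_inv_rev, inv_inv, _root_.map_mul, h]
  rfl

variable [CompactSpace (G ⧸ Γ)] [BorelSpace (G ⧸ Γ)] [IsProbabilityMeasure ν]

theorem EquivMap.dist_ofAction_le {α : G →* (X ≃ᵢ X)} (hα : IsContinuousAction α)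
    (h : Extends α ρ) (x y : X) :
    dist (ofAction (ν := ν) hα h x) (ofAction hα h y) ≤ dist x y := by
  refine (dist_le_norm_gap _ _).trans ((ContinuousMap.norm_le _ dist_nonneg).2 fun q => ?_)
  obtain ⟨g, rfl⟩ := QuotientGroup.mk_surjective q
  rw [gap_mk, ofAction_apply, ofAction_apply, IsometryEquiv.dist_eq, Real.norm_of_nonneg dist_nonneg]

theorem EquivMap.continuous_ofAction {α : G →* (X ≃ᵢ X)} (hα : IsContinuousAction α)
    (h : Extends α ρ) : Continuous fun x => (ofAction hα h x : EquivMap ρ ν) :=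
  (LipschitzWith.of_dist_le_mul (K := 1) fun x y => by
    simpa using dist_ofAction_le (ν := ν) hα h x y).continuous

/-- Two continuous actions of `G` extending the given action of `Γ` coincide: the distance of their
orbit maps is a convex invariant function of the base point, hence constant, and strict convexity
of `L²` turns this into a Clifford isometry for each element of `G`. -/
theorem eq_of_extends [MidSpace X] [CompleteSpace X] (ν : Measure (G ⧸ Γ)) [IsProbabilityMeasure ν]
    [ν.IsOpenPosMeasure] [SMulInvariantMeasure G (G ⧸ Γ) ν]
    (hred : IsReduced ρ) (hfix : ¬ HasGlobalFixedPoint ρ)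
    (hCL : ∀ T : X ≃ᵢ X, IsClifford T → T = IsometryEquiv.refl X)
    {α β : G →* (X ≃ᵢ X)} (hα : IsContinuousAction α) (hαρ : Extends α ρ)
    (hβ : IsContinuousAction β) (hβρ : Extends β ρ) : β = α := by
  set u : X → EquivMap ρ ν := EquivMap.ofAction hα hαρ with hu
  set v : X → EquivMap ρ ν := EquivMap.ofAction hβ hβρ with hv
  have hmid : ∀ x y, EquivMap.gap (u (mid x y)) (v (mid x y)) =
      EquivMap.gap (EquivMap.midMap (u x) (u y)) (EquivMap.midMap (v x) (v y)) := fun x y => by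
    congr 1
    · exact EquivMap.ext fun g => map_mid _ _ _
    · exact EquivMap.ext fun g => map_mid _ _ _
  have hle : ∀ x y, toL2 ν (EquivMap.gap (u (mid x y)) (v (mid x y))) ≤
      (1 / 2 : ℝ) • (toL2 ν (EquivMap.gap (u x) (v x)) + toL2 ν (EquivMap.gap (u y) (v y))) := by
    intro x y
    rw [hmid, ← map_add, ← map_smul]
    refine toL2_mono ν fun q => (EquivMap.gap_midMap_midMap_le _ _ _ _ q).trans_eq ?_
    simp
    ring
  have hconst : ∀ x y, dist (u x) (v x) ≤ dist (u y) (v y) := by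
    intro x y
    have hinv : IsInvConvex ρ {x | dist (u x) (v x) ≤ dist (u y) (v y)} := by
      refine ⟨⟨y, le_refl (dist (u y) (v y))⟩, isClosed_le ((EquivMap.continuous_ofAction hα hαρ).dist
        (EquivMap.continuous_ofAction hβ hβρ)) continuous_const, ?_, fun γ x hx => ?_⟩
      · refine MidConvexFun.midConvex_le (fun x y => ?_) _
        rw [EquivMap.dist_def, hmid]
        exact EquivMap.dist_midMap_midMap_le _ _ _ _
      · change dist (u (ρ γ x)) (v (ρ γ x)) ≤ _
        rw [hu, hv, ← EquivMap.smul_ofAction, ← EquivMap.smul_ofAction, dist_smul]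
        exact hx
    have := hred.eq_univ_of_isInvConvex hfix hinv
    exact this.symm.subset (Set.mem_univ x)
  have heq : ∀ x y, EquivMap.gap (u x) (v x) = EquivMap.gap (u y) (v y) := fun x y =>
    ContinuousMap.toLp_injective ν (p := 2) (𝕜 := ℝ)
      (eq_of_le_half_add ν (by
        rw [← map_zero (toL2 ν)]
        exact toL2_mono ν (EquivMap.gap_nonneg (u (mid x y)) (v (mid x y)))) (hle x y)
        (le_antisymm (hconst _ _) (hconst _ _)) (le_antisymm (hconst _ _) (hconst _ _)))
  ext g x
  have hT : (α g) * (β g⁻¹) = 1 := by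
    refine hCL _ ⟨dist (α g⁻¹ x) (β g⁻¹ x), fun y => ?_⟩
    have h1 := DFunLike.congr_fun (heq x y) (g : G ⧸ Γ)
    change dist (α g⁻¹ x) (β g⁻¹ x) = dist (α g⁻¹ y) (β g⁻¹ y) at h1
    rw [h1, ← (α g).dist_eq (α g⁻¹ y), apply_inv_apply]
    rfl
  rw [map_inv, mul_inv_eq_one] at hT
  rw [hT]

end Uniqueness

/-! ### Projections of a product onto its factors -/

section Product

variable {n : ℕ} {G : Fin n → Type*} [∀ i, Group (G i)]

/-- The projection of a product of groups onto a factor, as an endomorphism of the product. -/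
def projection (i : Fin n) : (∀ i, G i) →* (∀ i, G i) :=
  (MonoidHom.mulSingle G i).comp (Pi.evalMonoidHom G i)

theorem projection_apply (i : Fin n) (g : ∀ i, G i) : projection i g = Pi.mulSingle i (g i) := rfl

theorem projection_eq_one {i : Fin n} {g : ∀ i, G i} : projection i g = 1 ↔ g i = 1 := by
  rw [projection_apply, Pi.mulSingle_eq_one_iff]

theorem continuous_projection [∀ i, TopologicalSpace (G i)] (i : Fin n) :
    Continuous (projection (G := G) i) :=
  (continuous_mulSingle i).comp (continuous_apply i)

theorem projection_projection (i : Fin n) (g : ∀ i, G i) :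
    projection i (projection i g) = projection i g := by
  simp [projection_apply]

theorem projection_mul_comm (i : Fin n) (g h : ∀ i, G i) (hh : projection i h = 1) :
    projection i g * h = h * projection i g := by
  rw [projection_eq_one] at hh
  funext j
  by_cases hj : j = i
  · subst hj
    simp [hh]
  · simp [projection_apply, hj]

variable [∀ i, TopologicalSpace (G i)] {Γ : Subgroup (∀ i, G i)}

/-- Irreducibility of `Γ` means that the kernel of each projection has a dense orbit in the quotient
by `Γ`, so that continuous functions invariant under it are constant. -/
theorem IsIrreducible.eq_const [∀ i, IsTopologicalGroup (G i)] (hirr : IsIrreducible Γ) (i : Fin n)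
    (F : C((∀ i, G i) ⧸ Γ, ℝ)) (hF : ∀ b ∈ (projection (G := G) i).ker, trC b F = F) :
    ∃ a, F = ContinuousMap.const _ a := by
  refine ⟨F ((1 : ∀ i, G i) : (∀ i, G i) ⧸ Γ), ?_⟩
  have hfun : (fun g : ∀ i, G i => F (g : (∀ i, G i) ⧸ Γ)) =
      fun _ => F ((1 : ∀ i, G i) : (∀ i, G i) ⧸ Γ) := by
    refine Continuous.ext_on (hirr i) (F.continuous.comp QuotientGroup.continuous_mk)
      continuous_const ?_
    rintro _ ⟨γ, hγ, b, hb, rfl⟩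
    have hb' : b⁻¹ ∈ (projection (G := G) i).ker := by
      rw [MonoidHom.mem_ker, projection_eq_one]
      have : b i = 1 := hb
      simp [this]
    have h1 := DFunLike.congr_fun (hF _ (Subgroup.Normal.conj_mem inferInstance _ hb' γ))
      ((1 : ∀ i, G i) : (∀ i, G i) ⧸ Γ)
    rw [trC_apply] at h1
    rw [← h1]
    change F _ = F (((γ * b⁻¹ * γ⁻¹)⁻¹ * 1 : ∀ i, G i) : (∀ i, G i) ⧸ Γ)
    congr 1
    refine QuotientGroup.eq.2 ?_
    convert Γ.inv_mem hγ using 1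
    group
  ext q
  obtain ⟨g, rfl⟩ := QuotientGroup.mk_surjective q
  exact congrFun hfun g

theorem IsIrreducible.denseRange (hirr : IsIrreducible Γ) (i : Fin n) :
    DenseRange ((Pi.evalMonoidHom G i).comp Γ.subtype) := by
  have h1 :=
    (Function.surjective_eval (β := G) i).denseRange.dense_image (continuous_apply i) (hirr i)
  refine h1.mono ?_
  rintro _ ⟨_, ⟨γ, hγ, b, hb, rfl⟩, rfl⟩
  refine ⟨⟨γ, hγ⟩, ?_⟩
  have : b i = 1 := hb
  simp [this]

end Product

/-! ### Existence of a factor through which the action extends -/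

section Main

variable {n : ℕ} {G : Fin n → Type*}
    [∀ i, Group (G i)] [∀ i, TopologicalSpace (G i)] [∀ i, IsTopologicalGroup (G i)]
    [∀ i, T2Space (G i)] [∀ i, LocallyCompactSpace (G i)] {Γ : Subgroup (∀ i, G i)}
    {X : Type*} [MetricSpace X] [CompleteSpace X] [MidSpace X] [Nonempty X] {ρ : Γ →* (X ≃ᵢ X)}
    [DiscreteTopology Γ] [CompactSpace ((∀ i, G i) ⧸ Γ)]
    [MeasurableSpace (∀ i, G i)] [BorelSpace (∀ i, G i)] (μ : Measure (∀ i, G i)) [μ.IsHaarMeasure]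
    [MeasurableSpace ((∀ i, G i) ⧸ Γ)] [BorelSpace ((∀ i, G i) ⧸ Γ)]
    {ν : Measure ((∀ i, G i) ⧸ Γ)} [IsProbabilityMeasure ν] [ν.Regular] [ν.IsOpenPosMeasure]
    [SMulInvariantMeasure (∀ i, G i) ((∀ i, G i) ⧸ Γ) ν]

/-- For some factor, `Γ`-elements which are small in that factor move some point of `X` little.
Otherwise one finds equivariant maps which are invariant under more and more factors, and finally
a constant one, whose value is a fixed point of `Γ`. -/
theorem exists_tendsto_dist (hG : IsCompactlyGeneratedGroup (∀ i, G i)) (hirr : IsIrreducible Γ)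
    (hUp : BoundedAverages μ ν)
    (hLow : ∃ θ : (∀ i, G i) → ℝ, Continuous θ ∧ HasCompactSupport θ ∧ (∀ s, 0 ≤ θ s) ∧
      ∀ F : C((∀ i, G i) ⧸ Γ, ℝ), (∀ q, 0 ≤ F q) → ∀ x : (∀ i, G i) ⧸ Γ,
        ∫ q, F q ∂ν ≤ ∫ s, θ s * F (s⁻¹ • x) ∂μ)
    (hCL : ∀ T : X ≃ᵢ X, IsClifford T → T = IsometryEquiv.refl X)
    (hred : IsReduced ρ) (hfix : ¬ HasGlobalFixedPoint ρ) :
    ∃ (i : Fin n) (p : X), Tendsto (fun γ : Γ => dist (ρ γ p) p)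
      (comap ((Pi.evalMonoidHom G i).comp Γ.subtype) (𝓝 1)) (𝓝 0) := by
  have := t2Space_quotient Γ
  by_contra hnot
  have key : ∀ J : Finset (Fin n), ∃ v : EquivMap ρ ν,
      ∀ g : ∀ i, G i, (∀ j ∉ J, g j = 1) → g • v = v := by
    intro J
    induction J using Finset.induction_on with
    | empty =>
      obtain ⟨v⟩ := nonempty_equivMap ρ ν
      refine ⟨v, fun g hg => ?_⟩
      rw [show g = 1 from funext fun j => hg j (Finset.notMem_empty j), one_smul]
    | insert i J hi ih =>
      obtain ⟨u₀, hu₀⟩ := ih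
      obtain ⟨S, hS, hB⟩ := exists_isBounded_displacement μ hG
        (fun S hS R => hred.isBounded_displacement hfix hCL hS R) hLow u₀
      obtain ⟨R₀, hR₀, hgrow⟩ := exists_linear_growth hS (u₀ : L2Maps ρ ν) hB
      rcases exists_fixed_or_tendsto μ hUp (continuous_projection i) (projection_projection i)
        (projection_mul_comm i) (hirr.eq_const i) hred hCL
        (N := {g | ∀ j ∉ J, g j = 1}) (fun g hg => projection_eq_one.2 (hg i hi)) hu₀ hS hR₀ hgrow
        with ⟨v, hvN, hvi⟩ | ⟨p, hp⟩
      · refine ⟨v, fun g hg => ?_⟩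
        have h1 : g = projection i g * ((projection i g)⁻¹ * g) := by rw [mul_inv_cancel_left]
        rw [h1, mul_smul, hvN _ ?_, hvi]
        intro j hj
        by_cases hji : j = i
        · subst hji
          simp [projection_apply]
        · have : g j = 1 := hg j (by simp [hji, hj])
          simp [projection_apply, hji, this]
      · refine absurd ⟨i, p, hp.mono_left ?_⟩ hnot
        have h1 : Tendsto (Pi.mulSingle i : G i → ∀ j, G j) (𝓝 1) (𝓝 1) := by
          simpa using (continuous_mulSingle (A := G) i).tendsto 1
        refine (comap_mono h1.le_comap).trans_eq ?_
        rw [comap_comap]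
        rfl
  obtain ⟨v, hv⟩ := key Finset.univ
  refine hfix ⟨v 1, fun γ => ?_⟩
  have h1 := v.map_mul 1 γ⁻¹
  rw [inv_inv, one_mul] at h1
  rw [← h1]
  conv_rhs => rw [← hv ((γ⁻¹ : Γ) : ∀ i, G i)⁻¹ (fun j hj => absurd (Finset.mem_univ j) hj)]
  rw [EquivMap.smul_apply, inv_inv, mul_one]

end Main

end Superrigidity

theorem theorem1 {n : ℕ} (hn : 1 < n) (G : Fin n → Type*)
    [∀ i, Group (G i)] [∀ i, TopologicalSpace (G i)] [∀ i, IsTopologicalGroup (G i)]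
    [∀ i, T2Space (G i)] [∀ i, LocallyCompactSpace (G i)]
    (hG : Superrigidity.IsCompactlyGeneratedGroup (∀ i, G i))
    (Γ : Subgroup (∀ i, G i))
    (hΓ : Superrigidity.IsUniformLattice Γ) (hirr : Superrigidity.IsIrreducible Γ)
    (X : Type*) [MetricSpace X] [CompleteSpace X]
    (hX : Superrigidity.IsBNPC X) (hUC : Superrigidity.IsUniformlyConvex X)
    (hCL : ∀ T : X ≃ᵢ X, Superrigidity.IsClifford T → T = IsometryEquiv.refl X)
    (ρ : Γ →* (X ≃ᵢ X)) (hred : Superrigidity.IsReduced ρ)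
    (hfix : ¬ Superrigidity.HasGlobalFixedPoint ρ) :
    ∃ α : (∀ i, G i) →* (X ≃ᵢ X),
      (Superrigidity.IsContinuousAction α ∧ Superrigidity.Extends α ρ) ∧
      (∀ β : (∀ i, G i) →* (X ≃ᵢ X),
        Superrigidity.IsContinuousAction β → Superrigidity.Extends β ρ → β = α) ∧
      ∃ i : Fin n, Superrigidity.FactorsThrough α i := by
  -- an empty `X` is allowed by the hypotheses, and has only one isometry
  rcases isEmpty_or_nonempty X with hX0 | hX0
  · have hsub : ∀ S T : X ≃ᵢ X, S = T := fun S T => IsometryEquiv.ext fun x => (hX0.false x).elim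
    refine ⟨1, ⟨continuous_of_const fun p => (hX0.false p.2).elim, fun γ => hsub _ _⟩,
      fun β _ _ => MonoidHom.ext fun g => hsub _ _, ⟨0, by omega⟩, 1,
      continuous_of_const fun p => (hX0.false p.2).elim, fun g => hsub _ _⟩
  let := hX.midSpace hUC
  have := hΓ.1
  have := hΓ.2
  let : MeasurableSpace (∀ i, G i) := borel _
  have : BorelSpace (∀ i, G i) := ⟨rfl⟩
  let : MeasurableSpace ((∀ i, G i) ⧸ Γ) := borel _
  have : BorelSpace ((∀ i, G i) ⧸ Γ) := ⟨rfl⟩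
  obtain ⟨ν, _, _, _, _, hUp, hLow⟩ :=
    Superrigidity.exists_invariant_measure (MeasureTheory.Measure.haar (G := ∀ i, G i)) Γ
  obtain ⟨i, p, hp⟩ := Superrigidity.exists_tendsto_dist _ hG hirr hUp hLow hCL hred hfix
  obtain ⟨αi, hαi, hext⟩ := hred.exists_continuous_extension (hirr.denseRange i) hfix p hp
  have hα : Superrigidity.IsContinuousAction (αi.comp (Pi.evalMonoidHom G i)) :=
    hαi.comp (((continuous_apply i).comp continuous_fst).prodMk continuous_snd)
  exact ⟨αi.comp (Pi.evalMonoidHom G i), ⟨hα, hext⟩,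
    fun β hβ hβρ => Superrigidity.eq_of_extends ν hred hfix hCL hα hext hβ hβρ,
    i, αi, hαi, fun g => rfl⟩
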